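/- **Background.** Let $a^*=3/(2(26+15\sqrt3))^{1/3}$, let $0<a<a^*$ and $\ell\in\mathbb N$, and put $$S(z)=(1+az)^{2/3},\qquad q(z)=\frac{a^2}{6\pi(3+4az+a^2z^2)}\qquad (z>-1/a).$$ A dot denotes $d/dz$. Let $z_c$ be the largest root in $(-1/a,\infty)$ of $z+S-z\dot S=0$ (the Cauchy horizon; $z_c<0$). Let $\tilde A(z)=\mathrm{diag}\big(0,0,-\tfrac1z,-(z-S+z\dot S)^{-1},-(z+S-z\dot S)^{-1}\big)$ and $$\tilde C=\begin{pmatrix}c_{11}&c_{12}&c_{13}&c_{14}&c_{15}\\ c_{21}&c_{22}&0&c_{24}&c_{25}\\ c_{31}&c_{32}&c_{33}&c_{34}&c_{35}\\ c_{41}&0&c_{43}&c_{44}&c_{45}\\ c_{51}&0&c_{53}&c_{54}&c_{55}\end{pmatrix},$$ where - $c_{11}=\dfrac{-3z(-1+\dot S)\dot S^2-S^2\ddot S+S(3\dot S^2-z\ddot S+\dot S(-3+2z\ddot S))}{S(-1+\dot S)(S-z\dot S)}$, $\;c_{13}=c_{14}=c_{15}=-c_{12}=\dfrac{-1+\dot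 S}{2S}$; - $c_{21}=-\dfrac{8\pi qS}{-1+\dot S}$, $c_{22}=-\dfrac{\dot q}{q}$, $c_{24}=-\dfrac{4\pi qS}{1+\dot S}$, $c_{25}=-\dfrac{4\pi qS}{-1+\dot S}$; - $c_{31}=\dfrac{2\big(2z^3\dot S^4-2z^2S\dot S^2(3\dot S+z\ddot S)+S^3(-2\dot S+z^2S^{(3)})+zS^2(6\dot S^2+z^2\ddot S^2+z\dot S(2\ddot S-zS^{(3)}))\big)}{zS(-1+\dot S)(S-z\dot S)^2}$, $c_{32}=-\dfrac2z-\dfrac{\dot q}{q}$, $c_{33}=\dfrac1z+\dfrac{2\dot S}{S}$; - $c_{34}=\dfrac{z\dot S(2-\ell-\ell^2+2\dot S+2\dot S^2)-4S^2\ddot S+S(-2+\ell+\ell^2-2\dot S^2-2z\ddot S+\dot S(-2+4z\ddot S))}{2zS(1+\dot S)}$; - $c_{35}=\dfrac{z\dot S(-2+\ell+\ell^2+2\dot S-2\dot S^2)+4S^2\ddot S-S(-2+\ell+\ell^2-2\dot S^2+2z\ddot S+\dot S(2+4z\ddot S))}{2zS(-1+\dot S)}$; - $c_{41}=\dfrac{4(1+\dot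 S)(-z\dot S^2+S(\dot S+z\ddot S))}{S(-1+\dot S)(z-S+z\dot S)}$, $c_{43}=c_{45}=\dfrac{(1+\dot S)(S-z\dot S)}{S(z-S+z\dot S)}$, $c_{44}=\dfrac{3+(z+S)\ddot S+\dot S(3+z\ddot S)}{(1+\dot S)(z-S+z\dot S)}$; - $c_{51}=-\dfrac{4(-z\dot S^2+S(\dot S+z\ddot S))}{S(z+S-z\dot S)}$, $c_{53}=c_{54}=-\dfrac{(-1+\dot S)(S-z\dot S)}{S(z+S-z\dot S)}$, $c_{55}=-\dfrac{3+(-z+S)\ddot S+\dot S(-3+z\ddot S)}{(-1+\dot S)(z+S-z\dot S)}$. Let also $$\tilde f=\Big(0,\,0,\,-\frac{16\pi q(-S+z\dot S)}{zS},\,-\frac{8\pi q(1+\dot S)(S-z\dot S)}{S(z-S+z\dot S)},\,\frac{8\pi q(-1+\dot S)(S-z\dot S)}{S(z+S-z\dot S)}\Big)^T .$$ With $t=z-z_c$ put $A(t)=t\tilde A(z_c+t)$, $C(t)=t\tilde C(z_c+t)$, $\vec h(t)=t\tilde f(z_c+t)$. Fix $t_1$ with $0<t_1<-z_c$ and $g\in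 C_0^\infty(\mathbb R,\mathbb R)$, and consider $$t\,\partial_t\vec u+A(t)\,\partial_p\vec u+C(t)\,\vec u=\vec h(t)\,g(p),\qquad 0<t\le t_1,\ p\in\mathbb R,\qquad \vec u(t_1,\cdot)=\vec u^{(0)}. \tag{1}$$ For $\vec u^{(0)}\in\mathcal S:=L^1(\mathbb R,\mathbb R^5)$ a solution of (1) is a $\vec u\in C((0,t_1],L^1(\mathbb R,\mathbb R^5))$ with $\vec u(t_1)=\vec u^{(0)}$ that satisfies the equation weakly in $p$: for every test function $\psi\in C_0^\infty(\mathbb R)$ the vector $\int\vec u\,\psi\,dp$ is differentiable in $t$ on $(0,t_1]$ and $t\frac{d}{dt}\int\vec u\,\psi\,dp=A(t)\int\vec u\,\psi'\,dp-C(t)\int\vec u\,\psi\,dp+\vec h(t)\int g\,\psi\,dp$. The average $\bar u(t)=\int_{\mathbb R}\vec u(t,p)\,dp$ obeys $$t\,\frac{d\bar u}{dt}=-C(t)\bar u+\vec h(t)\int_{\mathbb R} g\,dp,\qquad 0<t\le t_1. \tag{2}$$ Let $c=\lim_{t\to0^+}C_{55}(t)$. Let $\bar\phi_1,\dots,\bar\phi_5$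 be a basis of solutions of the homogeneous equation associated with (2), and $\bar\chi$ a solution of (2), such that $\bar\phi_1,\dots,\bar\phi_4,\bar\chi$ have finite limits as $t\to0^+$ and $t^{c}\bar\phi_5(t)\to e_5=(0,0,0,0,1)^T$. Every $\vec u^{(0)}\in\mathcal S$ has unique coefficients $d_i=d_i(\vec u^{(0)})$ with $\int\vec u^{(0)}dp=\bar\chi(t_1)+\sum_{i=1}^5d_i\bar\phi_i(t_1)$. Put $\mathcal S'=\{\vec u^{(0)}\in\mathcal S: d_5(\vec u^{(0)})=0\}$ (for some such system $\bar\phi_i,\bar\chi$) and $\mathcal S''=\mathcal S\setminus\mathcal S'$. **Theorem.** If $\vec u^{(0)}\in\mathcal S''$ and $\vec u$ is a solution of (1) with this data, then for every $1\le r\le\infty$ $$\lim_{t\to0^+}\|\vec u(t,\cdot)\|_{L^r(\mathbb R,\mathbb R^5)}=\infty,$$ where the norm is taken to be $+\infty$ if $\vec u(t,\cdot)\notin L^r$. -/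

import Mathlib

open MeasureTheory Filter Topology Set
open scoped ContDiff

noncomputable section

namespace LTB

/-- State space `ℝ⁵` of the perturbation vector. -/
abbrev V : Type := EuclideanSpace ℝ (Fin 5)

/-- Radial function `S(z) = (1 + a z)^(2/3)` of the self-similar LTB spacetime. -/
def S (a z : ℝ) : ℝ := (1 + a * z) ^ (2 / 3 : ℝ)

/-- First, second and third derivatives of the radial function in `z`. -/
def S1 (a z : ℝ) : ℝ := deriv (S a) z

def S2 (a z : ℝ) : ℝ := iteratedDeriv 2 (S a) z

def S3 (a z : ℝ) : ℝ := iteratedDeriv 3 (S a) z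

/-- Density function; `dq` is its derivative. -/
def q (a z : ℝ) : ℝ := a ^ 2 / (6 * Real.pi * (3 + 4 * a * z + a ^ 2 * z ^ 2))

def dq (a z : ℝ) : ℝ := deriv (q a) z

/-- Largest value of `a` for which the singularity is naked. -/
def aStar : ℝ := 3 / (2 * (26 + 15 * Real.sqrt 3)) ^ (1 / 3 : ℝ)

/-- `zc` is the Cauchy horizon: the first root, in the direction of decreasing `z` and before the
shell-focusing singularity `z = -1/a`, of `z + S - z S' = 0`. -/
def IsCauchyHorizon (a zc : ℝ) : Prop :=
  IsGreatest {z : ℝ | -1 / a < z ∧ z + S a z - z * S1 a z = 0} zc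

/-- Coefficient of `∂u/∂p` in `∂u/∂z + Ã ∂u/∂p + C̃ u = f g`. -/
def Atilde (a z : ℝ) : Matrix (Fin 5) (Fin 5) ℝ :=
  let s := S a z
  let d := S1 a z
  Matrix.diagonal ![0, 0, -(1 / z), -(z - s + z * d)⁻¹, -(z + s - z * d)⁻¹]

/-- Coefficient of `u`, for the multipole number `l`. -/
def Ctilde (a : ℝ) (l : ℕ) (z : ℝ) : Matrix (Fin 5) (Fin 5) ℝ :=
  let s := S a z
  let d := S1 a z
  let e := S2 a z
  let k := S3 a z
  let r := q a z
  let L : ℝ := l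
  let c11 := (-3 * z * (-1 + d) * d ^ 2 - s ^ 2 * e
    + s * (3 * d ^ 2 - z * e + d * (-3 + 2 * z * e))) / (s * (-1 + d) * (s - z * d))
  let c12 := -((-1 + d) / (2 * s))
  let c13 := (-1 + d) / (2 * s)
  let c14 := (-1 + d) / (2 * s)
  let c15 := (-1 + d) / (2 * s)
  let c21 := -(8 * Real.pi * r * s / (-1 + d))
  let c22 := -(dq a z / r)
  let c24 := -(4 * Real.pi * r * s / (1 + d))
  let c25 := -(4 * Real.pi * r * s / (-1 + d))
  let n1 := 2 * (2 * z ^ 3 * d ^ 4 - 2 * z ^ 2 * s * d ^ 2 * (3 * d + z * e)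
    + s ^ 3 * (-2 * d + z ^ 2 * k)
    + z * s ^ 2 * (6 * d ^ 2 + z ^ 2 * e ^ 2 + z * d * (2 * e - z * k)))
  let c31 := n1 / (z * s * (-1 + d) * (s - z * d) ^ 2)
  let c32 := -(2 / z) - dq a z / r
  let c33 := 1 / z + 2 * d / s
  let n2 := z * d * (2 - L - L ^ 2 + 2 * d + 2 * d ^ 2) - 4 * s ^ 2 * e
    + s * (-2 + L + L ^ 2 - 2 * d ^ 2 - 2 * z * e + d * (-2 + 4 * z * e))
  let c34 := n2 / (2 * z * s * (1 + d))
  let n3 := z * d * (-2 + L + L ^ 2 + 2 * d - 2 * d ^ 2) + 4 * s ^ 2 * e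
    - s * (-2 + L + L ^ 2 - 2 * d ^ 2 + 2 * z * e + d * (2 + 4 * z * e))
  let c35 := n3 / (2 * z * s * (-1 + d))
  let c41 := 4 * (1 + d) * (-(z * d ^ 2) + s * (d + z * e)) / (s * (-1 + d) * (z - s + z * d))
  let c43 := (1 + d) * (s - z * d) / (s * (z - s + z * d))
  let c44 := (3 + (z + s) * e + d * (3 + z * e)) / ((1 + d) * (z - s + z * d))
  let c45 := (1 + d) * (s - z * d) / (s * (z - s + z * d))
  let c51 := -(4 * (-(z * d ^ 2) + s * (d + z * e)) / (s * (z + s - z * d)))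
  let c53 := -((-1 + d) * (s - z * d) / (s * (z + s - z * d)))
  let c54 := -((-1 + d) * (s - z * d) / (s * (z + s - z * d)))
  let c55 := -((3 + (-z + s) * e + d * (-3 + z * e)) / ((-1 + d) * (z + s - z * d)))
  !![c11, c12, c13, c14, c15;
     c21, c22, 0, c24, c25;
     c31, c32, c33, c34, c35;
     c41, 0, c43, c44, c45;
     c51, 0, c53, c54, c55]

/-- The `z`-dependent factor of the source. -/
def ftilde (a z : ℝ) : Fin 5 → ℝ :=
  let s := S a z
  let d := S1 a z
  let r := q a z
  ![0, 0,
    -(16 * Real.pi * r * (-s + z * d) / (z * s)),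
    -(8 * Real.pi * r * (1 + d) * (s - z * d) / (s * (z - s + z * d))),
    8 * Real.pi * r * (-1 + d) * (s - z * d) / (s * (z + s - z * d))]

/-- Coefficients of `t ∂u/∂t + A(t) ∂u/∂p + C(t) u = h(t) g(p)`, where `t = z - zc`. -/
def A (a zc t : ℝ) : Matrix (Fin 5) (Fin 5) ℝ := t • Atilde a (zc + t)

def C (a : ℝ) (l : ℕ) (zc t : ℝ) : Matrix (Fin 5) (Fin 5) ℝ := t • Ctilde a l (zc + t)

def h (a zc t : ℝ) : Fin 5 → ℝ := t • ftilde a (zc + t)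

/-- The exponent `c`: the limit of the `(5,5)` entry of `C(t)` as `t → 0⁺`. -/
def cExp (a : ℝ) (l : ℕ) (zc : ℝ) : ℝ := limUnder (𝓝[>] (0 : ℝ)) fun t => C a l zc t 4 4

/-- `u ∈ C((0,t₁], L¹(ℝ,ℝ⁵))` is a solution of
`t ∂u/∂t + A(t) ∂u/∂p + C(t) u = h(t) g(p)` with `u(t₁) = u₀`; the equation is understood weakly
in `p`, against smooth compactly supported test functions. -/
structure IsSolution (a : ℝ) (l : ℕ) (zc : ℝ) (g : ℝ → ℝ) (t₁ : ℝ)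
    (u₀ : Lp V 1 (volume : Measure ℝ)) (u : ℝ → Lp V 1 (volume : Measure ℝ)) : Prop where
  continuousOn : ContinuousOn u (Ioc 0 t₁)
  initial : u t₁ = u₀
  weak : ∀ (i : Fin 5) (ψ : ℝ → ℝ), ContDiff ℝ ∞ ψ → HasCompactSupport ψ →
    ∀ t ∈ Ioc 0 t₁,
      HasDerivWithinAt (fun s => ∫ p, (u s) p i * ψ p)
        (t⁻¹ * ((∑ j, A a zc t i j * ∫ p, (u t) p j * deriv ψ p)
          - (∑ j, C a l zc t i j * ∫ p, (u t) p j * ψ p)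
          + h a zc t i * ∫ p, g p * ψ p))
        (Ioc 0 t₁) t

/-- `x` solves the averaged equation `t x' = -C(t) x + G h(t)` on `(0,t₁]`; for `G = ∫ g` this is
the equation obeyed by `∫ u(t,p) dp`, and for `G = 0` it is the homogeneous equation. -/
def SolvesAveraged (a : ℝ) (l : ℕ) (zc t₁ G : ℝ) (x : ℝ → V) : Prop :=
  ∀ i : Fin 5, ∀ t ∈ Ioc 0 t₁,
    HasDerivWithinAt (fun s => x s i)
      (t⁻¹ * (-(∑ j, C a l zc t i j * x t j) + G * h a zc t i)) (Ioc 0 t₁) t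

/-- A basis `φ₁,…,φ₅` of solutions of the homogeneous averaged equation together with a particular
solution `χ` of the full one, such that `φ₁,…,φ₄` and `χ` are finite as `t → 0⁺`, while
`φ₅ ∼ t^(-c) e₅`. -/
structure IsFundamentalSystem (a : ℝ) (l : ℕ) (zc t₁ G : ℝ) (φ : Fin 5 → ℝ → V) (χ : ℝ → V) :
    Prop where
  solves : ∀ i, SolvesAveraged a l zc t₁ 0 (φ i)
  solves_particular : SolvesAveraged a l zc t₁ G χ
  linearIndependent : LinearIndependent ℝ fun i => φ i t₁
  finite : ∀ i, i ≠ 4 → ∃ v, Tendsto (φ i) (𝓝[>] 0) (𝓝 v)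
  finite_particular : ∃ v, Tendsto χ (𝓝[>] 0) (𝓝 v)
  divergent : Tendsto (fun t : ℝ => t ^ cExp a l zc • φ 4 t) (𝓝[>] 0)
    (𝓝 (EuclideanSpace.single 4 1))

/-- Data whose averaged solution `χ + d₁ φ₁ + ⋯ + d₅ φ₅` has `d₅ = 0`. -/
def SPrime (a : ℝ) (l : ℕ) (zc : ℝ) (g : ℝ → ℝ) (t₁ : ℝ) : Set (Lp V 1 (volume : Measure ℝ)) :=
  {u₀ | ∃ (φ : Fin 5 → ℝ → V) (χ : ℝ → V) (d : Fin 5 → ℝ),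
    IsFundamentalSystem a l zc t₁ (∫ p, g p) φ χ ∧
    ∫ p, u₀ p = χ t₁ + ∑ i, d i • φ i t₁ ∧ d 4 = 0}

/-- The complement of `SPrime` in `L¹(ℝ,ℝ⁵)`. -/
def SDoublePrime (a : ℝ) (l : ℕ) (zc : ℝ) (g : ℝ → ℝ) (t₁ : ℝ) :
    Set (Lp V 1 (volume : Measure ℝ)) :=
  (SPrime a l zc g t₁)ᶜ

end LTB

end

noncomputable section

namespace LTB

/-! ### Calculus on half-open intervals and linear equations -/

/-! The Cauchy horizon is a regular singular point at `t = 0`. Only the fifth row of `C̃` contains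
the vanishing denominator `z + S - z S'`, so after multiplication by `t` the first four rows of
`C(t)` are `O(t)` and the fifth is bounded. For `a < aStar` the root is simple
(`one_sub_mul_S2_ne_zero`), and the horizon equation gives `c = (3 - 2 zc S'') / (1 - zc S'') > 1`
(`one_lt_horizonExponent`).

For such a system `t ^ c x₅` converges along every solution of the averaged equation. The limit is a
nonzero linear functional of the homogeneous data, and a solution on which it vanishes is finite at
the horizon. This yields a fundamental system (`RegularSingular.exists_fundamental`). Data outside
`SPrime` therefore have `t ^ c x₅ → d₅ ≠ 0` for their average `x`.

The full average is controlled by the `L¹` norm but not by `Lʳ` for `r > 1`. It is replaced by the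
average against a cutoff `η(s p)`, of length scale `1/s`. This localised average solves the same
system up to a transport error of size `s ‖u(t)‖_{L¹}`. Testing along characteristics and using
duality gives `‖u(t)‖_{L¹} = O(t ^ (-c))` (`IsWeakSolution.exists_integral_abs_le`). A Grönwall
estimate then makes the error, in units of `t ^ (-c)`, of order `s / √t` plus the cut-off tail of
the data (`IsWeakSolution.rpow_mul_abs_average_sub_le`). At `s = t` both tend to zero, so the
localised average is still asymptotic to `d₅ t ^ (-c)`.

Finally, Hölder on an interval of length `4/t` costs at most a factor `4/t`
(`ofReal_abs_average_le_eLpNorm`), so every `Lʳ` norm is at least of order `t ^ (1 - c)`, which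
diverges because `c > 1`. -/

theorem abs_sub_le_integral_of_hasDerivWithinAt {f f' B : ℝ → ℝ} {T t t' : ℝ}
    (hf : ∀ s ∈ Ioc 0 T, HasDerivWithinAt f (f' s) (Ioc 0 T) s)
    (hB : ContinuousOn B (Ioc 0 T)) (hfB : ∀ s ∈ Ioc 0 T, |f' s| ≤ B s)
    (ht : 0 < t) (htt' : t ≤ t') (ht' : t' ≤ T) :
    |f t' - f t| ≤ ∫ s in t..t', B s := by
  have hsub : Icc t t' ⊆ Ioc 0 T := fun s hs => ⟨ht.trans_le hs.1, hs.2.trans ht'⟩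
  have hd : ∀ s ∈ Ioo t t', HasDerivAt f (f' s) s := fun s hs =>
    (hf s (hsub (Ioo_subset_Icc_self hs))).hasDerivAt
      (mem_of_superset (isOpen_Ioo.mem_nhds hs) (Ioo_subset_Icc_self.trans hsub))
  refine norm_sub_le_integral_of_norm_deriv_le_of_le htt'
    (fun s hs => ((hf s (hsub hs)).continuousWithinAt).mono hsub)
    (fun s hs => (hd s hs).differentiableAt.differentiableWithinAt)
    (Eventually.of_forall fun s hs => ?_) ?_
  · rw [(hd s hs).deriv]
    exact hfB s (hsub (Ioo_subset_Icc_self hs))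
  · exact (hB.mono (by rw [uIcc_of_le htt']; exact hsub)).intervalIntegrable

theorem continuousOn_rpow_Ioc (γ T : ℝ) : ContinuousOn (fun s : ℝ => s ^ γ) (Ioc 0 T) :=
  fun s hs => (Real.continuousAt_rpow_const s γ (Or.inl hs.1.ne')).continuousWithinAt

theorem continuousOn_inv_Ioc (T : ℝ) : ContinuousOn (fun s : ℝ => s⁻¹) (Ioc 0 T) :=
  fun _ hs => (continuousAt_inv₀ hs.1.ne').continuousWithinAt

/-- A derivative that is integrable at `0` makes `f` Cauchy there. The explicit rate matters as much
as the limit: it later shows that a limit is nonzero, and it bounds functions whose limit is zero.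
-/
theorem exists_tendsto_of_abs_deriv_le_rpow {f f' : ℝ → ℝ} {T B γ : ℝ} (hT : 0 < T) (hγ : 0 < γ)
    (hf : ∀ s ∈ Ioc 0 T, HasDerivWithinAt f (f' s) (Ioc 0 T) s)
    (hfB : ∀ s ∈ Ioc 0 T, |f' s| ≤ B * s ^ (γ - 1)) :
    ∃ L, Tendsto f (𝓝[>] 0) (𝓝 L) ∧ ∀ t ∈ Ioc 0 T, |f t - L| ≤ B / γ * t ^ γ := by
  have key : ∀ t t', 0 < t → t ≤ t' → t' ≤ T → |f t' - f t| ≤ B / γ * (t' ^ γ - t ^ γ) := by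
    intro t t' ht htt' ht'
    have := abs_sub_le_integral_of_hasDerivWithinAt (B := fun s => B * s ^ (γ - 1)) hf
      (continuousOn_const.mul (continuousOn_rpow_Ioc (γ - 1) T)) hfB ht htt' ht'
    rw [intervalIntegral.integral_const_mul, integral_rpow (Or.inl (by linarith))] at this
    rw [sub_add_cancel] at this
    calc _ ≤ _ := this
      _ = _ := by ring
  have hpow : Tendsto (fun t : ℝ => t ^ γ) (𝓝[>] 0) (𝓝 0) := by
    have := (Real.continuousAt_rpow_const 0 γ (Or.inr hγ.le)).tendsto
    rw [Real.zero_rpow hγ.ne'] at this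
    exact this.mono_left nhdsWithin_le_nhds
  have hB : 0 ≤ B := by
    have h1 := (abs_nonneg _).trans (hfB T ⟨hT, le_rfl⟩)
    exact nonneg_of_mul_nonneg_left h1 (Real.rpow_pos_of_pos hT _)
  have hmem : Ioc 0 T ∈ 𝓝[>] (0 : ℝ) := Ioc_mem_nhdsGT hT
  have hcau : Cauchy (map f (𝓝[>] (0 : ℝ))) := by
    refine cauchy_map_iff.2 ⟨inferInstance, ?_⟩
    have h2 : Tendsto (fun p : ℝ × ℝ => B / γ * (p.1 ^ γ + p.2 ^ γ)) (𝓝[>] 0 ×ˢ 𝓝[>] 0)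
        (𝓝 0) := by
      simpa using ((hpow.comp tendsto_fst).add (hpow.comp tendsto_snd)).const_mul (B / γ)
    rw [Metric.uniformity_eq_comap_nhds_zero, tendsto_comap_iff]
    refine squeeze_zero' (Eventually.of_forall fun _ => dist_nonneg) ?_ h2
    filter_upwards [prod_mem_prod hmem hmem] with p hp
    have ha : 0 ≤ B / γ := by positivity
    have e1 : 0 ≤ p.1 ^ γ := Real.rpow_nonneg hp.1.1.le _
    have e2 : 0 ≤ p.2 ^ γ := Real.rpow_nonneg hp.2.1.le _
    simp only [Function.comp, Real.dist_eq]
    rcases le_total p.1 p.2 with h | h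
    · rw [abs_sub_comm]
      exact (key _ _ hp.1.1 h hp.2.2).trans (mul_le_mul_of_nonneg_left (by linarith) ha)
    · exact (key _ _ hp.2.1 h hp.1.2).trans (mul_le_mul_of_nonneg_left (by linarith) ha)
  obtain ⟨L, hL⟩ := CompleteSpace.complete hcau
  refine ⟨L, hL, fun t ht => ?_⟩
  have h3 : Tendsto (fun s => |f t - f s|) (𝓝[>] 0) (𝓝 |f t - L|) := (tendsto_const_nhds.sub hL).abs
  have h4 : Tendsto (fun s : ℝ => B / γ * (t ^ γ - s ^ γ)) (𝓝[>] 0) (𝓝 (B / γ * t ^ γ)) := by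
    simpa using ((tendsto_const_nhds (x := t ^ γ)).sub hpow).const_mul (B / γ)
  refine le_of_tendsto_of_tendsto h3 h4 ?_
  filter_upwards [Ioc_mem_nhdsGT ht.1] with s hs
  exact key s t hs.1 hs.2 ht.2

/-- Backward Grönwall inequality with the integrable kernel `k / √s`. -/
theorem le_mul_exp_of_le_add_integral {Z : ℝ → ℝ} {b k t T : ℝ} (ht : 0 < t) (htT : t ≤ T)
    (hb : 0 ≤ b) (hk : 0 ≤ k) (hZ : ContinuousOn Z (Icc t T))
    (h : ∀ s ∈ Icc t T, Z s ≤ b + ∫ r in s..T, k / √r * Z r) :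
    Z t ≤ b * Real.exp (2 * k * √T) := by
  set F : ℝ → ℝ := fun r => k / √r * Z r with hF
  have hpos : ∀ r ∈ Icc t T, 0 < r := fun r hr => ht.trans_le hr.1
  have hFc : ContinuousOn F (Icc t T) :=
    (continuousOn_const.div Real.continuous_sqrt.continuousOn
      fun r hr => (Real.sqrt_pos.2 (hpos r hr)).ne').mul hZ
  have hFi : ∀ s ∈ Icc t T, IntervalIntegrable F volume s T := fun s hs =>
    (hFc.mono (by rw [uIcc_of_le hs.2]; exact Icc_subset_Icc_left hs.1)).intervalIntegrable
  -- Since `2 k √s` is a primitive of the kernel `k / √s`, the hypothesis `h` says exactly that `Y'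
  -- ≥ 0`.
  set Y : ℝ → ℝ := fun s => (b + ∫ r in s..T, F r) * Real.exp (2 * k * √s) with hY
  have hder : ∀ s ∈ Ioo t T, HasDerivAt Y
      (-F s * Real.exp (2 * k * √s)
        + (b + ∫ r in s..T, F r) * (Real.exp (2 * k * √s) * (2 * k * (1 / (2 * √s))))) s := by
    intro s hs
    have hs' := Ioo_subset_Icc_self hs
    have hFs : ContinuousAt F s := hFc.continuousAt (Icc_mem_nhds hs.1 hs.2)
    have h1 : HasDerivAt (fun s => ∫ r in s..T, F r) (-F s) s :=
      intervalIntegral.integral_hasDerivAt_left (hFi s hs')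
        (hFc.stronglyMeasurableAtFilter_nhdsWithin measurableSet_Icc s |>.filter_mono (by
          rw [nhdsWithin_eq_nhds.2 (Icc_mem_nhds hs.1 hs.2)])) hFs
    exact (h1.const_add b).mul
      (((Real.hasDerivAt_sqrt (hpos s hs').ne').const_mul (2 * k)).exp)
  have hYc : ContinuousOn Y (Icc t T) := by
    refine ContinuousOn.mul (continuousOn_const.add ?_) (by fun_prop)
    have := intervalIntegral.continuousOn_primitive_interval_left
      (f := F) (a := t) (b := T) (μ := volume)
      (by rw [uIcc_of_le htT]; exact hFc.integrableOn_Icc)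
    rwa [uIcc_of_le htT] at this
  have hmono : MonotoneOn Y (Icc t T) := by
    refine monotoneOn_of_deriv_nonneg (convex_Icc t T) hYc ?_ ?_
    · rw [interior_Icc]
      exact fun s hs => (hder s hs).differentiableAt.differentiableWithinAt
    · rw [interior_Icc]
      intro s hs
      have hs' := Ioo_subset_Icc_self hs
      have hsq := Real.sqrt_pos.2 (hpos s hs')
      rw [(hder s hs).deriv]
      have e : -F s * Real.exp (2 * k * √s)
        + (b + ∫ r in s..T, F r) * (Real.exp (2 * k * √s) * (2 * k * (1 / (2 * √s))))
        = k / √s * Real.exp (2 * k * √s) * ((b + ∫ r in s..T, F r) - Z s) := by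
        simp only [hF]
        field_simp
        ring
      rw [e]
      exact mul_nonneg (by positivity) (sub_nonneg.2 (h s hs'))
  have h1 := hmono ⟨le_rfl, htT⟩ ⟨htT, le_rfl⟩ htT
  simp only [hY, intervalIntegral.integral_same, add_zero] at h1
  have h2 := h t ⟨le_rfl, htT⟩
  have h3 : 1 ≤ Real.exp (2 * k * √t) := Real.one_le_exp (by positivity)
  rcases le_total 0 (b + ∫ r in t..T, F r) with h4 | h4
  · exact h2.trans ((le_mul_of_one_le_right h4 h3).trans h1)
  · exact h2.trans (h4.trans (by positivity))

/-- Global solvability of linear differential equations with continuous coefficients. -/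
theorem exists_forall_hasDerivAt_linear {E : Type*} [NormedAddCommGroup E] [NormedSpace ℝ E]
    [CompleteSpace E] {M : ℝ → E →L[ℝ] E} {b : ℝ → E} (hM : Continuous M) (hb : Continuous b)
    (v : E) (τ₀ : ℝ) :
    ∃ x : ℝ → E, x τ₀ = v ∧ ∀ τ, HasDerivAt x (M τ (x τ) + b τ) τ := by
  -- Picard iteration in a weighted sup norm on the whole line. As `(sinh κ)' = cosh κ * k` and
  -- `|sinh| ≤ cosh`, the weight `cosh κ` works in both time directions. The factor `2` gives the
  -- contraction constant `1/2`, and `‖b s‖` lets the same weight absorb the inhomogeneity.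
  set k : ℝ → ℝ := fun s => 2 * ‖M s‖ + ‖b s‖ with hk
  have hkc : Continuous k := by fun_prop
  set κ : ℝ → ℝ := fun τ => ∫ s in τ₀..τ, k s with hκ
  have hκd : ∀ τ, HasDerivAt κ (k τ) τ := fun τ => hkc.integral_hasStrictDerivAt τ₀ τ |>.hasDerivAt
  have hκc : Continuous κ := continuous_iff_continuousAt.2 fun τ => (hκd τ).continuousAt
  set wt : ℝ → ℝ := fun τ => Real.cosh (κ τ) with hw
  have hwc : Continuous wt := Real.continuous_cosh.comp hκc
  have hw1 : ∀ τ, 1 ≤ wt τ := fun τ => Real.one_le_cosh _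
  have hw0 : ∀ τ, 0 < wt τ := fun τ => Real.cosh_pos _
  have hinteg : ∀ τ, |∫ s in τ₀..τ, wt s * k s| ≤ wt τ := by
    intro τ
    have h1 : ∫ s in τ₀..τ, wt s * k s = Real.sinh (κ τ) - Real.sinh (κ τ₀) :=
      intervalIntegral.integral_eq_sub_of_hasDerivAt (fun s _ => (hκd s).sinh)
        ((hwc.mul hkc).intervalIntegrable _ _)
    rw [h1]
    simp only [hκ, intervalIntegral.integral_same, Real.sinh_zero, sub_zero]
    have h2 := Real.sinh_lt_cosh (-∫ s in τ₀..τ, k s)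
    rw [Real.sinh_neg, Real.cosh_neg] at h2
    exact abs_le.2 ⟨by linarith, (Real.sinh_lt_cosh _).le⟩
  have hbound : ∀ (f : ℝ → E) (r : ℝ), 0 ≤ r → (∀ s, ‖f s‖ ≤ r * (wt s * k s)) → ∀ τ,
      ‖∫ s in τ₀..τ, f s‖ ≤ r * wt τ := by
    intro f r hr0 hf τ
    have h2 := intervalIntegral.norm_integral_le_abs_of_norm_le (f := f) (a := τ₀) (b := τ)
      (μ := volume) (g := fun s => r * (wt s * k s)) (Eventually.of_forall fun s => hf s)
      ((continuous_const.mul (hwc.mul hkc)).intervalIntegrable _ _)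
    rw [intervalIntegral.integral_const_mul, abs_mul, abs_of_nonneg hr0] at h2
    exact h2.trans (mul_le_mul_of_nonneg_left (hinteg τ) hr0)
  set I : (ℝ → E) → ℝ → E := fun y s => wt s • M s (y s) + b s with hI
  have hIc : ∀ y, Continuous y → Continuous (I y) := fun y hy => by fun_prop
  have hIb : ∀ (y : BoundedContinuousFunction ℝ E) s, ‖I y s‖ ≤ (‖y‖ + 1) * (wt s * k s) := by
    intro y s
    have h1 : ‖M s (y s)‖ ≤ ‖M s‖ * ‖y‖ :=
      (M s).le_opNorm_of_le (y.norm_coe_le_norm s)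
    calc ‖I y s‖ ≤ wt s * (‖M s‖ * ‖y‖) + 1 * ‖b s‖ := by
          refine (norm_add_le _ _).trans (add_le_add ?_ (by simp))
          rw [norm_smul, Real.norm_of_nonneg (hw0 s).le]
          exact mul_le_mul_of_nonneg_left h1 (hw0 s).le
      _ ≤ wt s * (‖M s‖ * ‖y‖) + wt s * ‖b s‖ := by
          gcongr
          exact hw1 s
      _ ≤ (‖y‖ + 1) * (wt s * k s) := by
          have : 0 ≤ wt s * (‖M s‖ * ‖y‖ + 2 * ‖M s‖ + ‖y‖ * ‖b s‖) := by
            have := (hw0 s).le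
            positivity
          simp only [hk]
          linarith
  have hPc : ∀ y, Continuous y → Continuous fun τ => (wt τ)⁻¹ • (v + ∫ s in τ₀..τ, I y s) :=
    fun y hy => (hwc.inv₀ fun τ => (hw0 τ).ne').smul (continuous_const.add
      (intervalIntegral.continuous_primitive (fun _ _ => (hIc y hy).intervalIntegrable _ _) τ₀))
  have hPb : ∀ (y : BoundedContinuousFunction ℝ E) τ,
      ‖(wt τ)⁻¹ • (v + ∫ s in τ₀..τ, I y s)‖ ≤ ‖v‖ + (‖y‖ + 1) := by
    intro y τ
    rw [norm_smul, norm_inv, Real.norm_of_nonneg (hw0 τ).le, inv_mul_le_iff₀ (hw0 τ)]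
    calc _ ≤ ‖v‖ + (‖y‖ + 1) * wt τ :=
          (norm_add_le _ _).trans (add_le_add le_rfl (hbound _ _ (by positivity) (hIb y) τ))
      _ ≤ _ := by nlinarith [norm_nonneg v, hw1 τ]
  set Φ : BoundedContinuousFunction ℝ E → BoundedContinuousFunction ℝ E := fun y =>
    BoundedContinuousFunction.ofNormedAddCommGroup
      (fun τ => (wt τ)⁻¹ • (v + ∫ s in τ₀..τ, I y s)) (hPc y y.continuous) _ (hPb y) with hΦ
  have hcontr : ContractingWith (1 / 2) Φ := by
    refine ⟨by rw [← NNReal.coe_lt_coe]; norm_num, LipschitzWith.of_dist_le_mul fun y z => ?_⟩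
    refine (BoundedContinuousFunction.dist_le (by positivity)).2 fun τ => ?_
    have h1 : Φ y τ - Φ z τ = (wt τ)⁻¹ • ∫ s in τ₀..τ, wt s • M s (y s - z s) := by
      change (wt τ)⁻¹ • (v + ∫ s in τ₀..τ, I y s) - (wt τ)⁻¹ • (v + ∫ s in τ₀..τ, I z s) = _
      rw [← smul_sub, add_sub_add_left_eq_sub, ← intervalIntegral.integral_sub
        ((hIc y y.continuous).intervalIntegrable _ _) ((hIc z z.continuous).intervalIntegrable _ _)]
      congr 2
      ext s
      simp only [hI, map_sub, smul_sub]
      abel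
    rw [dist_eq_norm, h1, norm_smul, norm_inv, Real.norm_of_nonneg (hw0 τ).le,
      inv_mul_le_iff₀ (hw0 τ), mul_comm]
    have := hbound (fun s => wt s • M s (y s - z s)) (1 / 2 * dist y z) (by positivity) ?_ τ
    · simpa using this
    intro s
    rw [norm_smul, Real.norm_of_nonneg (hw0 s).le]
    have h2 : ‖M s (y s - z s)‖ ≤ ‖M s‖ * dist y z := by
      refine (M s).le_opNorm_of_le ?_
      rw [← dist_eq_norm]
      exact BoundedContinuousFunction.dist_coe_le_dist s
    calc wt s * ‖M s (y s - z s)‖ ≤ wt s * (‖M s‖ * dist y z) :=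
          mul_le_mul_of_nonneg_left h2 (hw0 s).le
      _ ≤ _ := by
          have : 0 ≤ wt s * (‖b s‖ * dist y z) := by
            have := (hw0 s).le
            positivity
          simp only [hk]
          linarith
  set y := hcontr.fixedPoint Φ
  have hy : ∀ τ, wt τ • y τ = v + ∫ s in τ₀..τ, I y s := by
    intro τ
    have h1 : Φ y τ = y τ := by
      rw [show Φ y = y from hcontr.fixedPoint_isFixedPt]
    rw [← h1]
    change wt τ • ((wt τ)⁻¹ • (v + ∫ s in τ₀..τ, I y s)) = _
    rw [smul_inv_smul₀ (hw0 τ).ne']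
  refine ⟨fun τ => wt τ • y τ, by simp [hy], fun τ => ?_⟩
  have h1 := ((hIc y y.continuous).integral_hasStrictDerivAt τ₀ τ).hasDerivAt.const_add v
  simp only [map_smul]
  exact h1.congr_of_eventuallyEq (Eventually.of_forall hy)

/-! ### Linear systems with a regular singular point and a simple nonzero exponent -/

/-- The system `t x' = -C(t) x + G h(t)` on `(0,T]` has a regular singular point at `t = 0`, where
only the last row of `C` survives, with diagonal entry `c`. -/
structure RegularSingular (C : ℝ → Matrix (Fin 5) (Fin 5) ℝ) (h : ℝ → Fin 5 → ℝ) (c T K : ℝ) :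
    Prop where
  T_pos : 0 < T
  K_nonneg : 0 ≤ K
  one_lt : 1 < c
  continuousOn_C : ∀ i j, ContinuousOn (fun t => C t i j) (Ioc 0 T)
  continuousOn_h : ∀ i, ContinuousOn (fun t => h t i) (Ioc 0 T)
  C_castSucc : ∀ (i : Fin 4) (j : Fin 5), ∀ t ∈ Ioc 0 T, |C t i.castSucc j| ≤ K * t
  C_last : ∀ j : Fin 4, ∀ t ∈ Ioc 0 T, |C t 4 j.castSucc| ≤ K
  C_diag : ∀ t ∈ Ioc 0 T, |c - C t 4 4| ≤ K * t
  h_castSucc : ∀ i : Fin 4, ∀ t ∈ Ioc 0 T, |h t i.castSucc| ≤ K * t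
  h_last : ∀ t ∈ Ioc 0 T, |h t 4| ≤ K
  C_tendsto : ∀ j : Fin 4, ∃ L, Tendsto (fun t => C t 4 j.castSucc) (𝓝[>] 0) (𝓝 L)
  h_tendsto : ∃ L, Tendsto (fun t => h t 4) (𝓝[>] 0) (𝓝 L)

theorem sum_univ_castSucc_add_four (f : Fin 5 → ℝ) :
    ∑ j, f j = ∑ j : Fin 4, f j.castSucc + f 4 := Fin.sum_univ_castSucc f

theorem intervalIntegrable_of_continuousOn_Ioc {f : ℝ → ℝ} {T t t' : ℝ}
    (hf : ContinuousOn f (Ioc 0 T)) (ht : 0 < t) (htt' : t ≤ t') (ht' : t' ≤ T) :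
    IntervalIntegrable f volume t t' :=
  (hf.mono (by
    rw [uIcc_of_le htt']
    exact fun s hs => ⟨ht.trans_le hs.1, hs.2.trans ht'⟩)).intervalIntegrable

/-! ### Weighted Grönwall estimates -/

section Estimates

variable {C : ℝ → Matrix (Fin 5) (Fin 5) ℝ} {h : ℝ → Fin 5 → ℝ} {c T K : ℝ}

/-- In the first four rows `C = O(t)` cancels the factor `t⁻¹`. The majorants `U`, `E` are kept
separate from `y`, `F` so that `y` may be a family of test integrals and `U` the corresponding `L¹`
norms. -/
theorem RegularSingular.abs_castSucc_le (H : RegularSingular C h c T K) (i : Fin 4) {f F E : ℝ → ℝ}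
    {y U : Fin 5 → ℝ → ℝ}
    (hf : ∀ t ∈ Ioc 0 T, HasDerivWithinAt f
      (t⁻¹ * (-(∑ j, C t i.castSucc j * y j t) + F t)) (Ioc 0 T) t)
    (hU : ∀ j, ContinuousOn (U j) (Ioc 0 T)) (hE : ContinuousOn E (Ioc 0 T))
    (hy : ∀ j, ∀ t ∈ Ioc 0 T, |y j t| ≤ U j t) (hF : ∀ t ∈ Ioc 0 T, |F t| ≤ E t)
    {t t' : ℝ} (ht : 0 < t) (htt' : t ≤ t') (ht' : t' ≤ T) :
    |f t| ≤ |f t'| + ∫ s in t..t', (K * ∑ j, U j s + s⁻¹ * E s) := by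
  have h1 := abs_sub_le_integral_of_hasDerivWithinAt
    (B := fun s => K * ∑ j, U j s + s⁻¹ * E s) hf
    ((continuousOn_const.mul (continuousOn_finsetSum _ fun j _ => hU j)).add
      ((continuousOn_inv_Ioc T).mul hE)) ?_ ht htt' ht'
  · have h2 := abs_sub_abs_le_abs_sub (f t) (f t')
    rw [abs_sub_comm] at h2
    linarith
  · intro s hs
    rw [abs_mul, abs_of_pos (inv_pos.2 hs.1)]
    calc s⁻¹ * |-(∑ j, C s i.castSucc j * y j s) + F s|
        ≤ s⁻¹ * (∑ j, (K * s) * U j s + E s) := by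
          refine mul_le_mul_of_nonneg_left ?_ (inv_pos.2 hs.1).le
          refine (abs_add_le _ _).trans (add_le_add ?_ (hF s hs))
          rw [abs_neg]
          refine (Finset.abs_sum_le_sum_abs _ _).trans (Finset.sum_le_sum fun j _ => ?_)
          rw [abs_mul]
          exact mul_le_mul (H.C_castSucc i j s hs) (hy j s hs) (abs_nonneg _)
            (mul_nonneg H.K_nonneg hs.1.le)
      _ = K * ∑ j, U j s + s⁻¹ * E s := by
          rw [← Finset.mul_sum]
          have := hs.1.ne'
          field_simp

/-- The integrating factor `t ^ c` removes the leading part of the diagonal entry and leaves `c -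
C₅₅`, which is `O(t)` for a regular singular system. -/
theorem hasDerivWithinAt_rpow_mul {f F : ℝ → ℝ} {y : Fin 5 → ℝ → ℝ} {t : ℝ} (ht : t ∈ Ioc 0 T)
    (hf : HasDerivWithinAt f (t⁻¹ * (-(∑ j, C t 4 j * y j t) + F t)) (Ioc 0 T) t)
    (hfy : y 4 t = f t) :
    HasDerivWithinAt (fun s => s ^ c * f s)
      (t ^ (c - 1) * ((c - C t 4 4) * f t - ∑ j : Fin 4, C t 4 j.castSucc * y j.castSucc t + F t))
      (Ioc 0 T) t := by
  have h1 := ((Real.hasDerivAt_rpow_const (p := c) (Or.inl ht.1.ne')).hasDerivWithinAt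
    (s := Ioc 0 T)).mul hf
  refine h1.congr_deriv ?_
  rw [sum_univ_castSucc_add_four, hfy, Real.rpow_sub_one ht.1.ne']
  have := ht.1.ne'
  field_simp
  ring

theorem RegularSingular.abs_last_integrand_le (H : RegularSingular C h c T K) {F E : ℝ → ℝ}
    {y U : Fin 5 → ℝ → ℝ} {t : ℝ} (ht : t ∈ Ioc 0 T)
    (hy : ∀ j, |y j t| ≤ U j t) (hF : |F t| ≤ E t) :
    |t ^ (c - 1) * ((c - C t 4 4) * y 4 t
        - ∑ j : Fin 4, C t 4 j.castSucc * y j.castSucc t + F t)|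
      ≤ t ^ (c - 1) * (K * (∑ j : Fin 4, U j.castSucc t + t * U 4 t) + E t) := by
  have hp := Real.rpow_nonneg ht.1.le (c - 1)
  rw [abs_mul, abs_of_nonneg hp]
  refine mul_le_mul_of_nonneg_left ?_ hp
  have h1 : |(c - C t 4 4) * y 4 t| ≤ K * t * U 4 t := by
    rw [abs_mul]
    exact mul_le_mul (H.C_diag t ht) (hy 4) (abs_nonneg _) (mul_nonneg H.K_nonneg ht.1.le)
  have h2 : |∑ j : Fin 4, C t 4 j.castSucc * y j.castSucc t|
      ≤ K * ∑ j : Fin 4, U j.castSucc t := by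
    rw [Finset.mul_sum]
    refine (Finset.abs_sum_le_sum_abs _ _).trans (Finset.sum_le_sum fun j _ => ?_)
    rw [abs_mul]
    exact mul_le_mul (H.C_last j t ht) (hy _) (abs_nonneg _) H.K_nonneg
  have h3 := abs_add_le ((c - C t 4 4) * y 4 t
        - ∑ j : Fin 4, C t 4 j.castSucc * y j.castSucc t) (F t)
  have h4 := abs_sub ((c - C t 4 4) * y 4 t) (∑ j : Fin 4, C t 4 j.castSucc * y j.castSucc t)
  linarith

theorem RegularSingular.rpow_mul_abs_last_le (H : RegularSingular C h c T K) {F E : ℝ → ℝ}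
    {y U : Fin 5 → ℝ → ℝ}
    (hf : ∀ t ∈ Ioc 0 T, HasDerivWithinAt (y 4)
      (t⁻¹ * (-(∑ j, C t 4 j * y j t) + F t)) (Ioc 0 T) t)
    (hU : ∀ j, ContinuousOn (U j) (Ioc 0 T)) (hE : ContinuousOn E (Ioc 0 T))
    (hy : ∀ j, ∀ t ∈ Ioc 0 T, |y j t| ≤ U j t) (hF : ∀ t ∈ Ioc 0 T, |F t| ≤ E t)
    {t t' : ℝ} (ht : 0 < t) (htt' : t ≤ t') (ht' : t' ≤ T) :
    t ^ c * |y 4 t| ≤ t' ^ c * |y 4 t'|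
      + ∫ s in t..t', s ^ (c - 1) * (K * (∑ j : Fin 4, U j.castSucc s + s * U 4 s) + E s) := by
  have h1 := abs_sub_le_integral_of_hasDerivWithinAt
    (B := fun s => s ^ (c - 1) * (K * (∑ j : Fin 4, U j.castSucc s + s * U 4 s) + E s))
    (fun s hs => hasDerivWithinAt_rpow_mul (c := c) hs (hf s hs) rfl)
    ((continuousOn_rpow_Ioc _ T).mul ((continuousOn_const.mul
      ((continuousOn_finsetSum _ fun j _ => hU _).add (continuousOn_id.mul (hU 4)))).add hE))
    (fun s hs => H.abs_last_integrand_le hs (fun j => hy j s hs) (hF s hs)) ht htt' ht'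
  have h2 := abs_sub_abs_le_abs_sub (t ^ c * y 4 t) (t' ^ c * y 4 t')
  rw [abs_sub_comm, abs_mul, abs_mul, abs_of_nonneg (Real.rpow_nonneg ht.le c),
    abs_of_nonneg (Real.rpow_nonneg (ht.le.trans htt') c)] at h2
  linarith

/-- The weighted size of a solution: the last component grows at most like `t ^ (-c)`, the others
at most like `t ^ (1/2 - c)`. -/
def weightedSize (c : ℝ) (U : Fin 5 → ℝ → ℝ) (t : ℝ) : ℝ :=
  t ^ c * U 4 t + t ^ (c - 1 / 2) * ∑ j : Fin 4, U j.castSucc t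

theorem weightedSize_nonneg {U : Fin 5 → ℝ → ℝ} {t : ℝ} (ht : 0 < t) (hU : ∀ j, 0 ≤ U j t) :
    0 ≤ weightedSize c U t :=
  add_nonneg (mul_nonneg (Real.rpow_nonneg ht.le _) (hU 4))
    (mul_nonneg (Real.rpow_nonneg ht.le _) (Finset.sum_nonneg fun _ _ => hU _))

theorem rpow_sub_half {r : ℝ} (hr : 0 < r) (c : ℝ) : r ^ (c - 1 / 2) = r ^ c / √r := by
  rw [Real.rpow_sub hr, Real.sqrt_eq_rpow]

/-- Weighting the regular components by `t ^ (c - 1/2)`, half a power less than their natural `t ^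
(c - 1)` would allow, turns all couplings into the integrable kernel `1 / √s`. The input is a set of
integral inequalities instead of a differential equation, because `U` is also taken to be the `L¹`
norms of a weak solution. -/
theorem weightedSize_le {U : Fin 5 → ℝ → ℝ} {E : ℝ → ℝ} (hc : 1 < c) (hK : 0 ≤ K)
    (hU : ∀ j, ContinuousOn (U j) (Ioc 0 T)) (hE : ContinuousOn E (Ioc 0 T))
    (hU0 : ∀ j, ∀ t ∈ Ioc 0 T, 0 ≤ U j t) (hE0 : ∀ t ∈ Ioc 0 T, 0 ≤ E t)
    {t t' : ℝ} (ht : 0 < t) (htt' : t ≤ t') (ht' : t' ≤ T)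
    (hreg : ∀ i : Fin 4, ∀ r ∈ Icc t t', U i.castSucc r ≤ U i.castSucc t'
      + ∫ s in r..t', (K * ∑ j, U j s + s⁻¹ * E s))
    (hlast : ∀ r ∈ Icc t t', r ^ c * U 4 r ≤ t' ^ c * U 4 t'
      + ∫ s in r..t', s ^ (c - 1) * (K * (∑ j : Fin 4, U j.castSucc s + s * U 4 s) + E s)) :
    weightedSize c U t ≤ (weightedSize c U t' + (4 + √T) * ∫ s in t..t', s ^ (c - 3 / 2) * E s)
      * Real.exp (2 * (4 * K * (1 + √T)) * √T) := by
  have hsub : Icc t t' ⊆ Ioc 0 T := fun s hs => ⟨ht.trans_le hs.1, hs.2.trans ht'⟩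
  have ht'0 : 0 < t' := ht.trans_le htt'
  have hNc : ContinuousOn (fun s => ∑ j : Fin 4, U j.castSucc s) (Ioc 0 T) :=
    continuousOn_finsetSum _ fun j _ => hU _
  have hSc : ContinuousOn (fun s => ∑ j, U j s) (Ioc 0 T) :=
    continuousOn_finsetSum _ fun j _ => hU _
  have hZc : ContinuousOn (weightedSize c U) (Ioc 0 T) :=
    ((continuousOn_rpow_Ioc c T).mul (hU 4)).add ((continuousOn_rpow_Ioc _ T).mul hNc)
  have hEc : ContinuousOn (fun s => s ^ (c - 3 / 2) * E s) (Ioc 0 T) :=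
    (continuousOn_rpow_Ioc _ T).mul hE
  have hsqc : ContinuousOn (fun s => (4 * K * (1 + √T)) / √s * weightedSize c U s) (Ioc 0 T) :=
    (continuousOn_const.div Real.continuous_sqrt.continuousOn
      fun r hr => (Real.sqrt_pos.2 hr.1).ne').mul hZc
  have hG1c : ContinuousOn (fun s => K * ∑ j, U j s + s⁻¹ * E s) (Ioc 0 T) :=
    (continuousOn_const.mul hSc).add ((continuousOn_inv_Ioc T).mul hE)
  have hG2c : ContinuousOn (fun s => s ^ (c - 1) *
      (K * (∑ j : Fin 4, U j.castSucc s + s * U 4 s) + E s)) (Ioc 0 T) :=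
    (continuousOn_rpow_Ioc _ T).mul
      ((continuousOn_const.mul (hNc.add (continuousOn_id.mul (hU 4)))).add hE)
  have hG3c : ContinuousOn (fun s => s ^ (c - 1 / 2) * (4 * (K * ∑ j, U j s + s⁻¹ * E s)))
      (Ioc 0 T) := (continuousOn_rpow_Ioc _ T).mul (continuousOn_const.mul hG1c)
  have hE3 : ∀ s ∈ Ioc 0 T, 0 ≤ s ^ (c - 3 / 2) * E s := fun s hs =>
    mul_nonneg (Real.rpow_nonneg hs.1.le _) (hE0 s hs)
  have hEint : ∀ r ∈ Icc t t', ∫ s in r..t', s ^ (c - 3 / 2) * E s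
      ≤ ∫ s in t..t', s ^ (c - 3 / 2) * E s := by
    intro r hr
    rw [← intervalIntegral.integral_add_adjacent_intervals
      (intervalIntegrable_of_continuousOn_Ioc hEc ht hr.1 (hr.2.trans ht'))
      (intervalIntegrable_of_continuousOn_Ioc hEc (ht.trans_le hr.1) hr.2 ht')]
    have := intervalIntegral.integral_nonneg (μ := volume) hr.1
      fun s hs => hE3 s (hsub ⟨hs.1, hs.2.trans hr.2⟩)
    linarith
  have hb0 : 0 ≤ weightedSize c U t' + (4 + √T) * ∫ s in t..t', s ^ (c - 3 / 2) * E s :=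
    add_nonneg (weightedSize_nonneg ht'0 fun j => hU0 j t' (hsub ⟨htt', le_rfl⟩))
      (mul_nonneg (by positivity) (intervalIntegral.integral_nonneg htt' fun s hs => hE3 s (hsub hs)))
  have hk0 : 0 ≤ 4 * K * (1 + √T) := by positivity
  refine (le_mul_exp_of_le_add_integral ht htt' hb0 hk0 (hZc.mono hsub) ?_).trans ?_
  · intro r hr
    have hr0 : 0 < r := ht.trans_le hr.1
    have hrsub : Icc r t' ⊆ Ioc 0 T := (Icc_subset_Icc_left hr.1).trans hsub
    have ii := fun {f : ℝ → ℝ} (hf : ContinuousOn f (Ioc 0 T)) =>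
      intervalIntegrable_of_continuousOn_Ioc hf hr0 hr.2 ht'
    have hsum : ∑ i : Fin 4, U i.castSucc r ≤ ∑ i : Fin 4, U i.castSucc t'
        + ∫ s in r..t', 4 * (K * ∑ j, U j s + s⁻¹ * E s) := by
      calc _ ≤ ∑ i : Fin 4, (U i.castSucc t' + ∫ s in r..t', (K * ∑ j, U j s + s⁻¹ * E s)) :=
            Finset.sum_le_sum fun i _ => hreg i r hr
        _ = _ := by
            rw [Finset.sum_add_distrib, intervalIntegral.integral_const_mul]
            simp
    have hmul : r ^ (c - 1 / 2) * ∑ i : Fin 4, U i.castSucc r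
        ≤ t' ^ (c - 1 / 2) * ∑ i : Fin 4, U i.castSucc t'
          + ∫ s in r..t', s ^ (c - 1 / 2) * (4 * (K * ∑ j, U j s + s⁻¹ * E s)) := by
      refine (mul_le_mul_of_nonneg_left hsum (Real.rpow_nonneg hr0.le _)).trans ?_
      rw [mul_add, ← intervalIntegral.integral_const_mul]
      refine add_le_add ?_ (intervalIntegral.integral_mono_on hr.2
        (ii (continuousOn_const.mul (continuousOn_const.mul hG1c))) (ii hG3c) fun s hs => ?_)
      · exact mul_le_mul_of_nonneg_right (Real.rpow_le_rpow hr0.le hr.2 (by linarith))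
          (Finset.sum_nonneg fun j _ => hU0 _ t' (hsub ⟨htt', le_rfl⟩))
      · have hs' := hrsub hs
        refine mul_le_mul_of_nonneg_right (Real.rpow_le_rpow hr0.le hs.1 (by linarith)) ?_
        have h1 : 0 ≤ ∑ j, U j s := Finset.sum_nonneg fun j _ => hU0 j s hs'
        have h2 := hE0 s hs'
        have h3 := hs'.1
        positivity
    have hpt : ∀ s ∈ Icc r t',
        s ^ (c - 1) * (K * (∑ j : Fin 4, U j.castSucc s + s * U 4 s) + E s)
          + s ^ (c - 1 / 2) * (4 * (K * ∑ j, U j s + s⁻¹ * E s))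
        ≤ 4 * K * (1 + √T) / √s * weightedSize c U s + (4 + √T) * (s ^ (c - 3 / 2) * E s) := by
      intro s hs
      have hs' := hrsub hs
      have hs0 := hs'.1
      set w := √s with hw
      have hw0 : 0 < w := Real.sqrt_pos.2 hs0
      have hwT : w ≤ √T := Real.sqrt_le_sqrt hs'.2
      have hsw : s = w ^ 2 := (Real.sq_sqrt hs0.le).symm
      have e1 : s ^ (c - 1 / 2) = s ^ c / w := rpow_sub_half hs0 c
      have e2 : s ^ (c - 1) = s ^ c / w ^ 2 := by rw [Real.rpow_sub_one hs0.ne', ← hsw]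
      have e3 : s ^ (c - 3 / 2) = s ^ c / w ^ 3 := by
        rw [show c - 3 / 2 = (c - 1) - 1 / 2 by ring, rpow_sub_half hs0, e2, ← hw]
        field_simp
      have hN : 0 ≤ ∑ j : Fin 4, U j.castSucc s := Finset.sum_nonneg fun j _ => hU0 _ s hs'
      have hM := hU0 4 s hs'
      have hEs := hE0 s hs'
      have hp : 0 ≤ s ^ c := Real.rpow_nonneg hs0.le _
      rw [weightedSize, sum_univ_castSucc_add_four, e1, e2, e3]
      set N := ∑ j : Fin 4, U j.castSucc s
      set P := s ^ c
      -- With `w = √s`, the difference of the two sides is a sum of terms that are nonnegative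
      -- because `w ≤ √T`. The `4` counts the regular rows.
      have hid : 4 * K * (1 + √T) / w * (P * U 4 s + P / w * N) + (4 + √T) * (P / w ^ 3 * E s)
          - (P / w ^ 2 * (K * (N + s * U 4 s) + E s)
            + P / w * (4 * (K * (N + U 4 s) + s⁻¹ * E s)))
          = P * (√T - w) * (4 * K * N / w ^ 2 + 4 * K * U 4 s / w + E s / w ^ 3)
            + P * (3 * K * N / w ^ 2 + 3 * K * U 4 s) := by
        rw [hsw]
        field_simp
        ring
      have hpos : 0 ≤ P * (√T - w) * (4 * K * N / w ^ 2 + 4 * K * U 4 s / w + E s / w ^ 3)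
            + P * (3 * K * N / w ^ 2 + 3 * K * U 4 s) := by
        have := sub_nonneg.2 hwT
        positivity
      linarith
    have hEc' : ContinuousOn (fun s => (4 + √T) * (s ^ (c - 3 / 2) * E s)) (Ioc 0 T) :=
      continuousOn_const.mul hEc
    have hinteg := intervalIntegral.integral_mono_on (μ := volume) hr.2 ((ii hG2c).add (ii hG3c))
      ((ii hsqc).add (ii hEc')) hpt
    rw [intervalIntegral.integral_add (ii hG2c) (ii hG3c),
      intervalIntegral.integral_add (ii hsqc) (ii hEc'), intervalIntegral.integral_const_mul] at hinteg
    have h1 := hlast r hr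
    have h2 := mul_le_mul_of_nonneg_left (hEint r hr) (show 0 ≤ 4 + √T by positivity)
    have e1 : weightedSize c U r = r ^ c * U 4 r + r ^ (c - 1 / 2) * ∑ j : Fin 4, U j.castSucc r :=
      rfl
    have e2 : weightedSize c U t'
      = t' ^ c * U 4 t' + t' ^ (c - 1 / 2) * ∑ j : Fin 4, U j.castSucc t' := rfl
    linarith
  · refine mul_le_mul_of_nonneg_left (Real.exp_le_exp.2 ?_) hb0
    exact mul_le_mul_of_nonneg_left (Real.sqrt_le_sqrt ht') (by positivity)

theorem RegularSingular.abs_h_le (H : RegularSingular C h c T K) (i : Fin 5) {t : ℝ}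
    (ht : t ∈ Ioc 0 T) : |h t i| ≤ K * (1 + T) := by
  have hK := H.K_nonneg
  have hT := H.T_pos
  induction i using Fin.lastCases with
  | last => exact (H.h_last t ht).trans (by nlinarith [mul_nonneg hK hT.le])
  | cast i => exact (H.h_castSucc i t ht).trans (by nlinarith [mul_le_mul_of_nonneg_left ht.2 hK])

theorem rpow_mul_le_weightedSize {t : ℝ} (ht : t ∈ Ioc 0 T) (U : Fin 5 → ℝ → ℝ)
    (hU : ∀ j, 0 ≤ U j t) (i : Fin 5) : t ^ c * U i t ≤ (1 + √T) * weightedSize c U t := by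
  have hw := Real.sqrt_pos.2 ht.1
  have hwT : √t ≤ √T := Real.sqrt_le_sqrt ht.2
  have hp := Real.rpow_pos_of_pos ht.1 c
  have hM := mul_nonneg hp.le (hU 4)
  have hN : 0 ≤ ∑ j : Fin 4, U j.castSucc t := Finset.sum_nonneg fun _ _ => hU _
  have hN' := mul_nonneg (div_pos hp hw).le hN
  rw [weightedSize, rpow_sub_half ht.1]
  induction i using Fin.lastCases with
  | last =>
    change t ^ c * U 4 t ≤ _
    nlinarith [Real.sqrt_nonneg T]
  | cast i =>
    have h1 : U i.castSucc t ≤ ∑ j : Fin 4, U j.castSucc t :=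
      Finset.single_le_sum (f := fun j : Fin 4 => U j.castSucc t) (fun _ _ => hU _)
        (Finset.mem_univ i)
    have h2 : t ^ c * ∑ j : Fin 4, U j.castSucc t
        = √t * (t ^ c / √t * ∑ j : Fin 4, U j.castSucc t) := by
      field_simp
    have h3 := mul_le_mul_of_nonneg_left h1 hp.le
    have h4 := mul_le_mul_of_nonneg_right hwT hN'
    nlinarith [Real.sqrt_nonneg T]

end Estimates

/-! ### Asymptotics of the solutions and the fundamental system -/

/-- `x` solves `t x' = -C(t) x + G h(t)` on `(0,T]`. -/
def Solves (C : ℝ → Matrix (Fin 5) (Fin 5) ℝ) (h : ℝ → Fin 5 → ℝ) (T G : ℝ) (x : ℝ → V) : Prop :=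
  ∀ i : Fin 5, ∀ t ∈ Ioc 0 T,
    HasDerivWithinAt (fun s => x s i)
      (t⁻¹ * (-(∑ j, C t i j * x t j) + G * h t i)) (Ioc 0 T) t

section Asymptotics

variable {C : ℝ → Matrix (Fin 5) (Fin 5) ℝ} {h : ℝ → Fin 5 → ℝ} {c T K G : ℝ}

theorem Solves.add_smul {G' : ℝ} {x y : ℝ → V} (hx : Solves C h T G x) (hy : Solves C h T G' y)
    (k : ℝ) : Solves C h T (G + k * G') (fun t => x t + k • y t) := by
  intro i t ht
  have h1 := (hx i t ht).add ((hy i t ht).const_mul k)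
  refine h1.congr_deriv ?_
  simp only [PiLp.add_apply, PiLp.smul_apply, smul_eq_mul, mul_add, Finset.sum_add_distrib]
  have : ∑ j, C t i j * (k * y t j) = k * ∑ j, C t i j * y t j := by
    rw [Finset.mul_sum]
    exact Finset.sum_congr rfl fun j _ => by ring
  rw [this]
  ring

/-- The substitution `t = exp τ` turns the equation into a nonsingular linear one. Freezing the
coefficients at `T` for `τ > log T` makes them continuous on all of `ℝ`. -/
theorem RegularSingular.exists_solves (H : RegularSingular C h c T K) (G : ℝ) (v : V) (T₀ : ℝ) :
    ∃ x, Solves C h T G x ∧ x T₀ = v := by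
  set θ : ℝ → ℝ := fun τ => min (Real.exp τ) T with hθ
  have hθc : Continuous θ := Real.continuous_exp.min continuous_const
  have hθm : ∀ τ, θ τ ∈ Ioc 0 T := fun τ => ⟨lt_min (Real.exp_pos τ) H.T_pos, min_le_right _ _⟩
  have hCc : Continuous fun τ => -C (θ τ) := by
    refine continuous_matrix fun i j => ?_
    exact ((H.continuousOn_C i j).comp_continuous hθc hθm).neg
  have hhc : Continuous fun τ => G • h (θ τ) :=
    continuous_pi fun i => continuous_const.mul ((H.continuousOn_h i).comp_continuous hθc hθm)
  set Λ : Matrix (Fin 5) (Fin 5) ℝ →ₗ[ℝ] (Fin 5 → ℝ) →L[ℝ] (Fin 5 → ℝ) :=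
    (LinearMap.toContinuousLinearMap.toLinearMap).comp (Matrix.toLin'.toLinearMap) with hΛ
  have hΛc : Continuous Λ := Λ.continuous_of_finiteDimensional
  obtain ⟨X, hX0, hX⟩ := exists_forall_hasDerivAt_linear (hΛc.comp hCc) hhc
    (WithLp.ofLp v) (Real.log T₀)
  refine ⟨fun t => WithLp.toLp 2 (X (Real.log t)), fun i t ht => ?_, ?_⟩
  · have h1 := hasDerivAt_pi.1 (hX (Real.log t)) i
    have h2 := (h1.comp t (Real.hasDerivAt_log ht.1.ne')).hasDerivWithinAt (s := Ioc 0 T)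
    have h3 : θ (Real.log t) = t := by
      simp only [hθ, Real.exp_log ht.1]
      exact min_eq_left ht.2
    refine h2.congr_deriv ?_
    simp only [Function.comp, h3, hΛ, LinearMap.comp_apply, LinearEquiv.coe_coe,
      LinearMap.coe_toContinuousLinearMap', Matrix.toLin'_apply, Pi.add_apply, Pi.smul_apply,
      smul_eq_mul, Matrix.neg_mulVec, Pi.neg_apply, Matrix.mulVec, dotProduct]
    ring
  · simp [hX0]

theorem RegularSingular.weightedSize_le_of_forced (H : RegularSingular C h c T K)
    {y F : Fin 5 → ℝ → ℝ} {E : ℝ → ℝ}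
    (hy : ∀ i, ∀ t ∈ Ioc 0 T, HasDerivWithinAt (y i)
      (t⁻¹ * (-(∑ j, C t i j * y j t) + F i t)) (Ioc 0 T) t)
    (hE : ContinuousOn E (Ioc 0 T)) (hF : ∀ i, ∀ t ∈ Ioc 0 T, |F i t| ≤ E t)
    {t t' : ℝ} (ht : 0 < t) (htt' : t ≤ t') (ht' : t' ≤ T) :
    weightedSize c (fun j s => |y j s|) t
      ≤ (weightedSize c (fun j s => |y j s|) t' + (4 + √T) * ∫ s in t..t', s ^ (c - 3 / 2) * E s)
      * Real.exp (2 * (4 * K * (1 + √T)) * √T) := by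
  have hU : ∀ j, ContinuousOn (fun s => |y j s|) (Ioc 0 T) := fun j =>
    ContinuousOn.abs fun t ht => (hy j t ht).continuousWithinAt
  refine weightedSize_le (U := fun j s => |y j s|) H.one_lt H.K_nonneg hU hE
    (fun j t _ => abs_nonneg _) (fun t ht => (abs_nonneg _).trans (hF 0 t ht)) ht htt' ht' ?_ ?_
  · intro i r hr
    exact H.abs_castSucc_le i (hy _) hU hE (fun j t _ => le_rfl) (hF _) (ht.trans_le hr.1) hr.2 ht'
  · intro r hr
    exact H.rpow_mul_abs_last_le (hy 4) hU hE (fun j t _ => le_rfl) (hF _) (ht.trans_le hr.1)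
      hr.2 ht'

theorem Solves.weightedSize_le (H : RegularSingular C h c T K) {x : ℝ → V}
    (hx : Solves C h T G x) {t t' : ℝ} (ht : 0 < t) (htt' : t ≤ t') (ht' : t' ≤ T) :
    weightedSize c (fun j s => |x s j|) t
      ≤ (weightedSize c (fun j s => |x s j|) t'
          + (4 + √T) * ∫ s in t..t', s ^ (c - 3 / 2) * (|G| * (K * (1 + T))))
      * Real.exp (2 * (4 * K * (1 + √T)) * √T) := by
  refine H.weightedSize_le_of_forced (y := fun j s => x s j) (F := fun i s => G * h s i) hx
    continuousOn_const ?_ ht htt' ht'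
  intro i t ht
  rw [abs_mul]
  refine mul_le_mul_of_nonneg_left ?_ (abs_nonneg _)
  exact H.abs_h_le i ht

theorem Solves.exists_weightedSize_le (H : RegularSingular C h c T K) {x : ℝ → V}
    (hx : Solves C h T G x) :
    ∃ B, 0 ≤ B ∧ ∀ t ∈ Ioc 0 T, weightedSize c (fun j s => |x s j|) t ≤ B := by
  have hT := H.T_pos
  have hK := H.K_nonneg
  have hc := H.one_lt
  have h0 : 0 ≤ weightedSize c (fun j s => |x s j|) T :=
    weightedSize_nonneg hT fun j => abs_nonneg _
  have hc' : 0 < c - 1 / 2 := by linarith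
  refine ⟨(weightedSize c (fun j s => |x s j|) T
    + (4 + √T) * (T ^ (c - 1 / 2) / (c - 1 / 2) * (|G| * (K * (1 + T)))))
      * Real.exp (2 * (4 * K * (1 + √T)) * √T), by positivity, fun t ht => ?_⟩
  refine (hx.weightedSize_le H ht.1 ht.2 le_rfl).trans ?_
  refine mul_le_mul_of_nonneg_right (add_le_add le_rfl
    (mul_le_mul_of_nonneg_left ?_ (by positivity))) (Real.exp_pos _).le
  rw [intervalIntegral.integral_mul_const, integral_rpow (Or.inl (by linarith)),
    show c - 3 / 2 + 1 = c - 1 / 2 by ring]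
  refine mul_le_mul_of_nonneg_right ?_ (by positivity)
  exact div_le_div_of_nonneg_right (sub_le_self _ (Real.rpow_nonneg ht.1.le _)) hc'.le

theorem Solves.eq_zero_of_eq_zero (H : RegularSingular C h c T K) {x : ℝ → V}
    (hx : Solves C h T 0 x) (hxT : x T = 0) : ∀ t ∈ Ioc 0 T, x t = 0 := by
  intro t ht
  have h1 := hx.weightedSize_le H ht.1 ht.2 le_rfl
  have h2 : weightedSize c (fun j s => |x s j|) T = 0 := by simp [weightedSize, hxT]
  simp only [h2, abs_zero, zero_mul, mul_zero, intervalIntegral.integral_zero, add_zero] at h1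
  have hp1 := Real.rpow_pos_of_pos ht.1 c
  have hp2 := Real.rpow_pos_of_pos ht.1 (c - 1 / 2)
  have hN : 0 ≤ ∑ j : Fin 4, |x t j.castSucc| := Finset.sum_nonneg fun j _ => abs_nonneg _
  rw [weightedSize] at h1
  have h3 : |x t 4| = 0 := by
    have : t ^ c * |x t 4| ≤ 0 := by linarith [mul_nonneg hp2.le hN]
    exact le_antisymm (nonpos_of_mul_nonpos_right this hp1) (abs_nonneg _)
  have h4 : ∑ j : Fin 4, |x t j.castSucc| = 0 := by
    have : t ^ (c - 1 / 2) * ∑ j : Fin 4, |x t j.castSucc| ≤ 0 := by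
      linarith [mul_nonneg hp1.le (abs_nonneg (x t 4))]
    exact le_antisymm (nonpos_of_mul_nonpos_right this hp2) hN
  ext i
  induction i using Fin.lastCases with
  | last => exact abs_eq_zero.1 h3
  | cast i =>
    exact abs_eq_zero.1 ((Finset.sum_eq_zero_iff_of_nonneg fun j _ => abs_nonneg _).1 h4 i
      (Finset.mem_univ i))

theorem rpow_le_const_mul_rpow {s p r : ℝ} (hs : s ∈ Ioc 0 T) (hpr : r ≤ p) :
    s ^ p ≤ T ^ (p - r) * s ^ r := by
  rw [show s ^ p = s ^ (p - r) * s ^ r by rw [← Real.rpow_add hs.1]; congr 1; ring]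
  exact mul_le_mul_of_nonneg_right (Real.rpow_le_rpow hs.1.le hs.2 (by linarith))
    (Real.rpow_nonneg hs.1.le _)

/-- The derivative of `t ^ c x₅(t)`, without the factor `t ^ (c - 1)`. -/
def lastForce (C : ℝ → Matrix (Fin 5) (Fin 5) ℝ) (h : ℝ → Fin 5 → ℝ) (c G : ℝ) (x : ℝ → V)
    (t : ℝ) : ℝ :=
  (c - C t 4 4) * x t 4 - ∑ j : Fin 4, C t 4 j.castSucc * x t j.castSucc + G * h t 4

theorem Solves.hasDerivWithinAt_last {x : ℝ → V} (hx : Solves C h T G x) {t : ℝ}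
    (ht : t ∈ Ioc 0 T) :
    HasDerivWithinAt (fun s => s ^ c * x s 4) (t ^ (c - 1) * lastForce C h c G x t) (Ioc 0 T) t :=
  hasDerivWithinAt_rpow_mul (y := fun j s => x s j) (F := fun s => G * h s 4) ht (hx 4 t ht) rfl

theorem RegularSingular.abs_lastForce_le (H : RegularSingular C h c T K) (x : ℝ → V) {t : ℝ}
    (ht : t ∈ Ioc 0 T) :
    |t ^ (c - 1) * lastForce C h c G x t|
      ≤ t ^ (c - 1) * (K * (∑ j : Fin 4, |x t j.castSucc| + t * |x t 4|) + |G| * K) :=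
  H.abs_last_integrand_le (y := fun j s => x s j) (U := fun j s => |x s j|)
    (F := fun s => G * h s 4) (E := fun _ => |G| * K) ht (fun _ => le_rfl) (by
      rw [abs_mul]
      exact mul_le_mul_of_nonneg_left (H.h_last t ht) (abs_nonneg _))

/-- Bounds the derivative of `t ^ c x₅` by the integrable power `t ^ (-1/2)`. The exponent is
written `1/2 - 1` to match `γ - 1` with `γ = 1/2`. -/
theorem rpow_sub_one_mul_le_weightedSize {t : ℝ} (ht : t ∈ Ioc 0 T) (U : Fin 5 → ℝ → ℝ)
    (hU : ∀ j, 0 ≤ U j t) :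
    t ^ (c - 1) * (∑ j : Fin 4, U j.castSucc t + t * U 4 t)
      ≤ (1 + √T) * weightedSize c U t * t ^ ((1 / 2 : ℝ) - 1) := by
  set w := √t with hw
  have hw0 : 0 < w := Real.sqrt_pos.2 ht.1
  have hwT : w ≤ √T := Real.sqrt_le_sqrt ht.2
  have hsw : t = w ^ 2 := (Real.sq_sqrt ht.1.le).symm
  have e1 : t ^ (c - 1 / 2) = t ^ c / w := rpow_sub_half ht.1 c
  have e2 : t ^ (c - 1) = t ^ c / w ^ 2 := by rw [Real.rpow_sub_one ht.1.ne', ← hsw]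
  have e3 : t ^ ((1 / 2 : ℝ) - 1) = 1 / w := by
    rw [Real.rpow_sub_one ht.1.ne', ← Real.sqrt_eq_rpow, ← hw]
    rw [div_eq_div_iff ht.1.ne' hw0.ne', one_mul, ← sq, ← hsw]
  have hN : 0 ≤ ∑ j : Fin 4, U j.castSucc t := Finset.sum_nonneg fun j _ => hU _
  have hM := hU 4
  have hp : 0 ≤ t ^ c := Real.rpow_nonneg ht.1.le _
  rw [weightedSize, e1, e2, e3]
  set N := ∑ j : Fin 4, U j.castSucc t
  set P := t ^ c
  have hid : (1 + √T) * (P * U 4 t + P / w * N) * (1 / w) - P / w ^ 2 * (N + t * U 4 t)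
      = P * (√T - w) * (U 4 t / w) + P * (U 4 t / w) + P * √T * N / w ^ 2 := by
    rw [hsw]
    field_simp
    ring
  have : 0 ≤ P * (√T - w) * (U 4 t / w) + P * (U 4 t / w) + P * √T * N / w ^ 2 := by
    have := sub_nonneg.2 hwT
    positivity
  linarith

/-- Every solution has `t ^ c x₅(t)` convergent. -/
theorem Solves.exists_tendsto_last (H : RegularSingular C h c T K) {x : ℝ → V}
    (hx : Solves C h T G x) : ∃ β, Tendsto (fun t => t ^ c * x t 4) (𝓝[>] 0) (𝓝 β) := by
  obtain ⟨B, hB0, hB⟩ := hx.exists_weightedSize_le H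
  have hT := H.T_pos
  have hK := H.K_nonneg
  have hc := H.one_lt
  obtain ⟨L, hL, -⟩ := exists_tendsto_of_abs_deriv_le_rpow
    (B := K * ((1 + √T) * B) + |G| * K * T ^ (c - 1 / 2)) (γ := 1 / 2) hT
    (by norm_num) (fun t ht => hx.hasDerivWithinAt_last (c := c) ht) fun t ht => by
      refine (H.abs_lastForce_le x ht).trans ?_
      have h1 := rpow_sub_one_mul_le_weightedSize (c := c) ht (fun j s => |x s j|)
        fun j => abs_nonneg _
      have h2 : (1 + √T) * weightedSize c (fun j s => |x s j|) t * t ^ ((1 / 2 : ℝ) - 1)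
          ≤ (1 + √T) * B * t ^ ((1 / 2 : ℝ) - 1) :=
        mul_le_mul_of_nonneg_right (mul_le_mul_of_nonneg_left (hB t ht) (by positivity))
          (Real.rpow_nonneg ht.1.le _)
      have h3 : t ^ (c - 1) ≤ T ^ (c - 1 / 2) * t ^ ((1 / 2 : ℝ) - 1) := by
        have := rpow_le_const_mul_rpow (p := c - 1) (r := 1 / 2 - 1) ht (by linarith)
        rwa [show c - 1 - (1 / 2 - 1) = c - 1 / 2 by ring] at this
      have h4 := mul_le_mul_of_nonneg_left (h1.trans h2) hK
      have h5 := mul_le_mul_of_nonneg_left h3 (mul_nonneg (abs_nonneg G) hK)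
      linarith
  exact ⟨L, hL⟩

/-- The weight `t ^ (c - 1/2)` of the regular components leaves a spare factor `√t`. -/
theorem Solves.tendsto_castSucc (H : RegularSingular C h c T K) {x : ℝ → V}
    (hx : Solves C h T G x) (i : Fin 4) :
    Tendsto (fun t => t ^ c * x t i.castSucc) (𝓝[>] 0) (𝓝 0) := by
  obtain ⟨B, hB0, hB⟩ := hx.exists_weightedSize_le H
  have h1 : Tendsto (fun t : ℝ => B * √t) (𝓝[>] 0) (𝓝 0) := by
    have := (Real.continuous_sqrt.tendsto 0).const_mul B
    rw [Real.sqrt_zero, mul_zero] at this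
    exact this.mono_left nhdsWithin_le_nhds
  refine squeeze_zero_norm' ?_ h1
  filter_upwards [Ioc_mem_nhdsGT H.T_pos] with t ht
  have hp := Real.rpow_pos_of_pos ht.1 c
  have hw := Real.sqrt_pos.2 ht.1
  have h2 := hB t ht
  rw [weightedSize, rpow_sub_half ht.1] at h2
  have h3 : |x t i.castSucc| ≤ ∑ j : Fin 4, |x t j.castSucc| :=
    Finset.single_le_sum (f := fun j : Fin 4 => |x t j.castSucc|) (fun j _ => abs_nonneg _)
      (Finset.mem_univ i)
  have h4 : t ^ c / √t * |x t i.castSucc| ≤ B := by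
    have := mul_le_mul_of_nonneg_left h3 (div_pos hp hw).le
    have := mul_nonneg hp.le (abs_nonneg (x t 4))
    linarith
  rw [Real.norm_eq_abs, abs_mul, abs_of_pos hp]
  rw [div_mul_eq_mul_div, div_le_iff₀ hw] at h4
  exact h4

end Asymptotics

/-! ### Regular solutions by bootstrap, and the fundamental system -/

section Fundamental

variable {C : ℝ → Matrix (Fin 5) (Fin 5) ℝ} {h : ℝ → Fin 5 → ℝ} {c T K G : ℝ}

/-- Pulling `s ^ (-α) ≤ t ^ (-α)` out of the integral leaves `s ^ (-1/2)`, so the exponent `α =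
1/2`, where direct integration gives a logarithm, needs no separate case. -/
theorem abs_le_rpow_neg_of_abs_deriv_le {f f' : ℝ → ℝ} {D α t : ℝ} (hα : 0 ≤ α)
    (hf : ∀ s ∈ Ioc 0 T, HasDerivWithinAt f (f' s) (Ioc 0 T) s) (hD : 0 ≤ D)
    (hfD : ∀ s ∈ Ioc 0 T, |f' s| ≤ D * s ^ (-α - 1 / 2)) (ht : t ∈ Ioc 0 T) :
    |f t| ≤ (|f T| * T ^ α + D * (2 * √T)) * t ^ (-α) := by
  have hT : 0 < T := ht.1.trans_le ht.2
  have hp : 0 < t ^ (-α) := Real.rpow_pos_of_pos ht.1 _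
  have h1 := abs_sub_le_integral_of_hasDerivWithinAt (B := fun s => D * s ^ (-α - 1 / 2)) hf
    (continuousOn_const.mul (continuousOn_rpow_Ioc _ T)) hfD ht.1 ht.2 le_rfl
  have h2 : ∫ s in t..T, D * s ^ (-α - 1 / 2) ≤ ∫ s in t..T, (D * t ^ (-α)) * s ^ (-(1 / 2) : ℝ) := by
    refine intervalIntegral.integral_mono_on ht.2
      (intervalIntegrable_of_continuousOn_Ioc
        (continuousOn_const.mul (continuousOn_rpow_Ioc _ T)) ht.1 ht.2 le_rfl)
      (intervalIntegrable_of_continuousOn_Ioc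
        (continuousOn_const.mul (continuousOn_rpow_Ioc _ T)) ht.1 ht.2 le_rfl) fun s hs => ?_
    have hs0 := ht.1.trans_le hs.1
    rw [mul_assoc]
    refine mul_le_mul_of_nonneg_left ?_ hD
    rw [show -α - 1 / 2 = -α + -(1 / 2) by ring, Real.rpow_add hs0]
    exact mul_le_mul_of_nonneg_right (Real.rpow_le_rpow_of_nonpos ht.1 hs.1 (by linarith))
      (Real.rpow_nonneg hs0.le _)
  rw [intervalIntegral.integral_const_mul (D * t ^ (-α)),
    integral_rpow (r := -(1 / 2)) (Or.inl (by norm_num))] at h2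
  have h3 : (T ^ (-(1 / 2) + 1 : ℝ) - t ^ (-(1 / 2) + 1 : ℝ)) / (-(1 / 2) + 1) ≤ 2 * √T := by
    rw [show (-(1 / 2) + 1 : ℝ) = 1 / 2 by norm_num, ← Real.sqrt_eq_rpow, ← Real.sqrt_eq_rpow]
    linarith [Real.sqrt_nonneg t]
  have h4 := mul_le_mul_of_nonneg_left h3 (mul_nonneg hD hp.le)
  have h5 : 1 ≤ T ^ α * t ^ (-α) := by
    have := rpow_le_const_mul_rpow (p := 0) (r := -α) ht (by linarith)
    simpa using this
  have h6 := mul_le_mul_of_nonneg_left h5 (abs_nonneg (f T))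
  have h7 := abs_sub_abs_le_abs_sub (f t) (f T)
  rw [abs_sub_comm] at h7
  linarith

/-- One bootstrap step, gaining up to half a power. The regular components are integrated down from
`T`. The last one is integrated up from `0`, where `t ^ c x₅` vanishes, so no `t ^ (-c)` term
appears. -/
theorem Solves.improve_decay (H : RegularSingular C h c T K) {x : ℝ → V}
    (hx : Solves C h T G x) (hβ : Tendsto (fun t => t ^ c * x t 4) (𝓝[>] 0) (𝓝 0))
    {α α' : ℝ} (hα' : 0 ≤ α') (hαα' : α ≤ α' + 1 / 2) (hα'c : α' < c)
    (hb : ∃ B, 0 ≤ B ∧ ∀ j, ∀ t ∈ Ioc 0 T, |x t j| ≤ B * t ^ (-α)) :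
    ∃ B, 0 ≤ B ∧ ∀ j, ∀ t ∈ Ioc 0 T, |x t j| ≤ B * t ^ (-α') := by
  obtain ⟨B, hB0, hB⟩ := hb
  have hT := H.T_pos
  have hK := H.K_nonneg
  set D := 5 * K * B * T ^ (α' + 1 / 2 - α) + |G| * K * T ^ (α' + 1 / 2) with hD
  have hD0 : 0 ≤ D := by positivity
  have hreg : ∀ i : Fin 4, ∀ t ∈ Ioc 0 T, |x t i.castSucc|
      ≤ (|x T i.castSucc| * T ^ α' + D * (2 * √T)) * t ^ (-α') := by
    intro i t ht
    refine abs_le_rpow_neg_of_abs_deriv_le hα' (hx i.castSucc) hD0 (fun s hs => ?_) ht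
    have h1 : |∑ j, C s i.castSucc j * x s j| ≤ 5 * (K * s * (B * s ^ (-α))) := by
      refine (Finset.abs_sum_le_sum_abs _ _).trans ?_
      calc _ ≤ ∑ _j : Fin 5, K * s * (B * s ^ (-α)) := Finset.sum_le_sum fun j _ => by
            rw [abs_mul]
            exact mul_le_mul (H.C_castSucc i j s hs) (hB j s hs) (abs_nonneg _)
              (mul_nonneg hK hs.1.le)
        _ = _ := by simp
    have h2 : |G * h s i.castSucc| ≤ |G| * (K * s) := by
      rw [abs_mul]
      exact mul_le_mul_of_nonneg_left (H.h_castSucc i s hs) (abs_nonneg _)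
    have h3 : |-(∑ j, C s i.castSucc j * x s j) + G * h s i.castSucc|
        ≤ s * (5 * K * B * s ^ (-α) + |G| * K) := by
      have := abs_add_le (-(∑ j, C s i.castSucc j * x s j)) (G * h s i.castSucc)
      rw [abs_neg] at this
      linarith
    rw [abs_mul, abs_of_pos (inv_pos.2 hs.1), inv_mul_le_iff₀ hs.1]
    refine h3.trans (mul_le_mul_of_nonneg_left ?_ hs.1.le)
    have h4 := rpow_le_const_mul_rpow (p := -α) (r := -α' - 1 / 2) hs (by linarith)
    have h5 := rpow_le_const_mul_rpow (p := 0) (r := -α' - 1 / 2) hs (by linarith)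
    rw [show -α - (-α' - 1 / 2) = α' + 1 / 2 - α by ring] at h4
    rw [Real.rpow_zero, show 0 - (-α' - 1 / 2) = α' + 1 / 2 by ring] at h5
    have h6 := mul_le_mul_of_nonneg_left h4 (show 0 ≤ 5 * K * B by positivity)
    have h7 := mul_le_mul_of_nonneg_left h5 (show 0 ≤ |G| * K by positivity)
    rw [hD]
    linarith
  set N₀ := ∑ i : Fin 4, (|x T i.castSucc| * T ^ α' + D * (2 * √T)) with hN₀
  have hterm : ∀ i : Fin 4, 0 ≤ |x T i.castSucc| * T ^ α' + D * (2 * √T) := fun i => by positivity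
  have hN₀0 : 0 ≤ N₀ := Finset.sum_nonneg fun i _ => hterm i
  have hN : ∀ t ∈ Ioc 0 T, ∑ i : Fin 4, |x t i.castSucc| ≤ N₀ * t ^ (-α') := fun t ht => by
    rw [hN₀, Finset.sum_mul]
    exact Finset.sum_le_sum fun i _ => hreg i t ht
  set Q := K * (N₀ + B * T ^ (1 - α + α')) + |G| * K * T ^ α' with hQ
  have hQ0 : 0 ≤ Q := by positivity
  obtain ⟨L, hL, hLb⟩ := exists_tendsto_of_abs_deriv_le_rpow (B := Q) (γ := c - α') hT
    (by linarith) (fun t ht => hx.hasDerivWithinAt_last (c := c) ht) fun t ht => by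
      refine (H.abs_lastForce_le x ht).trans ?_
      have e : t ^ (c - α' - 1) = t ^ (c - 1) * t ^ (-α') := by
        rw [← Real.rpow_add ht.1]
        congr 1
        ring
      have h1 : t * |x t 4| ≤ B * (T ^ (1 - α + α') * t ^ (-α')) := by
        have h4 := rpow_le_const_mul_rpow (p := 1 - α) (r := -α') ht (by linarith)
        rw [show 1 - α - -α' = 1 - α + α' by ring] at h4
        have h5 : t ^ (1 - α) = t * t ^ (-α) := by
          rw [show 1 - α = 1 + -α by ring, Real.rpow_add ht.1, Real.rpow_one]
        have h6 := mul_le_mul_of_nonneg_left (hB 4 t ht) ht.1.le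
        have h7 := mul_le_mul_of_nonneg_left h4 hB0
        rw [h5] at h7
        linarith
      have h2 : 1 ≤ T ^ α' * t ^ (-α') := by
        have := rpow_le_const_mul_rpow (p := 0) (r := -α') ht (by linarith)
        simpa using this
      rw [e, ← mul_assoc, mul_comm Q, mul_assoc]
      refine mul_le_mul_of_nonneg_left ?_ (Real.rpow_nonneg ht.1.le _)
      have h3 := mul_le_mul_of_nonneg_left (add_le_add (hN t ht) h1) hK
      have h4 := mul_le_mul_of_nonneg_left h2 (show 0 ≤ |G| * K by positivity)
      rw [hQ]
      linarith
  -- The rate bound now controls `t ^ c x₅` itself by `t ^ (c - α')`; dividing by `t ^ c` gives the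
  -- claim.
  obtain rfl : L = 0 := tendsto_nhds_unique hL hβ
  have hcα : 0 < c - α' := by linarith
  refine ⟨N₀ + Q / (c - α'), by positivity, fun j t ht => ?_⟩
  have hp : 0 < t ^ (-α') := Real.rpow_pos_of_pos ht.1 _
  induction j using Fin.lastCases with
  | last =>
    have h1 := hLb t ht
    have hpc := Real.rpow_pos_of_pos ht.1 c
    rw [sub_zero, abs_mul, abs_of_pos hpc, show c - α' = c + -α' by ring, Real.rpow_add ht.1,
      mul_left_comm] at h1
    have h2 := le_of_mul_le_mul_left h1 hpc
    have h3 := mul_nonneg hN₀0 hp.le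
    rw [show c - α' = c + -α' by ring]
    refine h2.trans ?_
    linarith
  | cast i =>
    have h1 : |x t i.castSucc| ≤ ∑ j : Fin 4, |x t j.castSucc| :=
      Finset.single_le_sum (f := fun j : Fin 4 => |x t j.castSucc|) (fun j _ => abs_nonneg _)
        (Finset.mem_univ i)
    have h2 := hN t ht
    have h3 : 0 ≤ Q / (c - α') * t ^ (-α') := by positivity
    linarith

/-- The bootstrap starts from the a priori exponent `c` and lowers it by `1/2` at a time, clamped at
`0`; at least `2 c` steps reach boundedness. -/
theorem Solves.exists_abs_le (H : RegularSingular C h c T K) {x : ℝ → V}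
    (hx : Solves C h T G x) (hβ : Tendsto (fun t => t ^ c * x t 4) (𝓝[>] 0) (𝓝 0)) :
    ∃ B, 0 ≤ B ∧ ∀ j, ∀ t ∈ Ioc 0 T, |x t j| ≤ B := by
  have hc := H.one_lt
  have hT := H.T_pos
  have key : ∀ n : ℕ, ∃ B, 0 ≤ B ∧ ∀ j, ∀ t ∈ Ioc 0 T,
      |x t j| ≤ B * t ^ (-(max (c - n / 2) 0)) := by
    intro n
    induction n with
    | zero =>
      obtain ⟨B, hB0, hB⟩ := hx.exists_weightedSize_le H
      refine ⟨B * (1 + √T), by positivity, fun j t ht => ?_⟩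
      rw [Nat.cast_zero, zero_div, sub_zero, max_eq_left (by linarith), Real.rpow_neg ht.1.le,
        ← div_eq_mul_inv, le_div_iff₀ (Real.rpow_pos_of_pos ht.1 c), mul_comm]
      refine (rpow_mul_le_weightedSize ht (fun j s => |x s j|) (fun j => abs_nonneg _) j).trans ?_
      rw [mul_comm]
      exact mul_le_mul_of_nonneg_right (hB t ht) (by positivity)
    | succ n ih =>
      refine hx.improve_decay H hβ (le_max_right _ _) ?_ ?_ ih
      · push_cast
        rcases le_total (c - (n + 1) / 2) 0 with h0 | h0
        · rw [max_eq_right h0]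
          exact max_le (by linarith) (by norm_num)
        · rw [max_eq_left h0]
          exact max_le (by linarith) (by linarith)
      · refine max_lt ?_ (by linarith)
        push_cast
        have : (0 : ℝ) ≤ n := n.cast_nonneg
        linarith
  obtain ⟨n, hn⟩ := exists_nat_ge (2 * c)
  obtain ⟨B, hB0, hB⟩ := key n
  rw [max_eq_right (by linarith)] at hB
  exact ⟨B, hB0, by simpa using hB⟩

theorem tendsto_euclidean {f : ℝ → V} {l : Filter ℝ} {v : V}
    (hf : ∀ i, Tendsto (fun t => f t i) l (𝓝 (v i))) : Tendsto f l (𝓝 v) := by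
  have h1 : Tendsto (fun t => WithLp.ofLp (f t)) l (𝓝 (WithLp.ofLp v)) := tendsto_pi_nhds.2 hf
  exact ((PiLp.continuous_toLp 2 (fun _ : Fin 5 => ℝ)).tendsto _).comp h1

/-- A solution without singular part has a limit at the singular point. -/
theorem Solves.exists_tendsto (H : RegularSingular C h c T K) {x : ℝ → V}
    (hx : Solves C h T G x) (hβ : Tendsto (fun t => t ^ c * x t 4) (𝓝[>] 0) (𝓝 0)) :
    ∃ v, Tendsto x (𝓝[>] 0) (𝓝 v) := by
  obtain ⟨B, hB0, hB⟩ := hx.exists_abs_le H hβ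
  have hT := H.T_pos
  have hK := H.K_nonneg
  have hc := H.one_lt
  have hreg : ∀ i : Fin 4, ∃ L, Tendsto (fun t => x t i.castSucc) (𝓝[>] 0) (𝓝 L) := by
    intro i
    obtain ⟨L, hL, -⟩ := exists_tendsto_of_abs_deriv_le_rpow (B := 5 * K * B + |G| * K) (γ := 1) hT
      one_pos (hx i.castSucc) fun s hs => by
        have h1 : |∑ j, C s i.castSucc j * x s j| ≤ 5 * (K * s * B) := by
          refine (Finset.abs_sum_le_sum_abs _ _).trans ?_
          calc _ ≤ ∑ _j : Fin 5, K * s * B := Finset.sum_le_sum fun j _ => by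
                rw [abs_mul]
                exact mul_le_mul (H.C_castSucc i j s hs) (hB j s hs) (abs_nonneg _)
                  (mul_nonneg hK hs.1.le)
            _ = _ := by simp
        have h2 : |G * h s i.castSucc| ≤ |G| * (K * s) := by
          rw [abs_mul]
          exact mul_le_mul_of_nonneg_left (H.h_castSucc i s hs) (abs_nonneg _)
        have h3 := abs_add_le (-(∑ j, C s i.castSucc j * x s j)) (G * h s i.castSucc)
        rw [abs_neg] at h3
        rw [abs_mul, abs_of_pos (inv_pos.2 hs.1), inv_mul_le_iff₀ hs.1]
        simp only [sub_self, Real.rpow_zero, mul_one]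
        linarith
    exact ⟨L, hL⟩
  choose L hL using hreg
  choose M hM using H.C_tendsto
  obtain ⟨η, hη⟩ := H.h_tendsto
  have hforce : Tendsto (lastForce C h c G x) (𝓝[>] 0)
      (𝓝 (0 - ∑ j : Fin 4, M j * L j + G * η)) := by
    refine Tendsto.add (Tendsto.sub ?_ (tendsto_finsetSum _ fun j _ => (hM j).mul (hL j)))
      (hη.const_mul G)
    have h1 : Tendsto (fun t : ℝ => K * t * B) (𝓝[>] 0) (𝓝 0) := by
      have : Continuous fun t : ℝ => K * t * B := by fun_prop
      simpa using (this.tendsto 0).mono_left nhdsWithin_le_nhds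
    refine squeeze_zero_norm' ?_ h1
    filter_upwards [Ioc_mem_nhdsGT hT] with t ht
    rw [Real.norm_eq_abs, abs_mul]
    exact mul_le_mul (H.C_diag t ht) (hB 4 t ht) (abs_nonneg _) (mul_nonneg hK ht.1.le)
  set Λ := 0 - ∑ j : Fin 4, M j * L j + G * η
  -- An argument of l'Hôpital type: `t ^ c x₅` vanishes at `0` and has derivative `t ^ (c - 1) (Λ +
  -- o(1))`. It is compared with `(Λ / c) t ^ c`.
  have hlast : Tendsto (fun t => x t 4) (𝓝[>] 0) (𝓝 (Λ / c)) := by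
    rw [Metric.tendsto_nhds]
    intro ε hε
    have h1 : ∀ᶠ t in 𝓝[>] (0 : ℝ), |lastForce C h c G x t - Λ| < ε / 2 :=
      (Metric.tendsto_nhds.1 hforce (ε / 2) (by positivity))
    obtain ⟨δ, hδ0, hδ⟩ := mem_nhdsGT_iff_exists_Ioc_subset.1 (inter_mem h1 (Ioc_mem_nhdsGT hT))
    have hδ0 : 0 < δ := hδ0
    have hδT : Ioc 0 δ ⊆ Ioc 0 T := fun s hs => (hδ hs).2
    obtain ⟨L', hL', hb⟩ := exists_tendsto_of_abs_deriv_le_rpow (B := ε / 2) (γ := c)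
      (f := fun s => s ^ c * x s 4 - Λ / c * s ^ c)
      (f' := fun s => s ^ (c - 1) * (lastForce C h c G x s - Λ)) hδ0 (by linarith)
      (fun s hs => by
        have h2 := ((hx.hasDerivWithinAt_last (c := c) (hδT hs)).mono hδT).sub
          (((Real.hasDerivAt_rpow_const (p := c) (Or.inl hs.1.ne')).hasDerivWithinAt
            (s := Ioc 0 δ)).const_mul (Λ / c))
        refine h2.congr_deriv ?_
        have : c ≠ 0 := by linarith
        field_simp)
      (fun s hs => by
        rw [abs_mul, abs_of_pos (Real.rpow_pos_of_pos hs.1 _), mul_comm]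
        exact mul_le_mul_of_nonneg_right (hδ hs).1.le (Real.rpow_nonneg hs.1.le _))
    have hL'0 : L' = 0 := by
      have h3 : Tendsto (fun s : ℝ => s ^ c) (𝓝[>] 0) (𝓝 0) := by
        have := (Real.continuousAt_rpow_const 0 c (Or.inr (by linarith))).tendsto
        rw [Real.zero_rpow (by linarith)] at this
        exact this.mono_left nhdsWithin_le_nhds
      have h4 := hβ.sub (h3.const_mul (Λ / c))
      rw [mul_zero, sub_zero] at h4
      exact tendsto_nhds_unique hL' h4
    filter_upwards [Ioc_mem_nhdsGT hδ0] with t ht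
    have hpc := Real.rpow_pos_of_pos ht.1 c
    have h5 := hb t ht
    rw [hL'0, sub_zero, show t ^ c * x t 4 - Λ / c * t ^ c = t ^ c * (x t 4 - Λ / c) by ring,
      abs_mul, abs_of_pos hpc, mul_comm] at h5
    have h6 := le_of_mul_le_mul_right h5 hpc
    rw [Real.dist_eq]
    refine h6.trans_lt ?_
    rw [div_lt_iff₀ (by linarith)]
    nlinarith
  refine ⟨WithLp.toLp 2 (Fin.lastCases (Λ / c) L), tendsto_euclidean fun i => ?_⟩
  induction i using Fin.lastCases with
  | last =>
    have : (Fin.lastCases (Λ / c) L (4 : Fin 5) : ℝ) = Λ / c := Fin.lastCases_last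
    simpa [this] using hlast
  | cast i => simpa using hL i

/-- Some homogeneous solution has a nonzero singular part. -/
theorem RegularSingular.exists_singular (H : RegularSingular C h c T K) :
    ∃ x β, Solves C h T 0 x ∧ β ≠ 0 ∧ Tendsto (fun t => t ^ c * x t 4) (𝓝[>] 0) (𝓝 β) := by
  have hT := H.T_pos
  have hK := H.K_nonneg
  set e := Real.exp (2 * (4 * K * (1 + √T)) * √T) with he
  have he0 : 0 < e := Real.exp_pos _
  set Q := K * ((1 + √T) * e) with hQ
  have hQ0 : 0 ≤ Q := by positivity
  -- The solution equal to `e₅` at `δ` has `t ^ c x₅ = δ ^ c` there. Between `δ` and `0` this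
  -- changes by at most `2 Q √δ * δ ^ c`, so for small `δ` the limit cannot vanish.
  obtain ⟨δ, hδ0, hδT, hδ⟩ : ∃ δ, 0 < δ ∧ δ ≤ T ∧ 2 * Q * √δ < 1 := by
    have h1 : Tendsto (fun t : ℝ => 2 * Q * √t) (𝓝[>] 0) (𝓝 0) := by
      have : Continuous fun t : ℝ => 2 * Q * √t := by fun_prop
      simpa using (this.tendsto 0).mono_left nhdsWithin_le_nhds
    obtain ⟨δ, h2, h3⟩ := ((h1.eventually (gt_mem_nhds one_pos)).and (Ioc_mem_nhdsGT hT)).exists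
    exact ⟨δ, h3.1, h3.2, h2⟩
  obtain ⟨x, hx, hxδ⟩ := H.exists_solves 0 (EuclideanSpace.single 4 1) δ
  have hpδ := Real.rpow_pos_of_pos hδ0 c
  have hZδ : weightedSize c (fun j s => |x s j|) δ = δ ^ c := by
    have h1 : ∀ j : Fin 4, x δ j.castSucc = 0 := fun j => by
      rw [hxδ]
      have : j.castSucc ≠ (4 : Fin 5) := (Fin.castSucc_lt_last j).ne
      simp [this]
    have h2 : x δ 4 = 1 := by simp [hxδ]
    simp only [weightedSize, h1, h2]
    simp
  have hsub : Ioc 0 δ ⊆ Ioc 0 T := Ioc_subset_Ioc_right hδT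
  have hZ : ∀ t ∈ Ioc 0 δ, weightedSize c (fun j s => |x s j|) t ≤ δ ^ c * e := by
    intro t ht
    have := hx.weightedSize_le H ht.1 ht.2 hδT
    simpa [hZδ, he] using this
  obtain ⟨β, hβ, hb⟩ := exists_tendsto_of_abs_deriv_le_rpow (B := Q * δ ^ c) (γ := 1 / 2) hδ0
    (by norm_num) (fun t ht => (hx.hasDerivWithinAt_last (c := c) (hsub ht)).mono hsub) fun t ht => by
      refine (H.abs_lastForce_le x (hsub ht)).trans ?_
      have h1 := rpow_sub_one_mul_le_weightedSize (c := c) (hsub ht) (fun j s => |x s j|)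
        fun j => abs_nonneg _
      have h2 : (1 + √T) * weightedSize c (fun j s => |x s j|) t * t ^ ((1 / 2 : ℝ) - 1)
          ≤ (1 + √T) * (δ ^ c * e) * t ^ ((1 / 2 : ℝ) - 1) :=
        mul_le_mul_of_nonneg_right (mul_le_mul_of_nonneg_left (hZ t ht) (by positivity))
          (Real.rpow_nonneg ht.1.le _)
      have h4 := mul_le_mul_of_nonneg_left (h1.trans h2) hK
      rw [abs_zero, zero_mul, add_zero, hQ]
      linarith
  refine ⟨x, β, hx, ?_, hβ⟩
  rintro rfl
  have h1 := hb δ ⟨hδ0, le_rfl⟩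
  rw [show x δ 4 = 1 by simp [hxδ], ← Real.sqrt_eq_rpow, mul_one, sub_zero, abs_of_pos hpδ] at h1
  have h2 : Q * δ ^ c / (1 / 2) * √δ = δ ^ c * (2 * Q * √δ) := by ring
  rw [h2] at h1
  nlinarith

theorem Solves.eq_of_eq (H : RegularSingular C h c T K) {x y : ℝ → V}
    (hx : Solves C h T 0 x) (hy : Solves C h T 0 y) (hxy : x T = y T) :
    ∀ t ∈ Ioc 0 T, x t = y t := by
  intro t ht
  have h1 := hx.add_smul hy (-1)
  rw [mul_zero, add_zero] at h1
  have h2 := h1.eq_zero_of_eq_zero H (by simp [hxy]) t ht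
  rwa [neg_one_smul, ← sub_eq_add_neg, sub_eq_zero] at h2

/-- A fundamental system, ordered so that only the last solution is singular. -/
theorem RegularSingular.exists_fundamental (H : RegularSingular C h c T K) (G : ℝ) :
    ∃ (φ : Fin 5 → ℝ → V) (χ : ℝ → V), (∀ i, Solves C h T 0 (φ i)) ∧ Solves C h T G χ ∧
      LinearIndependent ℝ (fun i => φ i T) ∧
      (∀ i, i ≠ 4 → ∃ v, Tendsto (φ i) (𝓝[>] 0) (𝓝 v)) ∧
      (∃ v, Tendsto χ (𝓝[>] 0) (𝓝 v)) ∧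
      Tendsto (fun t : ℝ => t ^ c • φ 4 t) (𝓝[>] 0) (𝓝 (EuclideanSpace.single 4 1)) := by
  have hT := H.T_pos
  -- `X v` is the homogeneous solution with value `v` at `T`, and `b v` the coefficient of its
  -- singular part. By uniqueness `b` is linear, and its four-dimensional kernel supplies the
  -- regular solutions.
  choose X hX hXT using fun v : V => H.exists_solves 0 v T
  choose b hb using fun v : V => (hX v).exists_tendsto_last H
  have hcomb : ∀ (k : ℝ) (v w : V), ∀ t ∈ Ioc 0 T, X (v + k • w) t = X v t + k • X w t := by
    intro k v w t ht
    exact (hX (v + k • w)).eq_of_eq H (by simpa using (hX v).add_smul (hX w) k) (by simp [hXT]) t ht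
  have hbcomb : ∀ (k : ℝ) (v w : V), b (v + k • w) = b v + k * b w := by
    intro k v w
    refine tendsto_nhds_unique (hb (v + k • w)) (((hb v).add ((hb w).const_mul k)).congr' ?_)
    filter_upwards [Ioc_mem_nhdsGT hT] with t ht
    rw [hcomb k v w t ht]
    simp only [PiLp.add_apply, PiLp.smul_apply, smul_eq_mul]
    ring
  have hb0 : b 0 = 0 := by
    have := hbcomb 1 0 0
    simpa using this
  set β : V →ₗ[ℝ] ℝ :=
    { toFun := b
      map_add' := fun v w => by simpa using hbcomb 1 v w
      map_smul' := fun k v => by simpa [hb0] using hbcomb k 0 v } with hβ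
  obtain ⟨y, γ, hy, hγ, hyγ⟩ := H.exists_singular
  have hyT : b (y T) = γ := by
    refine tendsto_nhds_unique (hb (y T)) (hyγ.congr' ?_)
    filter_upwards [Ioc_mem_nhdsGT hT] with t ht
    rw [(hX (y T)).eq_of_eq H hy (hXT _) t ht]
  set v₅ : V := γ⁻¹ • y T with hv₅
  have hβ5 : β v₅ = 1 := by
    rw [hv₅, map_smul]
    change γ⁻¹ • b (y T) = 1
    rw [hyT, smul_eq_mul, inv_mul_cancel₀ hγ]
  have hβs : Function.Surjective β := fun r => ⟨r • v₅, by rw [map_smul, hβ5]; simp⟩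
  have hfr : Module.finrank ℝ (LinearMap.ker β) = 4 := by
    have h1 := LinearMap.finrank_range_add_finrank_ker β
    rw [LinearMap.range_eq_top.2 hβs, finrank_top, Module.finrank_self,
      finrank_euclideanSpace_fin] at h1
    omega
  set B := Module.finBasisOfFinrankEq ℝ (LinearMap.ker β) hfr
  have hBli : LinearIndependent ℝ (fun i => (B i : V)) :=
    B.linearIndependent.map' (LinearMap.ker β).subtype (Submodule.ker_subtype _)
  set w : Fin 5 → V := Fin.snoc (fun i => (B i : V)) v₅ with hw
  have hwli : LinearIndependent ℝ w := by
    refine linearIndependent_finSnoc.2 ⟨hBli, fun hmem => ?_⟩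
    have hle : Submodule.span ℝ (range fun i => (B i : V)) ≤ LinearMap.ker β :=
      Submodule.span_le.2 (by rintro _ ⟨i, rfl⟩; exact (B i).2)
    have h1 : β v₅ = 0 := hle hmem
    rw [hβ5] at h1
    exact one_ne_zero h1
  have hw4 : w 4 = v₅ := Fin.snoc_last (α := fun _ => V) v₅ _
  obtain ⟨p, hp, -⟩ := H.exists_solves G 0 T
  obtain ⟨bp, hbp⟩ := hp.exists_tendsto_last H
  -- An arbitrary particular solution `p` becomes regular once its singular part, a multiple of the
  -- singular homogeneous solution, is subtracted.
  refine ⟨fun i => X (w i), fun t => p t + (-bp) • X v₅ t, fun i => hX _,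
    by simpa using hp.add_smul (hX v₅) (-bp), by simpa [hXT] using hwli, ?_, ?_, ?_⟩
  · intro i hi
    refine (hX _).exists_tendsto H ?_
    induction i using Fin.lastCases with
    | last => exact absurd rfl hi
    | cast i =>
      have h1 : b (w i.castSucc) = 0 := by
        rw [hw, Fin.snoc_castSucc]
        exact (B i).2
      have h2 := hb (w i.castSucc)
      rwa [h1] at h2
  · refine Solves.exists_tendsto H (G := G + -bp * 0) (hp.add_smul (hX v₅) (-bp)) ?_
    have h1 := hbp.add ((hb v₅).const_mul (-bp))
    rw [show b v₅ = 1 from hβ5, mul_one, add_neg_cancel] at h1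
    refine h1.congr fun t => ?_
    simp only [PiLp.add_apply, PiLp.smul_apply, smul_eq_mul]
    ring
  · simp only [hw4]
    refine tendsto_euclidean fun i => ?_
    induction i using Fin.lastCases with
    | last =>
      have h1 := hb v₅
      rw [show b v₅ = 1 from hβ5] at h1
      simpa using h1
    | cast i =>
      have : i.castSucc ≠ (4 : Fin 5) := (Fin.castSucc_lt_last i).ne
      simpa [this] using (hX v₅).tendsto_castSucc H i

end Fundamental

/-! ### Integrable functions and smooth test functions -/

theorem integrable_coord (f : Lp V 1 (volume : Measure ℝ)) (i : Fin 5) :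
    Integrable fun p => f p i :=
  (EuclideanSpace.proj i : V →L[ℝ] ℝ).integrable_comp (L1.integrable_coeFn f)

theorem Integrable.mul_bounded_continuous {f ψ : ℝ → ℝ} {M : ℝ} (hf : Integrable f)
    (hψ : Continuous ψ) (hM : ∀ p, |ψ p| ≤ M) : Integrable fun p => f p * ψ p :=
  hf.mul_bdd (c := M) hψ.aestronglyMeasurable (Eventually.of_forall hM)

theorem abs_integral_mul_le {f ψ : ℝ → ℝ} {M : ℝ} (hf : Integrable f)
    (hM : ∀ p, |ψ p| ≤ M) : |∫ p, f p * ψ p| ≤ M * ∫ p, |f p| := by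
  rw [← integral_const_mul, ← Real.norm_eq_abs]
  refine norm_integral_le_of_norm_le (hf.abs.const_mul M) (Eventually.of_forall fun p => ?_)
  rw [Real.norm_eq_abs, abs_mul, mul_comm]
  exact mul_le_mul_of_nonneg_right (hM p) (abs_nonneg _)

theorem integral_abs_coord_sub_le (f g : Lp V 1 (volume : Measure ℝ)) (i : Fin 5) :
    ∫ p, |f p i - g p i| ≤ ‖f - g‖ := by
  rw [L1.norm_eq_integral_norm]
  refine integral_mono_ae ((integrable_coord f i).sub (integrable_coord g i)).abs
    (L1.integrable_coeFn (f - g)).norm ?_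
  filter_upwards [Lp.coeFn_sub f g] with p hp
  rw [hp]
  exact PiLp.norm_apply_le (f p - g p) i

theorem continuousOn_integral_abs_coord {u : ℝ → Lp V 1 (volume : Measure ℝ)} {s : Set ℝ}
    (hu : ContinuousOn u s) (i : Fin 5) : ContinuousOn (fun t => ∫ p, |u t p i|) s := by
  intro t ht
  rw [ContinuousWithinAt, tendsto_iff_dist_tendsto_zero]
  have h1 : Tendsto (fun r => ‖u r - u t‖) (𝓝[s] t) (𝓝 0) :=
    (tendsto_iff_norm_sub_tendsto_zero.1 (hu t ht))
  refine squeeze_zero (fun _ => dist_nonneg) (fun r => ?_) h1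
  refine le_trans ?_ (integral_abs_coord_sub_le (u r) (u t) i)
  rw [Real.dist_eq, ← integral_sub (integrable_coord _ i).abs (integrable_coord _ i).abs,
    ← Real.norm_eq_abs]
  refine norm_integral_le_of_norm_le ((integrable_coord _ i).sub (integrable_coord _ i)).abs
    (Eventually.of_forall fun p => ?_)
  exact abs_abs_sub_abs_le_abs_sub _ _

/-- The `L¹` norm is attained on smooth compactly supported test functions. -/
theorem integral_abs_le_of_forall_test {f : ℝ → ℝ} {B : ℝ} (hf : Integrable f)
    (h : ∀ ψ : ℝ → ℝ, ContDiff ℝ ∞ ψ → HasCompactSupport ψ → (∀ p, |ψ p| ≤ 1) →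
      |∫ p, f p * ψ p| ≤ B) : ∫ p, |f p| ≤ B := by
  refine le_of_forall_pos_le_add fun ε hε => ?_
  obtain ⟨g, hgs, hgc, hg⟩ := (memLp_one_iff_integrable.2 hf).exist_eLpNorm_sub_le
    ENNReal.one_ne_top le_rfl (show 0 < ε / 4 by positivity)
  have hgi : Integrable g := hgc.continuous.integrable_of_hasCompactSupport hgs
  have hfg : ∫ p, |f p - g p| ≤ ε / 4 := by
    have h1 := (hf.sub hgi)
    rw [eLpNorm_one_eq_lintegral_enorm, ← ofReal_integral_norm_eq_lintegral_enorm h1] at hg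
    exact (ENNReal.ofReal_le_ofReal_iff (by positivity)).1 hg
  set m := volume.real (tsupport g) with hm
  have hm0 : 0 ≤ m := measureReal_nonneg
  -- The test function `g / √(g² + η²)` is a smooth sign of `g`, with `g ψ ≥ |g| - η`. The loss `η`
  -- occurs only on the support of `g`, of measure `m`, hence totals at most `ε / 2`; `m + 1` avoids
  -- dividing by zero.
  set η := ε / (2 * (m + 1)) with hη
  have hη0 : 0 < η := by positivity
  have hηm : η * m ≤ ε / 2 := by
    rw [hη, div_mul_eq_mul_div, div_le_div_iff₀ (by positivity) (by norm_num)]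
    nlinarith
  set ψ : ℝ → ℝ := fun p => g p / √(g p ^ 2 + η ^ 2) with hψ
  have hpos : ∀ p, 0 < g p ^ 2 + η ^ 2 := fun p => by positivity
  have hψc : ContDiff ℝ ∞ ψ :=
    hgc.div (((hgc.pow 2).add contDiff_const).sqrt fun p => (hpos p).ne')
      fun p => (Real.sqrt_pos.2 (hpos p)).ne'
  have hψs : HasCompactSupport ψ := hgs.mono fun p hp => by
    contrapose! hp
    simp only [Function.mem_support, not_not] at hp ⊢
    simp [hψ, hp]
  have hroot : ∀ p, |g p| ≤ √(g p ^ 2 + η ^ 2) := fun p => by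
    rw [← Real.sqrt_sq_eq_abs]
    exact Real.sqrt_le_sqrt (by nlinarith [sq_nonneg η])
  have hroot' : ∀ p, √(g p ^ 2 + η ^ 2) ≤ |g p| + η := fun p => by
    refine Real.sqrt_le_iff.2 ⟨by positivity, ?_⟩
    nlinarith [sq_abs (g p), mul_nonneg (abs_nonneg (g p)) hη0.le]
  have hψ1 : ∀ p, |ψ p| ≤ 1 := fun p => by
    rw [hψ, abs_div, abs_of_pos (Real.sqrt_pos.2 (hpos p))]
    exact div_le_one_of_le₀ (hroot p) (Real.sqrt_nonneg _)
  have hind : Integrable ((tsupport g).indicator fun _ => η) :=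
    (integrable_indicator_iff (isClosed_tsupport g).measurableSet).2
      (integrableOn_const (hgs.measure_lt_top.ne))
  have hgψ : Integrable fun p => g p * ψ p :=
    Integrable.mul_bounded_continuous hgi hψc.continuous hψ1
  have hfψ : Integrable fun p => f p * ψ p :=
    Integrable.mul_bounded_continuous hf hψc.continuous hψ1
  have h1 : ∫ p, |g p| ≤ ∫ p, (g p * ψ p + (tsupport g).indicator (fun _ => η) p) := by
    refine integral_mono hgi.abs (hgψ.add hind) fun p => ?_
    by_cases hp : p ∈ tsupport g
    · simp only [indicator_of_mem hp]
      have hq := Real.sqrt_pos.2 (hpos p)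
      have e : g p * ψ p = |g p| ^ 2 / √(g p ^ 2 + η ^ 2) := by
        rw [hψ, sq_abs]
        ring
      rw [e, ← sub_le_iff_le_add, le_div_iff₀ hq]
      nlinarith [hroot p, hroot' p, abs_nonneg (g p)]
    · simp [image_eq_zero_of_notMem_tsupport hp, indicator_of_notMem hp]
  rw [integral_add hgψ hind, integral_indicator (isClosed_tsupport g).measurableSet,
    setIntegral_const, smul_eq_mul, ← hm, mul_comm m] at h1
  have h2 : ∫ p, g p * ψ p ≤ (∫ p, f p * ψ p) + ε / 4 := by
    have h3 := abs_integral_mul_le (hf.sub hgi) hψ1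
    have h4 : ∫ p, (f - g) p * ψ p = (∫ p, f p * ψ p) - ∫ p, g p * ψ p := by
      rw [← integral_sub hfψ hgψ]
      exact integral_congr_ae (Eventually.of_forall fun p => by simp [sub_mul])
    rw [h4, one_mul] at h3
    have h5 := neg_abs_le ((∫ p, f p * ψ p) - ∫ p, g p * ψ p)
    simp only [Pi.sub_apply] at h3
    linarith
  have h3 : ∫ p, |f p| ≤ (∫ p, |f p - g p|) + ∫ p, |g p| := by
    have hfgi : Integrable fun p => |f p - g p| := (hf.sub hgi).abs
    rw [← integral_add hfgi hgi.abs]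
    refine integral_mono hf.abs (hfgi.add hgi.abs) fun p => ?_
    have := abs_add_le (f p - g p) (g p)
    simpa using this
  have h4 := (le_abs_self _).trans (h ψ hψc hψs hψ1)
  linarith

theorem hasDerivAt_integral_mul_translate {f ψ : ℝ → ℝ} (hf : Integrable f)
    (hψ : ContDiff ℝ ∞ ψ) (hs : HasCompactSupport ψ) (b : ℝ) :
    HasDerivAt (fun b => ∫ p, f p * ψ (p - b)) (-∫ p, f p * deriv ψ (p - b)) b := by
  obtain ⟨M, hM⟩ := hs.exists_bound_of_continuous hψ.continuous
  have hd : Continuous (deriv ψ) := hψ.continuous_deriv (by simp)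
  obtain ⟨M', hM'⟩ := hs.deriv.exists_bound_of_continuous hd
  have hc : ∀ b, Continuous fun p => ψ (p - b) := fun b => hψ.continuous.comp (by fun_prop)
  have h1 := hasDerivAt_integral_of_dominated_loc_of_deriv_le (μ := volume) (s := univ)
    (F := fun b p => f p * ψ (p - b)) (F' := fun b p => f p * -deriv ψ (p - b))
    (x₀ := b) (bound := fun p => |f p| * M') univ_mem
    (Eventually.of_forall fun b =>
      hf.aestronglyMeasurable.mul (hc b).aestronglyMeasurable)
    (Integrable.mul_bounded_continuous hf (hc b) fun p => hM _)
    (hf.aestronglyMeasurable.mul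
      (hd.comp (continuous_id.sub continuous_const)).neg.aestronglyMeasurable)
    (Eventually.of_forall fun p b _ => by
      rw [norm_mul, norm_neg]
      exact mul_le_mul_of_nonneg_left (hM' _) (norm_nonneg _))
    (hf.abs.mul_const M')
    (Eventually.of_forall fun p b _ => by
      have h2 := ((hψ.differentiable (by simp) (p - b)).hasDerivAt.comp b
        ((hasDerivAt_id b).const_sub p))
      simpa using h2.const_mul (f p))
  refine h1.2.congr_deriv ?_
  rw [← integral_neg]
  exact integral_congr_ae (Eventually.of_forall fun p => by simp)

theorem abs_test_translate_sub_le {ψ : ℝ → ℝ} {M' : ℝ} (hψ : ContDiff ℝ ∞ ψ)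
    (hM' : ∀ p, ‖deriv ψ p‖ ≤ M') (p b b' : ℝ) : |ψ (p - b) - ψ (p - b')| ≤ M' * |b - b'| := by
  have h1 := Convex.norm_image_sub_le_of_norm_deriv_le (f := ψ) (s := univ)
    (fun x _ => hψ.differentiable (by simp) x) (fun x _ => hM' x) convex_univ
    (mem_univ (p - b')) (mem_univ (p - b))
  rw [show p - b - (p - b') = -(b - b') by ring, norm_neg] at h1
  exact h1

/-- Test functions transported along a characteristic. -/
theorem hasDerivWithinAt_integral_mul_translate {u : ℝ → Lp V 1 (volume : Measure ℝ)}
    {s : Set ℝ} {i : Fin 5} {a : ℝ → ℝ} {a' D t : ℝ} {ψ : ℝ → ℝ} (hψ : ContDiff ℝ ∞ ψ)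
    (hs : HasCompactSupport ψ) (hu : ContinuousWithinAt u s t)
    (ha : HasDerivWithinAt a a' s t)
    (hD : HasDerivWithinAt (fun r => ∫ p, u r p i * ψ (p - a t)) D s t) :
    HasDerivWithinAt (fun r => ∫ p, u r p i * ψ (p - a r))
      (D - a' * ∫ p, u t p i * deriv ψ (p - a t)) s t := by
  obtain ⟨M, hM⟩ := hs.exists_bound_of_continuous hψ.continuous
  have hd : Continuous (deriv ψ) := hψ.continuous_deriv (by simp)
  obtain ⟨M', hM'⟩ := hs.deriv.exists_bound_of_continuous hd
  have hc : ∀ b, Continuous fun p => ψ (p - b) := fun b => hψ.continuous.comp (by fun_prop)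
  have hinteg : ∀ r b, Integrable fun p => u r p i * ψ (p - b) := fun r b =>
    Integrable.mul_bounded_continuous (integrable_coord _ i) (hc b) fun p => hM _
  have h1 : HasDerivWithinAt (fun r => ∫ p, u t p i * ψ (p - a r))
      (-(∫ p, u t p i * deriv ψ (p - a t)) * a') s t :=
    (hasDerivAt_integral_mul_translate (integrable_coord (u t) i) hψ hs (a t)).comp_hasDerivWithinAt
      t ha
  -- The mixed increment has zero derivative: continuity of `u` in `L¹` makes one factor `o(1)`,
  -- while the Lipschitz bound on `ψ` makes the other `O(r - t)`. No strong differentiability of `u`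
  -- in time is needed.
  have h2 : HasDerivWithinAt
      (fun r => ∫ p, (u r p i - u t p i) * (ψ (p - a r) - ψ (p - a t))) 0 s t := by
    rw [hasDerivWithinAt_iff_isLittleO]
    simp only [sub_self, smul_zero, sub_zero, zero_mul, integral_zero]
    have ho : (fun r => ‖u r - u t‖) =o[𝓝[s] t] (fun _ => (1 : ℝ)) :=
      (Asymptotics.isLittleO_one_iff ℝ).2 (tendsto_iff_norm_sub_tendsto_zero.1 hu)
    have hO : (fun r => M' * |a r - a t|) =O[𝓝[s] t] fun r => r - t :=
      (ha.hasFDerivWithinAt.isBigO_sub.norm_left).const_mul_left M'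
    have hprod := ho.mul_isBigO hO
    simp only [one_mul] at hprod
    refine (Asymptotics.isBigO_of_le _ fun r => ?_).trans_isLittleO hprod
    have h3 := abs_integral_mul_le ((integrable_coord (u r) i).sub (integrable_coord (u t) i))
      (fun p => abs_test_translate_sub_le hψ hM' p (a r) (a t))
    have hM'0 : 0 ≤ M' := (norm_nonneg _).trans (hM' 0)
    have hnn : 0 ≤ M' * |a r - a t| := by positivity
    rw [norm_mul, norm_norm, Real.norm_of_nonneg hnn, mul_comm]
    exact h3.trans (mul_le_mul_of_nonneg_left (integral_abs_coord_sub_le _ _ i) hnn)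
  have h4 := (hD.add h1).add h2
  have heq : ∀ r, ∫ p, u r p i * ψ (p - a r)
      = ((∫ p, u r p i * ψ (p - a t)) + (∫ p, u t p i * ψ (p - a r))
        + ∫ p, (u r p i - u t p i) * (ψ (p - a r) - ψ (p - a t)))
        - ∫ p, u t p i * ψ (p - a t) := by
    intro r
    have e : (fun p => (u r p i - u t p i) * (ψ (p - a r) - ψ (p - a t)))
        = fun p => (u r p i * ψ (p - a r) - u r p i * ψ (p - a t))
          - (u t p i * ψ (p - a r) - u t p i * ψ (p - a t)) := by
      ext p
      ring
    have hinteg' : ∀ r' b b', Integrable fun p => u r' p i * ψ (p - b) - u r' p i * ψ (p - b') :=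
      fun r' b b' => (hinteg r' b).sub (hinteg r' b')
    rw [e, integral_sub (hinteg' _ _ _) (hinteg' _ _ _),
      integral_sub (hinteg _ _) (hinteg _ _), integral_sub (hinteg _ _) (hinteg _ _)]
    ring
  exact ((h4.congr_deriv (by ring)).sub_const (∫ p, u t p i * ψ (p - a t))).congr
    (fun r _ => heq r) (heq t)

/-! ### Weak solutions: growth of the `L¹` norm and blow-up of localised averages -/

/-- Weak solutions of `t ∂u/∂t + α(t) ∂u/∂p + C(t) u = h(t) g(p)` on `(0,T]` with a diagonal
transport matrix `α`. -/
structure IsWeakSolution (C : ℝ → Matrix (Fin 5) (Fin 5) ℝ) (h : ℝ → Fin 5 → ℝ)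
    (α : Fin 5 → ℝ → ℝ) (T : ℝ) (g : ℝ → ℝ) (u : ℝ → Lp V 1 (volume : Measure ℝ)) : Prop where
  continuousOn : ContinuousOn u (Ioc 0 T)
  weak : ∀ (i : Fin 5) (ψ : ℝ → ℝ), ContDiff ℝ ∞ ψ → HasCompactSupport ψ → ∀ t ∈ Ioc 0 T,
    HasDerivWithinAt (fun s => ∫ p, u s p i * ψ p)
      (t⁻¹ * (α i t * (∫ p, u t p i * deriv ψ p) - (∑ j, C t i j * ∫ p, u t p j * ψ p)
        + h t i * ∫ p, g p * ψ p)) (Ioc 0 T) t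

section Weak

variable {C : ℝ → Matrix (Fin 5) (Fin 5) ℝ} {h : ℝ → Fin 5 → ℝ} {c T K : ℝ}
  {α : Fin 5 → ℝ → ℝ} {g : ℝ → ℝ} {u : ℝ → Lp V 1 (volume : Measure ℝ)}

/-- The characteristic curves are primitives of `α` in the variable `log t`. They may run off to
infinity as `t → 0`, which is harmless since only bounds uniform under translation are used. -/
theorem exists_hasDerivWithinAt_inv_mul {α : ℝ → ℝ} (hT : 0 < T) (hα : ContinuousOn α (Ioc 0 T)) :
    ∃ a : ℝ → ℝ, ∀ t ∈ Ioc 0 T, HasDerivWithinAt a (t⁻¹ * α t) (Ioc 0 T) t := by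
  set θ : ℝ → ℝ := fun τ => min (Real.exp τ) T with hθ
  have hc : Continuous (α ∘ θ) := hα.comp_continuous (Real.continuous_exp.min continuous_const)
    fun τ => ⟨lt_min (Real.exp_pos τ) hT, min_le_right _ _⟩
  refine ⟨fun t => ∫ τ in (0 : ℝ)..Real.log t, (α ∘ θ) τ, fun t ht => ?_⟩
  have h1 := ((hc.integral_hasStrictDerivAt 0 (Real.log t)).hasDerivAt.comp t
    (Real.hasDerivAt_log ht.1.ne')).hasDerivWithinAt (s := Ioc 0 T)
  have h3 : θ (Real.log t) = t := by
    simp only [hθ, Real.exp_log ht.1]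
    exact min_eq_left ht.2
  refine h1.congr_deriv ?_
  rw [Function.comp_apply, h3, mul_comm]

/-- The weak equation along a characteristic of the `i`-th component. -/
theorem IsWeakSolution.hasDerivWithinAt_translate (hu : IsWeakSolution C h α T g u) (i : Fin 5)
    {a : ℝ → ℝ} (ha : ∀ t ∈ Ioc 0 T, HasDerivWithinAt a (t⁻¹ * α i t) (Ioc 0 T) t)
    {ψ : ℝ → ℝ} (hψ : ContDiff ℝ ∞ ψ) (hs : HasCompactSupport ψ) {t : ℝ} (ht : t ∈ Ioc 0 T) :
    HasDerivWithinAt (fun s => ∫ p, u s p i * ψ (p - a s))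
      (t⁻¹ * (-(∑ j, C t i j * ∫ p, u t p j * ψ (p - a t)) + h t i * ∫ p, g p * ψ (p - a t)))
      (Ioc 0 T) t := by
  have hψ' : ContDiff ℝ ∞ fun p => ψ (p - a t) := hψ.comp (contDiff_id.sub contDiff_const)
  have hs' : HasCompactSupport fun p => ψ (p - a t) :=
    hs.comp_homeomorph (Homeomorph.subRight (a t))
  have hd : deriv (fun p => ψ (p - a t)) = fun p => deriv ψ (p - a t) := by
    ext p
    exact deriv_comp_sub_const ψ (a t) p
  have h1 := hu.weak i _ hψ' hs' t ht
  rw [hd] at h1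
  have h2 := hasDerivWithinAt_integral_mul_translate hψ hs (hu.continuousOn t ht) (ha t ht) h1
  exact h2.congr_deriv (by ring)

theorem IsWeakSolution.test_bounds (H : RegularSingular C h c T K) (hg : Integrable g)
    {a : ℝ → ℝ} {ψ : ℝ → ℝ} (hψ1 : ∀ p, |ψ p| ≤ 1) (i : Fin 5) {t : ℝ} (ht : t ∈ Ioc 0 T) :
    |h t i * ∫ p, g p * ψ (p - a t)| ≤ K * (1 + T) * ∫ p, |g p| := by
  rw [abs_mul]
  have h1 := abs_integral_mul_le (ψ := fun p => ψ (p - a t)) hg (fun p => hψ1 _)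
  rw [one_mul] at h1
  exact mul_le_mul (H.abs_h_le i ht) h1 (abs_nonneg _)
    (mul_nonneg H.K_nonneg (by linarith [H.T_pos]))

/-- The `L¹` norm of a weak solution grows at most like `t ^ (-c)`. -/
theorem IsWeakSolution.exists_integral_abs_le (hu : IsWeakSolution C h α T g u)
    (H : RegularSingular C h c T K) (hα : ∀ i, ContinuousOn (α i) (Ioc 0 T)) (hg : Integrable g) :
    ∃ B, 0 ≤ B ∧ ∀ i, ∀ t ∈ Ioc 0 T, ∫ p, |u t p i| ≤ B * t ^ (-c) := by
  have hT := H.T_pos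
  have hK := H.K_nonneg
  have hc := H.one_lt
  set U : Fin 5 → ℝ → ℝ := fun i t => ∫ p, |u t p i| with hU
  have hUc : ∀ i, ContinuousOn (U i) (Ioc 0 T) := continuousOn_integral_abs_coord hu.continuousOn
  have hU0 : ∀ i t, 0 ≤ U i t := fun i t => integral_nonneg fun p => abs_nonneg _
  set E := K * (1 + T) * ∫ p, |g p| with hE
  have hE0 : 0 ≤ E := mul_nonneg (by positivity) (integral_nonneg fun p => abs_nonneg _)
  have hle : ∀ (ψ : ℝ → ℝ), (∀ p, |ψ p| ≤ 1) → ∀ (b : ℝ) (j : Fin 5) (t : ℝ),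
      |∫ p, u t p j * ψ (p - b)| ≤ U j t := fun ψ hψ b j t => by
    have := abs_integral_mul_le (ψ := fun p => ψ (p - b)) (integrable_coord (u t) j) fun p => hψ _
    rwa [one_mul] at this
  have key : ∀ i, ∃ a : ℝ → ℝ, ∀ t ∈ Ioc 0 T, HasDerivWithinAt a (t⁻¹ * α i t) (Ioc 0 T) t :=
    fun i => exists_hasDerivWithinAt_inv_mul hT (hα i)
  choose a ha using key
  have htrans : ∀ (ψ : ℝ → ℝ) (b : ℝ), ContDiff ℝ ∞ ψ → HasCompactSupport ψ →
      ContDiff ℝ ∞ (fun p => ψ (p + b)) ∧ HasCompactSupport (fun p => ψ (p + b)) :=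
    fun ψ b hψ hs => ⟨hψ.comp (contDiff_id.add contDiff_const),
      hs.comp_homeomorph (Homeomorph.addRight b)⟩
  have hbound : ∀ t ∈ Ioc 0 T, weightedSize c U t
      ≤ (weightedSize c U T + (4 + √T) * ∫ s in t..T, s ^ (c - 3 / 2) * E)
        * Real.exp (2 * (4 * K * (1 + √T)) * √T) := by
    intro t ht
    -- Each component is tested along its own characteristic, which removes the transport term. The
    -- supremum over test functions then gives the integral inequalities for the `L¹` norms.
    refine weightedSize_le (E := fun _ => E) hc hK hUc continuousOn_const (fun j t _ => hU0 j t)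
      (fun _ _ => hE0) ht.1 ht.2 le_rfl ?_ ?_
    · intro i r hr
      have hr0 := ht.1.trans_le hr.1
      refine integral_abs_le_of_forall_test (integrable_coord _ _) fun ψ hψ hs hψ1 => ?_
      -- The shift by `a(r)` makes the transported test function equal to `ψ` at time `r`.
      obtain ⟨hψ', hs'⟩ := htrans ψ (a i.castSucc r) hψ hs
      have h1 := H.abs_castSucc_le i
        (f := fun s => ∫ p, u s p i.castSucc * ψ (p - a i.castSucc s + a i.castSucc r))
        (fun t ht => hu.hasDerivWithinAt_translate i.castSucc (ha _) hψ' hs' ht)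
        hUc continuousOn_const
        (fun j t _ => hle (fun p => ψ (p + a i.castSucc r)) (fun p => hψ1 _) _ j t)
        (fun t ht => IsWeakSolution.test_bounds H hg (ψ := fun p => ψ (p + a i.castSucc r))
          (fun p => hψ1 _) _ ht) hr0 hr.2 le_rfl
      simp only [sub_add_cancel] at h1
      exact h1.trans (add_le_add
        (hle (fun p => ψ (p + a i.castSucc r)) (fun p => hψ1 _) _ _ _) le_rfl)
    · intro r hr
      have hr0 := ht.1.trans_le hr.1
      have hp := Real.rpow_pos_of_pos hr0 c
      rw [mul_comm, ← le_div_iff₀ hp]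
      refine integral_abs_le_of_forall_test (integrable_coord _ _) fun ψ hψ hs hψ1 => ?_
      obtain ⟨hψ', hs'⟩ := htrans ψ (a 4 r) hψ hs
      have h1 := H.rpow_mul_abs_last_le
        (y := fun j s => ∫ p, u s p j * ψ (p - a 4 s + a 4 r))
        (fun t ht => hu.hasDerivWithinAt_translate 4 (ha _) hψ' hs' ht)
        hUc continuousOn_const
        (fun j t _ => hle (fun p => ψ (p + a 4 r)) (fun p => hψ1 _) _ j t)
        (fun t ht => IsWeakSolution.test_bounds H hg (ψ := fun p => ψ (p + a 4 r))
          (fun p => hψ1 _) _ ht) hr0 hr.2 le_rfl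
      simp only [sub_add_cancel] at h1
      rw [le_div_iff₀ hp, mul_comm]
      exact h1.trans (add_le_add (mul_le_mul_of_nonneg_left
        (hle (fun p => ψ (p + a 4 r)) (fun p => hψ1 _) _ _ _) (Real.rpow_nonneg hT.le _)) le_rfl)
  have hZ0 : 0 ≤ weightedSize c U T := weightedSize_nonneg hT fun j => hU0 j T
  have hc' : 0 < c - 1 / 2 := by linarith
  set B := (weightedSize c U T + (4 + √T) * (T ^ (c - 1 / 2) / (c - 1 / 2) * E))
      * Real.exp (2 * (4 * K * (1 + √T)) * √T) with hB
  have hB0 : 0 ≤ B := by positivity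
  have hZB : ∀ t ∈ Ioc 0 T, weightedSize c U t ≤ B := by
    intro t ht
    refine (hbound t ht).trans (mul_le_mul_of_nonneg_right (add_le_add le_rfl
      (mul_le_mul_of_nonneg_left ?_ (by positivity))) (Real.exp_pos _).le)
    rw [intervalIntegral.integral_mul_const, integral_rpow (Or.inl (by linarith)),
      show c - 3 / 2 + 1 = c - 1 / 2 by ring]
    refine mul_le_mul_of_nonneg_right ?_ hE0
    exact div_le_div_of_nonneg_right (sub_le_self _ (Real.rpow_nonneg ht.1.le _)) hc'.le
  refine ⟨B * (1 + √T), by positivity, fun i t ht => ?_⟩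
  change U i t ≤ _
  rw [Real.rpow_neg ht.1.le, ← div_eq_mul_inv, le_div_iff₀ (Real.rpow_pos_of_pos ht.1 c), mul_comm]
  exact (rpow_mul_le_weightedSize ht U (fun j => hU0 j t) i).trans <| by
    rw [mul_comm]
    exact mul_le_mul_of_nonneg_right (hZB t ht) (by positivity)

end Weak

theorem exists_smooth_cutoff : ∃ η : ℝ → ℝ, ContDiff ℝ ∞ η ∧ HasCompactSupport η ∧
    (∀ p, |η p| ≤ 1) ∧ (∀ p, |p| ≤ 1 → η p = 1) ∧ ∀ p, 2 ≤ |p| → η p = 0 := by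
  let b : ContDiffBump (0 : ℝ) := ⟨1, 2, one_pos, one_lt_two⟩
  refine ⟨b, b.contDiff, b.hasCompactSupport, fun p => ?_, fun p hp => ?_, fun p hp => ?_⟩
  · rw [abs_of_nonneg b.nonneg]
    exact b.le_one
  · exact b.one_of_mem_closedBall (by simpa [b] using hp)
  · exact b.zero_of_le_dist (by simpa [b] using hp)

/-! ### Localised averages and divergence of the norms -/

section Blowup

variable {C : ℝ → Matrix (Fin 5) (Fin 5) ℝ} {h : ℝ → Fin 5 → ℝ} {c T K : ℝ}
  {α : Fin 5 → ℝ → ℝ} {g : ℝ → ℝ} {u : ℝ → Lp V 1 (volume : Measure ℝ)} {η : ℝ → ℝ}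

/-- A localised average differs from the solution of the averaged equation by little, since the
transport term is proportional to the inverse length scale `s`. -/
theorem IsWeakSolution.rpow_mul_abs_average_sub_le (hu : IsWeakSolution C h α T g u)
    (H : RegularSingular C h c T K) {K' L B : ℝ} (hαb : ∀ i, ∀ t ∈ Ioc 0 T, |α i t| ≤ K')
    (hB0 : 0 ≤ B) (hB : ∀ i, ∀ t ∈ Ioc 0 T, ∫ p, |u t p i| ≤ B * t ^ (-c))
    (hη : ContDiff ℝ ∞ η) (hηs : HasCompactSupport η) (hL : ∀ p, |deriv η p| ≤ L)
    {x : ℝ → V} (hx : Solves C h T (∫ p, g p) x) {s : ℝ} (hs : 0 < s)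
    (hgs : ∀ p, g p * η (s * p) = g p) {t : ℝ} (ht : t ∈ Ioc 0 T) :
    t ^ c * |(∫ p, u t p 4 * η (s * p)) - x t 4|
      ≤ (weightedSize c (fun j r => |(∫ p, u r p j * η (s * p)) - x r j|) T
          + (4 + √T) * (K' * (s * L * B) * (2 / √t)))
        * Real.exp (2 * (4 * K * (1 + √T)) * √T) := by
  have hT := H.T_pos
  have hK' : 0 ≤ K' := (abs_nonneg _).trans (hαb 0 T ⟨hT, le_rfl⟩)
  have hL0 : 0 ≤ L := (abs_nonneg _).trans (hL 0)
  set κ := K' * (s * L * B) with hκ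
  have hκ0 : 0 ≤ κ := by positivity
  have hψ : ContDiff ℝ ∞ fun p => η (s * p) := hη.comp (contDiff_const.mul contDiff_id)
  have hψs : HasCompactSupport fun p => η (s * p) :=
    hηs.comp_homeomorph (Homeomorph.mulLeft₀ s hs.ne')
  have hψd : ∀ p, |deriv (fun p => η (s * p)) p| ≤ s * L := fun p => by
    rw [deriv_comp_mul_left, smul_eq_mul, abs_mul, abs_of_pos hs]
    exact mul_le_mul_of_nonneg_left (hL _) hs.le
  set y : Fin 5 → ℝ → ℝ := fun j r => (∫ p, u r p j * η (s * p)) - x r j with hy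
  set F : Fin 5 → ℝ → ℝ := fun i r =>
    α i r * ∫ p, u r p i * deriv (fun p => η (s * p)) p with hF
  -- The cutoff does not affect `g`, so the sources cancel in the difference and only the transport
  -- term `F` is left as forcing.
  have hder : ∀ i, ∀ r ∈ Ioc 0 T, HasDerivWithinAt (y i)
      (r⁻¹ * (-(∑ j, C r i j * y j r) + F i r)) (Ioc 0 T) r := by
    intro i r hr
    have h1 := (hu.weak i _ hψ hψs r hr).sub (hx i r hr)
    refine h1.congr_deriv ?_
    simp only [hgs, hy, hF, mul_sub, Finset.sum_sub_distrib]
    ring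
  have hFb : ∀ i, ∀ r ∈ Ioc 0 T, |F i r| ≤ κ * r ^ (-c) := by
    intro i r hr
    have h1 := abs_integral_mul_le (integrable_coord (u r) i) hψd
    have h2 := mul_le_mul_of_nonneg_left (hB i r hr) (mul_nonneg hs.le hL0)
    simp only [hF]
    rw [abs_mul]
    calc _ ≤ K' * (s * L * (B * r ^ (-c))) :=
          mul_le_mul (hαb i r hr) (h1.trans h2) (abs_nonneg _) hK'
      _ = _ := by rw [hκ]; ring
  have h1 := H.weightedSize_le_of_forced hder
    (continuousOn_const.mul (continuousOn_rpow_Ioc (-c) T)) hFb ht.1 ht.2 le_rfl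
  -- The `L¹` growth `r ^ (-c)` against the weight leaves `r ^ (-3/2)`, whence the factor `2 / √t`.
  have h2 : ∫ r in t..T, r ^ (c - 3 / 2) * (κ * r ^ (-c)) ≤ κ * (2 / √t) := by
    have e : ∫ r in t..T, r ^ (c - 3 / 2) * (κ * r ^ (-c)) = ∫ r in t..T, κ * r ^ (-(3 / 2) : ℝ) := by
      refine intervalIntegral.integral_congr fun r hr => ?_
      rw [uIcc_of_le ht.2] at hr
      have hr0 := ht.1.trans_le hr.1
      rw [mul_left_comm, ← Real.rpow_add hr0]
      congr 2
      ring
    rw [e, intervalIntegral.integral_const_mul, integral_rpow (Or.inr ⟨by norm_num, by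
      rw [uIcc_of_le ht.2]
      exact fun h0 => absurd h0.1 (not_le.2 ht.1)⟩)]
    refine mul_le_mul_of_nonneg_left ?_ hκ0
    have e2 : ∀ r : ℝ, 0 < r → r ^ (-(3 / 2) + 1 : ℝ) = 1 / √r := fun r hr => by
      rw [show (-(3 / 2) + 1 : ℝ) = -(1 / 2) by norm_num, Real.rpow_neg hr.le,
        ← Real.sqrt_eq_rpow, one_div]
    rw [e2 t ht.1, e2 T hT]
    have : 0 ≤ 1 / √T := by positivity
    have e3 : (1 / √T - 1 / √t) / (-(3 / 2) + 1 : ℝ) = 2 / √t - 2 * (1 / √T) := by ring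
    rw [e3]
    linarith
  have h3 : t ^ c * |y 4 t| ≤ weightedSize c (fun j r => |y j r|) t :=
    le_add_of_nonneg_right (mul_nonneg (Real.rpow_nonneg ht.1.le _)
      (Finset.sum_nonneg fun j _ => abs_nonneg _))
  refine (h3.trans h1).trans (mul_le_mul_of_nonneg_right (add_le_add le_rfl
    (mul_le_mul_of_nonneg_left ?_ (by positivity))) (Real.exp_pos _).le)
  exact h2

theorem tendsto_integral_mul_cutoff {f : ℝ → ℝ} (hf : Integrable f) (hη : Continuous η)
    (hη1 : ∀ p, |η p| ≤ 1) (hη0 : η 0 = 1) :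
    Tendsto (fun s => ∫ p, f p * η (s * p)) (𝓝[>] 0) (𝓝 (∫ p, f p)) := by
  refine tendsto_integral_filter_of_dominated_convergence (fun p => |f p|)
    (Eventually.of_forall fun s => hf.aestronglyMeasurable.mul
      (hη.comp (continuous_const.mul continuous_id)).aestronglyMeasurable)
    (Eventually.of_forall fun s => Eventually.of_forall fun p => ?_) hf.abs
    (Eventually.of_forall fun p => ?_)
  · rw [norm_mul]
    exact mul_le_of_le_one_right (norm_nonneg _) (hη1 _)
  · have h1 : Continuous fun s => f p * η (s * p) := by fun_prop
    have h2 := h1.tendsto 0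
    simp only [zero_mul, hη0, mul_one] at h2
    exact h2.mono_left nhdsWithin_le_nhds

/-- An average at scale `1 / t` bounds every `Lʳ` norm from below. -/
theorem ofReal_abs_average_le_eLpNorm (f : Lp V 1 (volume : Measure ℝ)) (hη1 : ∀ p, |η p| ≤ 1)
    (hη2 : ∀ p, 2 ≤ |p| → η p = 0) {t : ℝ} (ht : 0 < t) (ht4 : t ≤ 4) {r : ENNReal} (hr : 1 ≤ r) :
    ENNReal.ofReal (t / 4 * |∫ p, f p 4 * η (t * p)|) ≤ eLpNorm f r volume := by
  set S := Icc (-(2 / t)) (2 / t) with hS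
  have hSm : MeasurableSet S := measurableSet_Icc
  have hfi := L1.integrable_coeFn f
  have h1 : |∫ p, f p 4 * η (t * p)| ≤ ∫ p in S, ‖f p‖ := by
    rw [← integral_indicator hSm, ← Real.norm_eq_abs]
    refine norm_integral_le_of_norm_le (hfi.norm.indicator hSm) (Eventually.of_forall fun p => ?_)
    by_cases hp : p ∈ S
    · rw [indicator_of_mem hp, norm_mul]
      exact (mul_le_of_le_one_right (norm_nonneg _) (hη1 _)).trans (PiLp.norm_apply_le (f p) 4)
    · rw [indicator_of_notMem hp, hη2, mul_zero, norm_zero]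
      rw [abs_mul, abs_of_pos ht]
      have h2 : ¬ |p| ≤ 2 / t := fun h => hp (abs_le.1 h)
      rw [not_le, div_lt_iff₀ ht] at h2
      linarith
  have hvol : volume S = ENNReal.ofReal (4 / t) := by
    rw [hS, Real.volume_Icc]
    congr 1
    ring
  have h4t : 1 ≤ 4 / t := (one_le_div ht).2 ht4
  have h2 : ENNReal.ofReal (∫ p in S, ‖f p‖) ≤ eLpNorm f r volume * ENNReal.ofReal (4 / t) := by
    rw [ofReal_integral_norm_eq_lintegral_enorm hfi.integrableOn, ← eLpNorm_one_eq_lintegral_enorm]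
    refine (eLpNorm_le_eLpNorm_mul_rpow_measure_univ hr
      hfi.aestronglyMeasurable.restrict).trans ?_
    refine mul_le_mul' (eLpNorm_restrict_le _ _ _ _) ?_
    rw [Measure.restrict_apply_univ, hvol]
    -- The Hölder exponent `1 - 1/r` is raised to `1`, since `4 / t ≥ 1`. For `r = ∞` the
    -- conventions `toReal ⊤ = 0` and `1 / 0 = 0` give the correct exponent `1`.
    calc ENNReal.ofReal (4 / t) ^ (1 / (1 : ENNReal).toReal - 1 / r.toReal)
        ≤ ENNReal.ofReal (4 / t) ^ (1 : ℝ) := by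
          refine ENNReal.rpow_le_rpow_of_exponent_le (ENNReal.one_le_ofReal.2 h4t) ?_
          have : 0 ≤ 1 / r.toReal := by positivity
          simp only [ENNReal.toReal_one, div_one]
          linarith
      _ = _ := ENNReal.rpow_one _
  have h3 : ENNReal.ofReal |∫ p, f p 4 * η (t * p)|
      ≤ eLpNorm f r volume * ENNReal.ofReal (4 / t) := (ENNReal.ofReal_le_ofReal h1).trans h2
  have hpos : ENNReal.ofReal (4 / t) ≠ 0 := (ENNReal.ofReal_pos.2 (by positivity)).ne'
  rw [← ENNReal.div_le_iff hpos ENNReal.ofReal_ne_top, ← ENNReal.ofReal_div_of_pos (by positivity)]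
    at h3
  convert h3 using 2
  field_simp

/-- The cutoff scale is tied to time by `s = t`. The relative transport error is then `t / √t = √t`,
and the Hölder loss of one power of `t` is outweighed by `t ^ (-c)`, as `c > 1`. -/
theorem IsWeakSolution.tendsto_eLpNorm_top (hu : IsWeakSolution C h α T g u)
    (H : RegularSingular C h c T K) (hα : ∀ i, ContinuousOn (α i) (Ioc 0 T)) {K' : ℝ}
    (hαb : ∀ i, ∀ t ∈ Ioc 0 T, |α i t| ≤ K') (hg : Continuous g) (hgs : HasCompactSupport g)
    {x : ℝ → V} (hx : Solves C h T (∫ p, g p) x) (hxT : ∀ i, x T i = ∫ p, u T p i)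
    {d : ℝ} (hd : d ≠ 0) (hxd : Tendsto (fun t => t ^ c * x t 4) (𝓝[>] 0) (𝓝 d))
    {r : ENNReal} (hr : 1 ≤ r) :
    Tendsto (fun t => eLpNorm (u t) r volume) (𝓝[>] 0) (𝓝 ⊤) := by
  have hT := H.T_pos
  have hc := H.one_lt
  obtain ⟨η, hη, hηs, hη1, hηone, hη2⟩ := exists_smooth_cutoff
  have hηc := hη.continuous
  obtain ⟨L, hL⟩ := hηs.deriv.exists_bound_of_continuous (hη.continuous_deriv (by simp))
  obtain ⟨B, hB0, hB⟩ := hu.exists_integral_abs_le H hα (hg.integrable_of_hasCompactSupport hgs)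
  set m : ℝ → ℝ := fun t => ∫ p, u t p 4 * η (t * p) with hm
  have hgη : ∀ᶠ s in 𝓝[>] (0 : ℝ), ∀ p, g p * η (s * p) = g p := by
    obtain ⟨R, hR⟩ := hgs.isCompact.isBounded.exists_norm_le
    have hR1 : 0 < |R| + 1 := by positivity
    filter_upwards [Ioc_mem_nhdsGT (show 0 < 1 / (|R| + 1) by positivity)] with s hs p
    by_cases hp : p ∈ tsupport g
    · rw [hηone, mul_one]
      rw [abs_mul, abs_of_pos hs.1]
      have h1 : |p| ≤ |R| + 1 := (hR p hp).trans ((le_abs_self R).trans (by linarith))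
      calc s * |p| ≤ 1 / (|R| + 1) * (|R| + 1) :=
            mul_le_mul hs.2 h1 (abs_nonneg _) (by positivity)
        _ = 1 := by field_simp
    · rw [image_eq_zero_of_notMem_tsupport hp, zero_mul]
  have hZ : Tendsto (fun s => weightedSize c (fun j r => |(∫ p, u r p j * η (s * p)) - x r j|) T)
      (𝓝[>] 0) (𝓝 0) := by
    have h1 : ∀ j, Tendsto (fun s => |(∫ p, u T p j * η (s * p)) - x T j|) (𝓝[>] 0) (𝓝 0) := by
      intro j
      have h2 := ((tendsto_integral_mul_cutoff (integrable_coord (u T) j) hηc hη1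
        (hηone 0 (by simp))).sub_const (x T j)).abs
      rwa [hxT j, sub_self, abs_zero, ← hxT j] at h2
    have h2 := ((h1 4).const_mul (T ^ c)).add
      ((tendsto_finsetSum Finset.univ fun (j : Fin 4) _ => h1 j.castSucc).const_mul
        (T ^ (c - 1 / 2)))
    simpa [weightedSize] using h2
  have hdiff : Tendsto (fun t => t ^ c * |m t - x t 4|) (𝓝[>] 0) (𝓝 0) := by
    have h1 : Tendsto (fun t : ℝ => (4 + √T) * (2 * K' * L * B * √t)) (𝓝[>] 0) (𝓝 0) := by
      have : Continuous fun t : ℝ => (4 + √T) * (2 * K' * L * B * √t) := by fun_prop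
      simpa using (this.tendsto 0).mono_left nhdsWithin_le_nhds
    have h2 := (hZ.add h1).mul_const (Real.exp (2 * (4 * K * (1 + √T)) * √T))
    rw [add_zero, zero_mul] at h2
    refine squeeze_zero' ?_ ?_ h2
    · filter_upwards [self_mem_nhdsWithin] with t ht
      exact mul_nonneg (Real.rpow_nonneg (le_of_lt ht) _) (abs_nonneg _)
    · filter_upwards [hgη, Ioc_mem_nhdsGT hT] with t hgt ht
      have h3 := hu.rpow_mul_abs_average_sub_le H hαb hB0 hB hη hηs hL hx ht.1 hgt ht
      have h4 : K' * (t * L * B) * (2 / √t) = 2 * K' * L * B * √t := by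
        have hw := Real.sqrt_pos.2 ht.1
        nth_rewrite 1 [← Real.sq_sqrt ht.1.le]
        field_simp
      rwa [h4] at h3
  have hmd : Tendsto (fun t => t ^ c * m t) (𝓝[>] 0) (𝓝 d) := by
    have h1 : Tendsto (fun t => t ^ c * (m t - x t 4)) (𝓝[>] 0) (𝓝 0) := by
      refine squeeze_zero_norm' ?_ hdiff
      filter_upwards [self_mem_nhdsWithin] with t ht
      rw [norm_mul, Real.norm_of_nonneg (Real.rpow_nonneg (le_of_lt ht) _), Real.norm_eq_abs]
    have h2 := h1.add hxd
    rw [zero_add] at h2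
    exact h2.congr fun t => by ring
  have hbig : Tendsto (fun t => t / 4 * |m t|) (𝓝[>] 0) atTop := by
    have h1 : Tendsto (fun t : ℝ => t ^ (-(c - 1))) (𝓝[>] 0) atTop :=
      tendsto_rpow_neg_nhdsGT_zero (by linarith)
    have h2 : Tendsto (fun t => |t ^ c * m t| / 4) (𝓝[>] 0) (𝓝 (|d| / 4)) := hmd.abs.div_const 4
    have h3 := h2.pos_mul_atTop (by positivity) h1
    refine h3.congr' ?_
    filter_upwards [self_mem_nhdsWithin] with t ht
    have ht0 : 0 < t := ht
    have e : t ^ c * t ^ (-(c - 1)) = t := by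
      rw [← Real.rpow_add ht0, show c + -(c - 1) = 1 by ring, Real.rpow_one]
    rw [abs_mul, abs_of_pos (Real.rpow_pos_of_pos ht0 c)]
    calc t ^ c * |m t| / 4 * t ^ (-(c - 1)) = (t ^ c * t ^ (-(c - 1))) * |m t| / 4 := by ring
      _ = t / 4 * |m t| := by rw [e]; ring
  refine tendsto_nhds_top_mono (ENNReal.tendsto_ofReal_atTop.comp hbig) ?_
  filter_upwards [Ioc_mem_nhdsGT (show (0 : ℝ) < 4 by norm_num)] with t ht
  exact ofReal_abs_average_le_eLpNorm (u t) hη1 hη2 ht.1 ht.2 hr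

end Blowup

/-! ### The coefficients near the Cauchy horizon -/

theorem hasDerivAt_const_mul_rpow {a z : ℝ} (hz : 0 < 1 + a * z) (k p : ℝ) :
    HasDerivAt (fun z => k * (1 + a * z) ^ p) (k * (p * a) * (1 + a * z) ^ (p - 1)) z := by
  have h1 : HasDerivAt (fun z : ℝ => 1 + a * z) a z := by
    simpa using ((hasDerivAt_id z).const_mul a).const_add 1
  exact ((h1.rpow_const (p := p) (Or.inl hz.ne')).const_mul k).congr_deriv (by ring)

theorem eventually_pos_of_pos {a z : ℝ} (hz : 0 < 1 + a * z) : ∀ᶠ w in 𝓝 z, 0 < 1 + a * w := by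
  have : Continuous fun w : ℝ => 1 + a * w := by fun_prop
  exact this.continuousAt.eventually (lt_mem_nhds hz)

theorem hasDerivAt_S {a z : ℝ} (hz : 0 < 1 + a * z) :
    HasDerivAt (S a) (2 * a / 3 * (1 + a * z) ^ (-(1 / 3) : ℝ)) z := by
  have h1 := hasDerivAt_const_mul_rpow hz 1 (2 / 3)
  simp only [one_mul] at h1
  refine h1.congr_deriv ?_
  rw [show (2 / 3 - 1 : ℝ) = -(1 / 3) by norm_num]
  ring

theorem S1_eq {a z : ℝ} (hz : 0 < 1 + a * z) :
    S1 a z = 2 * a / 3 * (1 + a * z) ^ (-(1 / 3) : ℝ) := (hasDerivAt_S hz).deriv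

theorem hasDerivAt_S1 {a z : ℝ} (hz : 0 < 1 + a * z) :
    HasDerivAt (S1 a) (-(2 * a ^ 2 / 9) * (1 + a * z) ^ (-(4 / 3) : ℝ)) z := by
  have h1 := hasDerivAt_const_mul_rpow hz (2 * a / 3) (-(1 / 3))
  refine (h1.congr_of_eventuallyEq ?_).congr_deriv ?_
  · filter_upwards [eventually_pos_of_pos hz] with w hw using S1_eq hw
  · rw [show (-(1 / 3) - 1 : ℝ) = -(4 / 3) by norm_num]
    ring

theorem S2_eq {a z : ℝ} (hz : 0 < 1 + a * z) :
    S2 a z = -(2 * a ^ 2 / 9) * (1 + a * z) ^ (-(4 / 3) : ℝ) := by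
  rw [S2, iteratedDeriv_succ, iteratedDeriv_one]
  exact (hasDerivAt_S1 hz).deriv

theorem hasDerivAt_S2 {a z : ℝ} (hz : 0 < 1 + a * z) :
    HasDerivAt (S2 a) (8 * a ^ 3 / 27 * (1 + a * z) ^ (-(7 / 3) : ℝ)) z := by
  have h1 := hasDerivAt_const_mul_rpow hz (-(2 * a ^ 2 / 9)) (-(4 / 3))
  refine (h1.congr_of_eventuallyEq ?_).congr_deriv ?_
  · filter_upwards [eventually_pos_of_pos hz] with w hw using S2_eq hw
  · rw [show (-(4 / 3) - 1 : ℝ) = -(7 / 3) by norm_num]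
    ring

theorem S3_eq {a z : ℝ} (hz : 0 < 1 + a * z) :
    S3 a z = 8 * a ^ 3 / 27 * (1 + a * z) ^ (-(7 / 3) : ℝ) := by
  rw [S3, iteratedDeriv_succ]
  exact (hasDerivAt_S2 hz).deriv

theorem continuousAt_S3 {a z : ℝ} (hz : 0 < 1 + a * z) : ContinuousAt (S3 a) z := by
  refine (hasDerivAt_const_mul_rpow hz (8 * a ^ 3 / 27) (-(7 / 3))).continuousAt.congr ?_
  filter_upwards [eventually_pos_of_pos hz] with w hw using (S3_eq hw).symm

theorem quadratic_pos {a z : ℝ} (hz : 0 < 1 + a * z) : 0 < 3 + 4 * a * z + a ^ 2 * z ^ 2 := by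
  nlinarith

theorem q_pos {a z : ℝ} (ha : 0 < a) (hz : 0 < 1 + a * z) : 0 < q a z := by
  have := quadratic_pos hz
  unfold q
  positivity

theorem contDiffAt_q {a z : ℝ} (hz : 0 < 1 + a * z) : ContDiffAt ℝ 2 (q a) z := by
  unfold q
  have := quadratic_pos hz
  have := Real.pi_pos
  refine contDiffAt_const.div (by fun_prop) (by positivity)

theorem continuousAt_dq {a z : ℝ} (hz : 0 < 1 + a * z) : ContinuousAt (dq a) z :=
  ((contDiffAt_q hz).derivWithin (m := 1) (by norm_num)).continuousAt

/-- The function whose largest root is the Cauchy horizon. -/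
def horizonFn (a z : ℝ) : ℝ := z + S a z - z * S1 a z

theorem hasDerivAt_horizonFn {a z : ℝ} (hz : 0 < 1 + a * z) :
    HasDerivAt (horizonFn a) (1 - z * S2 a z) z := by
  have h1 := ((hasDerivAt_id z).add (hasDerivAt_S hz)).sub ((hasDerivAt_id z).mul (hasDerivAt_S1 hz))
  refine h1.congr_deriv ?_
  rw [S2_eq hz, S1_eq hz, id]
  ring

/-- Analyticity passes to the difference quotient at the root, whose differentiability is behind `c
- C₅₅(t) = O(t)`. -/
theorem analyticAt_horizonFn {a z : ℝ} (hz : 0 < 1 + a * z) : AnalyticAt ℝ (horizonFn a) z := by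
  have hx : AnalyticAt ℝ (fun w : ℝ => 1 + a * w) z := by fun_prop
  have hp : ∀ p : ℝ, AnalyticAt ℝ (fun w : ℝ => (1 + a * w) ^ p) z := fun p =>
    (hx.contDiffAt.rpow_const_of_ne (n := ω) hz.ne').analyticAt
  have h1 : AnalyticAt ℝ (fun w => w + (1 + a * w) ^ (2 / 3 : ℝ)
      - w * (2 * a / 3 * (1 + a * w) ^ (-(1 / 3) : ℝ))) z :=
    (analyticAt_id.add (hp _)).sub (analyticAt_id.mul (analyticAt_const.mul (hp _)))
  refine h1.congr ?_
  filter_upwards [eventually_pos_of_pos hz] with w hw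
  rw [horizonFn, S1_eq hw, S]

/-- Below the critical value of `a` the Cauchy horizon is a simple root. -/
theorem one_sub_mul_S2_ne_zero {a z : ℝ} (ha : 0 < a) (ha' : a < aStar) (hz : 0 < 1 + a * z)
    (hroot : horizonFn a z = 0) : 1 - z * S2 a z ≠ 0 := by
  intro hdouble
  set y := (1 + a * z) ^ (1 / 3 : ℝ) with hy
  have hy0 : 0 < y := Real.rpow_pos_of_pos hz _
  have hpow : ∀ n : ℕ, (1 + a * z) ^ ((n : ℝ) / 3) = y ^ n := fun n => by
    rw [hy, ← Real.rpow_natCast, ← Real.rpow_mul hz.le]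
    congr 1
    ring
  have hy3 : y ^ 3 = 1 + a * z := by
    rw [← hpow 3]
    norm_num
  have hS : S a z = y ^ 2 := by
    rw [S, ← hpow 2]
    norm_num
  have hS1 : S1 a z = 2 * a / (3 * y) := by
    rw [S1_eq hz, Real.rpow_neg hz.le, ← hy]
    field_simp
  have hS2 : S2 a z = -(2 * a ^ 2 / (9 * y ^ 4)) := by
    have h4 := hpow 4
    rw [S2_eq hz, Real.rpow_neg hz.le, show (4 / 3 : ℝ) = ((4 : ℕ) : ℝ) / 3 by norm_num, h4]
    field_simp
  rw [horizonFn, hS, hS1] at hroot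
  rw [hS2] at hdouble
  have hz' : a * z = y ^ 3 - 1 := by linarith
  -- With `y = (1 + a z) ^ (1/3)`, a double root means two polynomial equations in `y` and `a`,
  -- namely `e1` and `e2`. Eliminating `a` leaves a quadratic for `w = y³` with positive root `3 √3
  -- - 5`. Substituting back gives `a³ = aStar³`, a contradiction.
  have e1 : 3 * y * (y ^ 3 - 1) + a * (y ^ 3 + 2) = 0 := by
    have h2 : 3 * y * z + 3 * y ^ 3 - 2 * a * z = 0 := by
      field_simp at hroot
      linarith
    linear_combination a * h2 - (3 * y - 2 * a) * hz'
  have e2 : 9 * y ^ 4 + 2 * a * (y ^ 3 - 1) = 0 := by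
    field_simp at hdouble
    have h3 : 9 * y ^ 4 + 2 * a * (a * z) = 0 := by linarith
    rwa [hz'] at h3
  set w := y ^ 3 with hw
  have hw0 : 0 < w := by positivity
  have e3 : w ^ 2 + 10 * w - 2 = 0 := by
    have h1 : 3 * y * (w ^ 2 + 10 * w - 2) = 0 := by
      have h4 : y ^ 4 = y * w := by rw [hw]; ring
      rw [h4] at e2
      linear_combination (w + 2) * e2 - 2 * (w - 1) * e1
    rcases mul_eq_zero.1 h1 with h | h
    · exact absurd h (by positivity)
    · exact h
  set σ := √3 with hσ
  have hσ2 : σ ^ 2 = 3 := Real.sq_sqrt (by norm_num)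
  have hσ0 : 0 < σ := Real.sqrt_pos.2 (by norm_num)
  have hwσ : w = 3 * σ - 5 := by
    have h1 : (w + 5 - 3 * σ) * (w + 5 + 3 * σ) = 0 := by linear_combination e3 - 9 * hσ2
    rcases mul_eq_zero.1 h1 with h | h
    · linarith
    · exact absurd h (by positivity)
  have e4 : a ^ 3 * (w + 2) ^ 3 = 27 * w * (1 - w) ^ 3 := by
    have h1 : a * (w + 2) = 3 * y * (1 - w) := by linarith
    calc a ^ 3 * (w + 2) ^ 3 = (a * (w + 2)) ^ 3 := by ring
      _ = (3 * y * (1 - w)) ^ 3 := by rw [h1]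
      _ = 27 * w * (1 - w) ^ 3 := by rw [hw]; ring
  have e5 : a ^ 3 * (2 * (26 + 15 * σ)) = 27 := by
    have h1 : (w + 2) ^ 3 = 54 * w := by
      rw [hwσ]
      linear_combination (27 * σ - 81) * hσ2
    have h2 : (1 - w) ^ 3 * (26 + 15 * σ) = 27 := by
      rw [hwσ]
      linear_combination (-405 * σ ^ 2 + 1728 * σ - 1863) * hσ2
    rw [h1] at e4
    have h3 : w * (a ^ 3 * (2 * (26 + 15 * σ)) - 27) = 0 := by
      linear_combination ((26 + 15 * σ) / 27) * e4 + w * h2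
    rcases mul_eq_zero.1 h3 with h | h
    · exact absurd h hw0.ne'
    · linarith
  have e6 : aStar ^ 3 * (2 * (26 + 15 * σ)) = 27 := by
    have hpos : 0 < 2 * (26 + 15 * σ) := by positivity
    rw [aStar, div_pow, ← Real.rpow_natCast (_ ^ (1 / 3 : ℝ)), ← Real.rpow_mul hpos.le]
    norm_num
    field_simp
  have h7 : a ^ 3 < aStar ^ 3 := pow_lt_pow_left₀ ha' ha.le (by norm_num)
  nlinarith

theorem IsCauchyHorizon.pos {a zc : ℝ} (ha : 0 < a) (hzc : IsCauchyHorizon a zc) {z : ℝ}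
    (hz : zc ≤ z) : 0 < 1 + a * z := by
  have h1 := hzc.1.1
  rw [div_lt_iff₀ ha] at h1
  nlinarith

theorem IsCauchyHorizon.horizonFn_eq_zero {a zc : ℝ} (hzc : IsCauchyHorizon a zc) :
    horizonFn a zc = 0 := hzc.1.2

/-- The function equals `1` at `0`; a nonpositive value to the right of `zc` would force a root
larger than `zc`. -/
theorem IsCauchyHorizon.horizonFn_pos {a zc : ℝ} (ha : 0 < a) (hzc : IsCauchyHorizon a zc) {z : ℝ}
    (hz : zc < z) (hz0 : z ≤ 0) : 0 < horizonFn a z := by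
  by_contra hcon
  have hcont : ContinuousOn (horizonFn a) (Icc z 0) := fun w hw =>
    (hasDerivAt_horizonFn (hzc.pos ha (hz.le.trans hw.1))).continuousAt.continuousWithinAt
  have h0 : horizonFn a 0 = 1 := by simp [horizonFn, S]
  obtain ⟨w, hw, hw0⟩ := intermediate_value_Icc hz0 hcont
    (show (0 : ℝ) ∈ Icc (horizonFn a z) (horizonFn a 0) from ⟨not_lt.1 hcon, by rw [h0]; norm_num⟩)
  have hmem : -1 / a < w := by
    have := hzc.pos ha (hz.le.trans hw.1)
    rw [div_lt_iff₀ ha]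
    linarith
  have := hzc.2 ⟨hmem, hw0⟩
  linarith [hw.1]

/-- The function `(z + S - z S') / (z - zc)`, extended to the Cauchy horizon. -/
def horizonSlope (a zc z : ℝ) : ℝ := dslope (horizonFn a) zc z

/-! ### Signs of the denominators up to the Cauchy horizon -/

section Horizon

variable {a zc : ℝ}

theorem horizonFn_eq_mul (hzc : IsCauchyHorizon a zc) (t : ℝ) :
    horizonFn a (zc + t) = t * horizonSlope a zc (zc + t) := by
  have := sub_smul_dslope_of_zero hzc.horizonFn_eq_zero (zc + t)
  rw [add_sub_cancel_left, smul_eq_mul] at this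
  exact this.symm

theorem horizonSlope_self (ha : 0 < a) (hzc : IsCauchyHorizon a zc) :
    horizonSlope a zc zc = 1 - zc * S2 a zc := by
  rw [horizonSlope, dslope_same, (hasDerivAt_horizonFn (hzc.pos ha le_rfl)).deriv]

theorem differentiableAt_horizonSlope (ha : 0 < a) (hzc : IsCauchyHorizon a zc) :
    DifferentiableAt ℝ (horizonSlope a zc) zc := by
  obtain ⟨p, hp⟩ := analyticAt_horizonFn (hzc.pos ha le_rfl)
  exact hp.has_fpower_series_dslope_fslope.analyticAt.differentiableAt

theorem continuousAt_horizonSlope (ha : 0 < a) (hzc : IsCauchyHorizon a zc) {z : ℝ} (hz : zc ≤ z) :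
    ContinuousAt (horizonSlope a zc) z := by
  rcases eq_or_lt_of_le hz with rfl | h
  · exact (differentiableAt_horizonSlope ha hzc).continuousAt
  · exact (continuousAt_dslope_of_ne h.ne').2 (hasDerivAt_horizonFn (hzc.pos ha hz)).continuousAt

theorem horizonSlope_pos_of_lt (ha : 0 < a) (hzc : IsCauchyHorizon a zc) {z : ℝ} (hz : zc < z)
    (hz0 : z ≤ 0) : 0 < horizonSlope a zc z := by
  have h1 := horizonFn_eq_mul hzc (z - zc)
  rw [add_sub_cancel] at h1
  have h2 := hzc.horizonFn_pos ha hz hz0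
  rw [h1] at h2
  exact pos_of_mul_pos_right h2 (sub_pos.2 hz).le

/-- At `zc` itself the slope is a limit of positive numbers, and it is nonzero because the root is
simple. -/
theorem horizonSlope_pos (ha : 0 < a) (ha' : a < aStar) (hzc : IsCauchyHorizon a zc) {z : ℝ}
    (hzc0 : zc < 0) (hz : zc ≤ z) (hz0 : z ≤ 0) : 0 < horizonSlope a zc z := by
  rcases eq_or_lt_of_le hz with rfl | h
  · refine lt_of_le_of_ne ?_ ?_
    · refine ge_of_tendsto ((continuousAt_horizonSlope ha hzc le_rfl).tendsto.mono_left
        (nhdsWithin_le_nhds (s := Ioi zc))) ?_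
      filter_upwards [Ioc_mem_nhdsGT hzc0] with w hw
      exact (horizonSlope_pos_of_lt ha hzc hw.1 hw.2).le
    · rw [horizonSlope_self ha hzc]
      exact (one_sub_mul_S2_ne_zero ha ha' (hzc.pos ha le_rfl) hzc.horizonFn_eq_zero).symm
  · exact horizonSlope_pos_of_lt ha hzc h hz0

theorem S_pos {z : ℝ} (hz : 0 < 1 + a * z) : 0 < S a z := Real.rpow_pos_of_pos hz _

theorem S1_pos {z : ℝ} (ha : 0 < a) (hz : 0 < 1 + a * z) : 0 < S1 a z := by
  rw [S1_eq hz]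
  have := Real.rpow_pos_of_pos hz (-(1 / 3))
  positivity

theorem S2_neg {z : ℝ} (ha : 0 < a) (hz : 0 < 1 + a * z) : S2 a z < 0 := by
  rw [S2_eq hz, neg_mul, neg_lt_zero]
  have := Real.rpow_pos_of_pos hz (-(4 / 3))
  positivity

/-- The horizon equation reads `S = zc (S' - 1)`, so `S > 0 > zc` forces `S' < 1` there, and `S'` is
decreasing. -/
theorem S1_lt_one (ha : 0 < a) (hzc : IsCauchyHorizon a zc) (hzc0 : zc < 0) {z : ℝ} (hz : zc ≤ z) :
    S1 a z < 1 := by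
  have hp := hzc.pos ha le_rfl
  have h1 := hzc.horizonFn_eq_zero
  rw [horizonFn] at h1
  have h2 : S1 a zc < 1 := by
    have := S_pos hp
    nlinarith
  refine lt_of_le_of_lt ?_ h2
  rw [S1_eq hp, S1_eq (hzc.pos ha hz)]
  refine mul_le_mul_of_nonneg_left ?_ (by positivity)
  exact Real.rpow_le_rpow_of_nonpos hp (by nlinarith) (by norm_num)

theorem coeff_ne_zero (ha : 0 < a) (hzc : IsCauchyHorizon a zc) {z : ℝ} (hz : zc ≤ z)
    (hz0 : z < 0) : S a z ≠ 0 ∧ -1 + S1 a z ≠ 0 ∧ 1 + S1 a z ≠ 0 ∧ S a z - z * S1 a z ≠ 0 ∧ z ≠ 0 ∧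
      z - S a z + z * S1 a z ≠ 0 ∧ q a z ≠ 0 := by
  have hp := hzc.pos ha hz
  have h1 := S_pos hp
  have h2 := S1_pos ha hp
  have h3 := S1_lt_one ha hzc (hz.trans_lt hz0) hz
  have h4 := mul_pos_of_neg_of_neg hz0 (neg_neg_of_pos h2)
  refine ⟨h1.ne', by linarith, by linarith, by nlinarith, hz0.ne, by nlinarith, (q_pos ha hp).ne'⟩

end Horizon

/-! ### Continuity of the coefficients and the exponent -/

section Coefficients

variable {a zc : ℝ}

/-- The entries of the last row of `C̃`, multiplied by `z + S - z S'`. -/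
def lastRow (a z : ℝ) : Fin 5 → ℝ :=
  ![-(4 * (-(z * S1 a z ^ 2) + S a z * (S1 a z + z * S2 a z)) / S a z), 0,
    -((-1 + S1 a z) * (S a z - z * S1 a z) / S a z),
    -((-1 + S1 a z) * (S a z - z * S1 a z) / S a z),
    -((3 + (-z + S a z) * S2 a z + S1 a z * (-3 + z * S2 a z)) / (-1 + S1 a z))]

theorem C_last_eq (l : ℕ) (hzc : IsCauchyHorizon a zc) {t : ℝ} (ht : t ≠ 0) (j : Fin 5) :
    C a l zc t 4 j = lastRow a (zc + t) j / horizonSlope a zc (zc + t) := by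
  have h1 : zc + t + S a (zc + t) - (zc + t) * S1 a (zc + t)
      = t * horizonSlope a zc (zc + t) := horizonFn_eq_mul hzc t
  have h2 : ∀ n m k : ℝ, t * -(n / (m * (t * k))) = -(n / m) / k := by
    intro n m k
    field_simp
  fin_cases j <;> simp [C, Ctilde, lastRow, h1, h2]

theorem h_last_eq (hzc : IsCauchyHorizon a zc) {t : ℝ} (ht : t ≠ 0) :
    h a zc t 4 = 8 * Real.pi * q a (zc + t) * (-1 + S1 a (zc + t))
      * (S a (zc + t) - (zc + t) * S1 a (zc + t)) / S a (zc + t)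
      / horizonSlope a zc (zc + t) := by
  have h1 : zc + t + S a (zc + t) - (zc + t) * S1 a (zc + t)
      = t * horizonSlope a zc (zc + t) := horizonFn_eq_mul hzc t
  have h2 : ∀ n m k : ℝ, t * (n / (m * (t * k))) = n / m / k := by
    intro n m k
    field_simp
  simp [h, ftilde, h1, h2]

theorem A_last_eq (hzc : IsCauchyHorizon a zc) {t : ℝ} (ht : t ≠ 0) :
    A a zc t 4 4 = -(horizonSlope a zc (zc + t))⁻¹ := by
  have h1 : zc + t + S a (zc + t) - (zc + t) * S1 a (zc + t)
      = t * horizonSlope a zc (zc + t) := horizonFn_eq_mul hzc t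
  simp [A, Atilde, h1]
  field_simp

section Continuity

variable {s : Set ℝ}

theorem continuousOn_S (hs : ∀ z ∈ s, 0 < 1 + a * z) : ContinuousOn (S a) s :=
  fun z hz => (hasDerivAt_S (hs z hz)).continuousAt.continuousWithinAt

theorem continuousOn_S1 (hs : ∀ z ∈ s, 0 < 1 + a * z) : ContinuousOn (S1 a) s :=
  fun z hz => (hasDerivAt_S1 (hs z hz)).continuousAt.continuousWithinAt

theorem continuousOn_S2 (hs : ∀ z ∈ s, 0 < 1 + a * z) : ContinuousOn (S2 a) s :=
  fun z hz => (hasDerivAt_S2 (hs z hz)).continuousAt.continuousWithinAt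

theorem continuousOn_S3 (hs : ∀ z ∈ s, 0 < 1 + a * z) : ContinuousOn (S3 a) s :=
  fun z hz => (continuousAt_S3 (hs z hz)).continuousWithinAt

theorem continuousOn_q (hs : ∀ z ∈ s, 0 < 1 + a * z) : ContinuousOn (q a) s :=
  fun z hz => (contDiffAt_q (hs z hz)).continuousAt.continuousWithinAt

theorem continuousOn_dq (hs : ∀ z ∈ s, 0 < 1 + a * z) : ContinuousOn (dq a) s :=
  fun z hz => (continuousAt_dq (hs z hz)).continuousWithinAt

theorem continuousOn_lastRow (ha : 0 < a) (hzc : IsCauchyHorizon a zc) (j : Fin 5) :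
    ContinuousOn (fun z => lastRow a z j) (Ico zc 0) := by
  have hs : ∀ z ∈ Ico zc 0, 0 < 1 + a * z := fun z hz => hzc.pos ha hz.1
  have c0 := continuousOn_S hs
  have c1 := continuousOn_S1 hs
  have c2 := continuousOn_S2 hs
  have n1 : ∀ z ∈ Ico zc 0, S a z ≠ 0 := fun z hz => (coeff_ne_zero ha hzc hz.1 hz.2).1
  have n2 : ∀ z ∈ Ico zc 0, -1 + S1 a z ≠ 0 := fun z hz => (coeff_ne_zero ha hzc hz.1 hz.2).2.1
  fin_cases j <;> simp [lastRow] <;> fun_prop (disch := assumption)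

theorem continuousOn_Ctilde (ha : 0 < a) (hzc : IsCauchyHorizon a zc) (l : ℕ) (i : Fin 4)
    (j : Fin 5) : ContinuousOn (fun z => Ctilde a l z i.castSucc j) (Ico zc 0) := by
  have hs : ∀ z ∈ Ico zc 0, 0 < 1 + a * z := fun z hz => hzc.pos ha hz.1
  have hn := fun z (hz : z ∈ Ico zc 0) => coeff_ne_zero ha hzc hz.1 hz.2
  have c0 := continuousOn_S hs
  have c1 := continuousOn_S1 hs
  have c2 := continuousOn_S2 hs
  have c3 := continuousOn_S3 hs
  have c4 := continuousOn_q hs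
  have c5 := continuousOn_dq hs
  fin_cases i <;> fin_cases j <;> simp [Ctilde] <;>
    fun_prop (disch := (intro z hz; obtain ⟨h1, h2, h3, h4, h5, h6, h7⟩ := hn z hz; simp [*]))

theorem continuousOn_ftilde (ha : 0 < a) (hzc : IsCauchyHorizon a zc) (i : Fin 4) :
    ContinuousOn (fun z => ftilde a z i.castSucc) (Ico zc 0) := by
  have hs : ∀ z ∈ Ico zc 0, 0 < 1 + a * z := fun z hz => hzc.pos ha hz.1
  have hn := fun z (hz : z ∈ Ico zc 0) => coeff_ne_zero ha hzc hz.1 hz.2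
  have c0 := continuousOn_S hs
  have c1 := continuousOn_S1 hs
  have c4 := continuousOn_q hs
  fin_cases i <;> simp [ftilde] <;>
    fun_prop (disch := (intro z hz; obtain ⟨h1, h2, h3, h4, h5, h6, h7⟩ := hn z hz; simp [*]))

theorem continuousOn_Atilde (ha : 0 < a) (hzc : IsCauchyHorizon a zc) (i : Fin 4) :
    ContinuousOn (fun z => Atilde a z i.castSucc i.castSucc) (Ico zc 0) := by
  have hs : ∀ z ∈ Ico zc 0, 0 < 1 + a * z := fun z hz => hzc.pos ha hz.1
  have hn := fun z (hz : z ∈ Ico zc 0) => coeff_ne_zero ha hzc hz.1 hz.2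
  have c0 := continuousOn_S hs
  have c1 := continuousOn_S1 hs
  have h5 : ContinuousOn (fun z => -(1 / z)) (Ico zc 0) :=
    (continuousOn_const.div continuousOn_id fun z hz => (hn z hz).2.2.2.2.1).neg
  have h6 : ContinuousOn (fun z => -(z - S a z + z * S1 a z)⁻¹) (Ico zc 0) :=
    (ContinuousOn.inv₀ (by fun_prop) fun z hz => (hn z hz).2.2.2.2.2.1).neg
  fin_cases i
  · simpa [Atilde] using continuousOn_const
  · simpa [Atilde] using continuousOn_const
  · simpa [Atilde] using h5
  · simpa [Atilde] using h6

end Continuity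

/-- The exponent at the Cauchy horizon. -/
def horizonExponent (a zc : ℝ) : ℝ := lastRow a zc 4 / horizonSlope a zc zc

/-- Inserting `S = zc S' - zc` reduces the numerator to `3 - 2 zc S''`, while the slope is `1 - zc
S'' > 0`; their difference `2 - zc S''` is positive. -/
theorem one_lt_horizonExponent (ha : 0 < a) (ha' : a < aStar) (hzc : IsCauchyHorizon a zc)
    (hzc0 : zc < 0) : 1 < horizonExponent a zc := by
  have hE := horizonSlope_pos ha ha' hzc hzc0 le_rfl hzc0.le
  have hp := hzc.pos ha le_rfl
  have h1 := S1_lt_one ha hzc hzc0 le_rfl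
  have h2 := S2_neg ha hp
  have hroot := hzc.horizonFn_eq_zero
  rw [horizonFn] at hroot
  rw [horizonSlope_self ha hzc] at hE
  have e : lastRow a zc 4 = 3 - 2 * (zc * S2 a zc) := by
    have hne : -1 + S1 a zc ≠ 0 := by linarith
    have hS : S a zc = zc * S1 a zc - zc := by linarith
    change -((3 + (-zc + S a zc) * S2 a zc + S1 a zc * (-3 + zc * S2 a zc)) / (-1 + S1 a zc)) = _
    rw [hS]
    field_simp
    ring
  rw [horizonExponent, e, horizonSlope_self ha hzc, one_lt_div hE]
  nlinarith [mul_pos_of_neg_of_neg hzc0 h2]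

theorem differentiableAt_lastRow (ha : 0 < a) (hzc : IsCauchyHorizon a zc) (hzc0 : zc < 0) :
    DifferentiableAt ℝ (fun z => lastRow a z 4) zc := by
  have hp := hzc.pos ha le_rfl
  have d0 := (hasDerivAt_S hp).differentiableAt
  have d1 := (hasDerivAt_S1 hp).differentiableAt
  have d2 := (hasDerivAt_S2 hp).differentiableAt
  have n2 : -1 + S1 a zc ≠ 0 := (coeff_ne_zero ha hzc le_rfl hzc0).2.1
  simp only [lastRow]
  change DifferentiableAt ℝ (fun z => -((3 + (-z + S a z) * S2 a z
    + S1 a z * (-3 + z * S2 a z)) / (-1 + S1 a z))) zc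
  fun_prop (disch := assumption)

end Coefficients

theorem exists_abs_sub_le_mul {f : ℝ → ℝ} {T : ℝ} (hf : ContinuousOn f (Icc 0 T))
    (hd : DifferentiableAt ℝ f 0) : ∃ K, 0 ≤ K ∧ ∀ t ∈ Ioc 0 T, |f t - f 0| ≤ K * t := by
  obtain ⟨k, hk⟩ := (hd.isBigO_sub).bound
  simp only [sub_zero] at hk
  obtain ⟨ε, hε, hball⟩ := Metric.eventually_nhds_iff.1 hk
  obtain ⟨M, hM⟩ := isCompact_Icc.exists_bound_of_continuousOn hf
  refine ⟨|k| + 2 * |M| / ε, by positivity, fun t ht => ?_⟩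
  have ht0 := ht.1
  rcases lt_or_ge t ε with h | h
  · have h1 := hball (y := t) (by rwa [Real.dist_eq, sub_zero, abs_of_pos ht0])
    rw [Real.norm_of_nonneg ht0.le] at h1
    refine h1.trans (mul_le_mul_of_nonneg_right ?_ ht0.le)
    have : 0 ≤ 2 * |M| / ε := by positivity
    linarith [le_abs_self k]
  · have h1 := hM t ⟨ht0.le, ht.2⟩
    have h2 := hM 0 ⟨le_rfl, ht0.le.trans ht.2⟩
    have h3 := norm_sub_le (f t) (f 0)
    have h4 : 2 * |M| ≤ 2 * |M| / ε * t := by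
      rw [div_mul_eq_mul_div, le_div_iff₀ hε]
      exact mul_le_mul_of_nonneg_left h (by positivity)
    have h5 := mul_nonneg (abs_nonneg k) ht0.le
    rw [Real.norm_eq_abs] at h3
    nlinarith [le_abs_self M]

theorem exists_forall_abs_le {ι : Type*} [Fintype ι] {T : ℝ} {f : ι → ℝ → ℝ}
    (hf : ∀ i, ContinuousOn (f i) (Icc 0 T)) : ∃ K, 0 ≤ K ∧ ∀ i, ∀ t ∈ Icc 0 T, |f i t| ≤ K := by
  choose M hM using fun i => isCompact_Icc.exists_bound_of_continuousOn (hf i)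
  refine ⟨∑ i, |M i|, Finset.sum_nonneg fun i _ => abs_nonneg _, fun i t ht => ?_⟩
  exact ((hM i t ht).trans (le_abs_self _)).trans
    (Finset.single_le_sum (f := fun i => |M i|) (fun i _ => abs_nonneg _) (Finset.mem_univ i))

/-! ### The equation as a regular singular weak problem -/

section Instance

variable {a zc T : ℝ}

theorem continuousOn_shift {F : ℝ → ℝ} (hT : zc + T < 0) (hF : ContinuousOn F (Ico zc 0)) :
    ContinuousOn (fun t => F (zc + t)) (Icc 0 T) :=
  hF.comp (by fun_prop) fun t ht => ⟨by linarith [ht.1], by linarith [ht.2]⟩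

theorem continuousOn_div_horizonSlope (ha : 0 < a) (ha' : a < aStar) (hzc : IsCauchyHorizon a zc)
    (hT0 : 0 < T) (hT : zc + T < 0) {F : ℝ → ℝ} (hF : ContinuousOn F (Ico zc 0)) :
    ContinuousOn (fun t => F (zc + t) / horizonSlope a zc (zc + t)) (Icc 0 T) :=
  continuousOn_shift (F := fun z => F z / horizonSlope a zc z) hT (hF.div
    (fun z hz => (continuousAt_horizonSlope ha hzc hz.1).continuousWithinAt)
    fun z hz => (horizonSlope_pos ha ha' hzc (by linarith) hz.1 hz.2.le).ne')

theorem tendsto_nhdsGT_of_continuousOn {f F : ℝ → ℝ} (hT0 : 0 < T)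
    (hF : ContinuousOn F (Icc 0 T)) (hfF : ∀ t ∈ Ioc 0 T, f t = F t) :
    Tendsto f (𝓝[>] 0) (𝓝 (F 0)) := by
  have h1 : Tendsto F (𝓝[>] 0) (𝓝 (F 0)) :=
    (hF 0 ⟨le_rfl, hT0.le⟩).tendsto.mono_left
      (nhdsWithin_le_of_mem (mem_of_superset (Ioc_mem_nhdsGT hT0) Ioc_subset_Icc_self))
  refine h1.congr' ?_
  filter_upwards [Ioc_mem_nhdsGT hT0] with t ht using (hfF t ht).symm

theorem tendsto_C_last (ha : 0 < a) (ha' : a < aStar) (l : ℕ) (hzc : IsCauchyHorizon a zc)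
    (hT0 : 0 < T) (hT : zc + T < 0) (j : Fin 5) :
    Tendsto (fun t => C a l zc t 4 j) (𝓝[>] 0) (𝓝 (lastRow a zc j / horizonSlope a zc zc)) := by
  have h1 := tendsto_nhdsGT_of_continuousOn hT0
    (continuousOn_div_horizonSlope ha ha' hzc hT0 hT (continuousOn_lastRow ha hzc j))
    (f := fun t => C a l zc t 4 j) (fun t ht => C_last_eq l hzc ht.1.ne' j)
  simpa using h1

/-- `limUnder` is meaningful only once convergence is known, which is what `tendsto_C_last`
provides. -/
theorem cExp_eq (ha : 0 < a) (ha' : a < aStar) (l : ℕ) (hzc : IsCauchyHorizon a zc)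
    (hT0 : 0 < T) (hT : zc + T < 0) : cExp a l zc = horizonExponent a zc :=
  (tendsto_C_last ha ha' l hzc hT0 hT 4).limUnder_eq

/-- On `[zc, 0)` the only vanishing denominator is that of the fifth row, and the factor `t` cancels
it. All remaining functions are continuous on the compact interval `[zc, zc + T]`, so one constant
serves for every bound. -/
theorem exists_regularSingular (ha : 0 < a) (ha' : a < aStar) (l : ℕ) (hzc : IsCauchyHorizon a zc)
    (hT0 : 0 < T) (hT : zc + T < 0) :
    ∃ K, RegularSingular (C a l zc) (h a zc) (cExp a l zc) T K := by
  have hzc0 : zc < 0 := by linarith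
  have hlast := fun j => continuousOn_div_horizonSlope ha ha' hzc hT0 hT
    (continuousOn_lastRow ha hzc j)
  have hreg := fun (p : Fin 4 × Fin 5) =>
    continuousOn_shift hT (continuousOn_Ctilde ha hzc l p.1 p.2)
  have hf := fun i => continuousOn_shift hT (continuousOn_ftilde ha hzc i)
  have hs : ∀ z ∈ Ico zc 0, 0 < 1 + a * z := fun z hz => hzc.pos ha hz.1
  have hfl : ContinuousOn (fun z => 8 * Real.pi * q a z * (-1 + S1 a z)
      * (S a z - z * S1 a z) / S a z) (Ico zc 0) := by
    have c0 := continuousOn_S hs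
    have c1 := continuousOn_S1 hs
    have c4 := continuousOn_q hs
    exact ContinuousOn.div (by fun_prop) c0 fun z hz => (coeff_ne_zero ha hzc hz.1 hz.2).1
  have hhl := continuousOn_div_horizonSlope ha ha' hzc hT0 hT hfl
  obtain ⟨K₁, hK₁, b₁⟩ := exists_forall_abs_le hreg
  obtain ⟨K₂, hK₂, b₂⟩ := exists_forall_abs_le hlast
  obtain ⟨K₃, hK₃, b₃⟩ := exists_forall_abs_le hf
  obtain ⟨K₄, hK₄, b₄⟩ := exists_forall_abs_le fun _ : Unit => hhl
  have hshift : HasDerivAt (fun t : ℝ => zc + t) 1 0 := by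
    simpa using (hasDerivAt_id (0 : ℝ)).const_add zc
  have hdiff : DifferentiableAt ℝ
      (fun t => lastRow a (zc + t) 4 / horizonSlope a zc (zc + t)) 0 := by
    have h1 : DifferentiableAt ℝ (fun z => lastRow a z 4 / horizonSlope a zc z) (zc + 0) := by
      rw [add_zero]
      exact (differentiableAt_lastRow ha hzc hzc0).div (differentiableAt_horizonSlope ha hzc)
        (horizonSlope_pos ha ha' hzc hzc0 le_rfl hzc0.le).ne'
    exact h1.comp (0 : ℝ) hshift.differentiableAt
  obtain ⟨K₅, hK₅, b₅⟩ := exists_abs_sub_le_mul (hlast 4) hdiff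
  have hC : ∀ (i : Fin 4) (j : Fin 5) (t : ℝ),
      C a l zc t i.castSucc j = t * Ctilde a l (zc + t) i.castSucc j := fun i j t => rfl
  have hh : ∀ (i : Fin 4) (t : ℝ), h a zc t i.castSucc = t * ftilde a (zc + t) i.castSucc :=
    fun i t => rfl
  refine ⟨K₁ + K₂ + K₃ + K₄ + K₅, hT0, by positivity, ?_, ?_, ?_, ?_, ?_, ?_, ?_, ?_, ?_, ?_⟩
  · rw [cExp_eq ha ha' l hzc hT0 hT]
    exact one_lt_horizonExponent ha ha' hzc hzc0
  · intro i j
    induction i using Fin.lastCases with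
    | last => exact ((hlast j).mono Ioc_subset_Icc_self).congr fun t ht => C_last_eq l hzc ht.1.ne' j
    | cast i => exact continuousOn_id.mul ((hreg (i, j)).mono Ioc_subset_Icc_self)
  · intro i
    induction i using Fin.lastCases with
    | last => exact (hhl.mono Ioc_subset_Icc_self).congr fun t ht => h_last_eq hzc ht.1.ne'
    | cast i => exact continuousOn_id.mul ((hf i).mono Ioc_subset_Icc_self)
  · intro i j t ht
    rw [hC, abs_mul, abs_of_pos ht.1, mul_comm]
    have := b₁ (i, j) t (Ioc_subset_Icc_self ht)
    exact mul_le_mul_of_nonneg_right (this.trans (by linarith)) ht.1.le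
  · intro j t ht
    rw [C_last_eq l hzc ht.1.ne']
    have := b₂ j.castSucc t (Ioc_subset_Icc_self ht)
    exact this.trans (by linarith)
  · intro t ht
    have := b₅ t ht
    rw [C_last_eq l hzc ht.1.ne', cExp_eq ha ha' l hzc hT0 hT, horizonExponent, abs_sub_comm]
    rw [add_zero] at this
    exact this.trans (mul_le_mul_of_nonneg_right (by linarith) ht.1.le)
  · intro i t ht
    rw [hh, abs_mul, abs_of_pos ht.1, mul_comm]
    have := b₃ i t (Ioc_subset_Icc_self ht)
    exact mul_le_mul_of_nonneg_right (this.trans (by linarith)) ht.1.le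
  · intro t ht
    rw [h_last_eq hzc ht.1.ne']
    have := b₄ () t (Ioc_subset_Icc_self ht)
    exact this.trans (by linarith)
  · exact fun j => ⟨_, tendsto_C_last ha ha' l hzc hT0 hT j.castSucc⟩
  · exact ⟨_, tendsto_nhdsGT_of_continuousOn hT0 hhl fun t ht => h_last_eq hzc ht.1.ne'⟩

theorem exists_transport (ha : 0 < a) (ha' : a < aStar) (hzc : IsCauchyHorizon a zc)
    (hT0 : 0 < T) (hT : zc + T < 0) :
    (∀ i, ContinuousOn (fun t => A a zc t i i) (Ioc 0 T)) ∧
      ∃ K, ∀ i, ∀ t ∈ Ioc 0 T, |A a zc t i i| ≤ K := by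
  have key : ∀ i, ∃ F : ℝ → ℝ, ContinuousOn F (Icc 0 T) ∧ ∀ t ∈ Ioc 0 T, A a zc t i i = F t := by
    intro i
    induction i using Fin.lastCases with
    | last =>
      refine ⟨_, (continuousOn_div_horizonSlope ha ha' hzc hT0 hT
        (F := fun _ => -1) continuousOn_const), fun t ht => ?_⟩
      refine (A_last_eq hzc ht.1.ne').trans ?_
      rw [neg_div, one_div]
    | cast i =>
      exact ⟨_, continuousOn_id.mul (continuousOn_shift hT (continuousOn_Atilde ha hzc i)),
        fun t ht => rfl⟩
  choose F hF hAF using key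
  obtain ⟨K, -, hK⟩ := exists_forall_abs_le hF
  refine ⟨fun i => ((hF i).mono Ioc_subset_Icc_self).congr (hAF i), K, fun i t ht => ?_⟩
  rw [hAF i t ht]
  exact hK i t (Ioc_subset_Icc_self ht)

theorem IsSolution.isWeakSolution {l : ℕ} {g : ℝ → ℝ} {u₀ : Lp V 1 (volume : Measure ℝ)}
    {u : ℝ → Lp V 1 (volume : Measure ℝ)} (hu : IsSolution a l zc g T u₀ u) :
    IsWeakSolution (C a l zc) (h a zc) (fun i t => A a zc t i i) T g u := by
  refine ⟨hu.continuousOn, fun i ψ hψ hs t ht => (hu.weak i ψ hψ hs t ht).congr_deriv ?_⟩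
  have hsum : ∑ j, A a zc t i j * ∫ p, u t p j * deriv ψ p
      = A a zc t i i * ∫ p, u t p i * deriv ψ p := by
    refine Finset.sum_eq_single i (fun j _ hj => ?_) (by simp)
    simp [A, Atilde, Matrix.diagonal_apply_ne _ hj.symm]
  rw [hsum]

theorem integral_coord (f : Lp V 1 (volume : Measure ℝ)) (i : Fin 5) :
    (∫ p, f p) i = ∫ p, f p i :=
  ((EuclideanSpace.proj i : V →L[ℝ] ℝ).integral_comp_comm (L1.integrable_coeFn f)).symm

theorem Solves.add_sum_smul {C : ℝ → Matrix (Fin 5) (Fin 5) ℝ} {h : ℝ → Fin 5 → ℝ} {G : ℝ}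
    {χ : ℝ → V} {φ : Fin 5 → ℝ → V} (hχ : Solves C h T G χ) (hφ : ∀ i, Solves C h T 0 (φ i))
    (d : Fin 5 → ℝ) (s : Finset (Fin 5)) :
    Solves C h T G (fun t => χ t + ∑ i ∈ s, d i • φ i t) := by
  induction s using Finset.induction_on with
  | empty => simpa using hχ
  | insert i s hi ih =>
    have h1 := ih.add_smul (hφ i) (d i)
    simp only [mul_zero, add_zero] at h1
    convert h1 using 2 with t
    rw [Finset.sum_insert hi]
    abel

end Instance

end LTB

end

/-! ### The blow-up theorem -/

theorem mainTheorem3 (a : ℝ) (ha : 0 < a) (ha' : a < LTB.aStar) (l : ℕ)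
    (zc : ℝ) (hzc : LTB.IsCauchyHorizon a zc)
    (t₁ : ℝ) (ht₁ : 0 < t₁) (ht₁' : zc + t₁ < 0)
    (g : ℝ → ℝ) (hg : ContDiff ℝ ∞ g) (hg' : HasCompactSupport g)
    (u₀ : Lp LTB.V 1 (volume : Measure ℝ)) (hu₀ : u₀ ∈ LTB.SDoublePrime a l zc g t₁)
    (u : ℝ → Lp LTB.V 1 (volume : Measure ℝ)) (hu : LTB.IsSolution a l zc g t₁ u₀ u)
    (r : ENNReal) (hr : 1 ≤ r) :
    Tendsto (fun t => eLpNorm (u t) r volume) (𝓝[>] 0) (𝓝 ⊤) := by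
  obtain ⟨K, H⟩ := LTB.exists_regularSingular ha ha' l hzc ht₁ ht₁'
  obtain ⟨hAc, K', hAb⟩ := LTB.exists_transport ha ha' hzc ht₁ ht₁'
  obtain ⟨φ, χ, hφ, hχ, hli, hfin, hfinχ, hdiv⟩ := H.exists_fundamental (∫ p, g p)
  have hspan := hli.span_eq_top_of_card_eq_finrank (by simp)
  obtain ⟨d, hd⟩ := (Submodule.mem_span_range_iff_exists_fun ℝ).1
    (hspan ▸ Submodule.mem_top : (∫ p, u₀ p) - χ t₁ ∈ Submodule.span ℝ (range fun i => φ i t₁))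
  -- `SPrime` asks only for some fundamental system, so the one just constructed would already be a
  -- witness.
  have hd4 : d 4 ≠ 0 := fun h4 => hu₀
    ⟨φ, χ, d, ⟨hφ, hχ, hli, hfin, hfinχ, hdiv⟩, by rw [hd]; abel, h4⟩
  set c := LTB.cExp a l zc
  have hc := H.one_lt
  have hpow : Tendsto (fun t : ℝ => t ^ c) (𝓝[>] 0) (𝓝 0) := by
    have := (Real.continuousAt_rpow_const 0 c (Or.inr (by linarith))).tendsto
    rw [Real.zero_rpow (by linarith)] at this
    exact this.mono_left nhdsWithin_le_nhds
  have hlim : ∀ {f : ℝ → LTB.V}, (∃ v, Tendsto f (𝓝[>] 0) (𝓝 v)) →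
      Tendsto (fun t => t ^ c * f t 4) (𝓝[>] 0) (𝓝 0) := by
    rintro f ⟨v, hv⟩
    have h1 := ((EuclideanSpace.proj 4 : LTB.V →L[ℝ] ℝ).continuous.tendsto v).comp hv
    simpa using hpow.mul h1
  have hφ4 : Tendsto (fun t => t ^ c * φ 4 t 4) (𝓝[>] 0) (𝓝 1) := by
    have h1 := ((EuclideanSpace.proj 4 : LTB.V →L[ℝ] ℝ).continuous.tendsto _).comp hdiv
    simpa [Function.comp_def] using h1
  set x : ℝ → LTB.V := fun t => χ t + ∑ i, d i • φ i t with hx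
  have hxs : LTB.Solves (LTB.C a l zc) (LTB.h a zc) t₁ (∫ p, g p) x :=
    LTB.Solves.add_sum_smul hχ hφ d Finset.univ
  have hxd : Tendsto (fun t => t ^ c * x t 4) (𝓝[>] 0) (𝓝 (d 4)) := by
    have h1 : ∀ i, Tendsto (fun t => t ^ c * φ i t 4) (𝓝[>] 0) (𝓝 (if i = 4 then 1 else 0)) := by
      intro i
      split_ifs with hi
      · rw [hi]
        exact hφ4
      · exact hlim (hfin i hi)
    have h2 := (hlim hfinχ).add (tendsto_finsetSum Finset.univ fun i _ => (h1 i).const_mul (d i))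
    simp only [mul_ite, mul_one, mul_zero, Finset.sum_ite_eq', Finset.mem_univ, if_true,
      zero_add] at h2
    refine h2.congr fun t => ?_
    simp only [hx, PiLp.add_apply, WithLp.ofLp_sum, Finset.sum_apply, PiLp.smul_apply, smul_eq_mul,
      mul_add, Finset.mul_sum]
    congr 1
    exact Finset.sum_congr rfl fun i _ => by ring
  refine hu.isWeakSolution.tendsto_eLpNorm_top H hAc hAb hg.continuous hg' hxs (fun i => ?_) hd4 hxd hr
  rw [hu.initial, ← LTB.integral_coord, hx]
  simp only [hd, add_sub_cancel]
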